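/- Let $p$ be an odd prime with $p\equiv 1 \pmod 4$, and write $p-1=2^{n-1}t$ with $t$ odd and $n\ge 3$. Let $r$ be a primitive root modulo $p$ and let $k,q$ be integers with $r^t\equiv -kq \pmod p$. Let $G=G_{p^32^n}$ be the group with generators $x,y,z,w$ and relations $$x^p=y^p=z^p=w^{2^n}=e,\quad xy=yx,\quad yz=zyx,\quad xz=zx,\quad w^{-1}xw=x^{r^t},\quad w^{-1}yw=z^k,\quad w^{-1}zw=y^q$$ (the semidirect product of the extraspecial group $P=\langle x,y,z\rangle$ of order $p^3$ with the cyclic group $\langle w\rangle$ of order $2^n$), and let $Q=\langle x,y,w^{2^{n-1}}\rangle$. Definitions, for a finite group $G$. A pair $(H,K)$ of subgroups of $G$ is a *Shoda pair* if $K\trianglelefteq H$, $H/K$ is cyclic, and every $g\in G$ with $[H,g]\cap H\subseteq K$ lies in $H$, where $[H,g]=\langle g^{-1}h^{-1}gh : h\in H\rangle$. For an irreducible complex character $\chi$ of a finite group $M$ put $e_{\mathbb Q}(\chi)=\frac{\chi(1)}{|M|}\sum_{\sigma\in \mathrm{Gal}(\mathbb Q(\chi)/\mathbb Q)}\sum_{m\in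 M}\sigma(\chi(m))\,m^{-1}\in\mathbb QM$. Two Shoda pairs $(H_1,K_1)$, $(H_2,K_2)$ are *equivalent* if $e_{\mathbb Q}(\lambda_1^G)=e_{\mathbb Q}(\lambda_2^G)$, where $\lambda_i$ is a linear character of $H_i$ with kernel $K_i$ (the choice of $\lambda_i$ does not matter). A *complete and irredundant set of Shoda pairs* is a set of representatives of the distinct equivalence classes of Shoda pairs of $G$. A Shoda pair $(H,K)$ is a *generalized strong Shoda pair* if there is a chain $H=H_0\le H_1\le\dots\le H_m=G$ of subgroups such that, for a linear character $\lambda$ of $H$ with kernel $K$ and all $0\le i<m$, one has $H_i\trianglelefteq \mathrm{Cen}_{H_{i+1}}(e_{\mathbb Q}(\lambda^{H_i}))$ and the distinct $H_{i+1}$-conjugates of $e_{\mathbb Q}(\lambda^{H_i})$ are mutually orthogonal. $G$ is *generalized strongly monomial* if every irreducible complex character of $G$ is of the form $\lambda^G$ for a linear character $\lambda$ of $H$ with kernel $K$, for some generalized strong Shoda pair $(H,K)$ of $G$. Theorem. Let $J'\subseteq\{1,\dots,p-1\}$ contain exactly one $j$ from each class of the relation "$\langle x,z^iy\rangle$ and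 $\langle x,z^jy\rangle$ are conjugate in $G$" on $\{1,\dots,p-1\}$, and let $J=\{0\}\cup J'$. Then $|J|=\frac{p+1}{2}$, the group $G=G_{p^32^n}$ is generalized strongly monomial, and the following pairs, which are pairwise distinct, form a complete and irredundant set of Shoda pairs of $G$: 1. $(G,\langle P,w^{2^i}\rangle)$, $0\le i\le n$; 2. $(P,\langle x,z^jy\rangle)$, $j\in J$; 3. $(Q,\langle y\rangle)$ and $(Q,\langle y,w^{2^{n-1}}\rangle)$. -/

import Mathlib

noncomputable section

open scoped Classical in
/-- For subgroups `H ≤ M` of a finite group and a linear character `lam` of `H`, the induced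
character `lam^M : M → ℂ`,
`lam^M (m) = |H|⁻¹ * ∑ t ∈ M with t⁻¹ m t ∈ H, lam (t⁻¹ m t)`. -/
def inducedChar {G : Type*} [Group G] [Finite G] (H M : Subgroup G) (lam : H →* ℂˣ) (m : M) : ℂ :=
  (Nat.card H : ℂ)⁻¹ *
    ∑ᶠ t : M, if h : (t : G)⁻¹ * (m : G) * (t : G) ∈ H then (lam ⟨_, h⟩ : ℂ) else 0

/-- `charField χ = ℚ(χ)`, the field generated over `ℚ` by the values of `χ`. -/
abbrev charField {X : Type*} (χ : X → ℂ) : IntermediateField ℚ ℂ :=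
  IntermediateField.adjoin ℚ (Set.range χ)

/-- A value of `χ`, as an element of `ℚ(χ)`. -/
def charValue {X : Type*} (χ : X → ℂ) (a : X) : charField χ :=
  ⟨χ a, IntermediateField.subset_adjoin ℚ _ ⟨a, rfl⟩⟩

/-- For an irreducible character `χ` of a subgroup `M` of `G`, the primitive central idempotent
`e_ℚ(χ) = (χ(1) / |M|) * ∑ m ∈ M, (∑ σ ∈ Gal(ℚ(χ)/ℚ), σ (χ m)) m⁻¹`
of `ℚM`, regarded as an element of `ℚG`. The field `ℚ(χ)` is Galois over `ℚ` (it lies in a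
cyclotomic field), so the inner sum is the trace of `χ m`; the rational factor `χ(1)` has been
moved under the trace. -/
def rationalIdempotent {G : Type*} [Group G] [Finite G] (M : Subgroup G) (χ : M → ℂ) :
    MonoidAlgebra ℚ G :=
  ∑ᶠ m : M, MonoidAlgebra.single ((m : G)⁻¹)
    ((Nat.card M : ℚ)⁻¹ *
      Algebra.trace ℚ (charField χ) (charValue χ 1 * charValue χ m))

/-- `(H, K)` is a Shoda pair of `G`: `K` is normal in `H` with `H / K` cyclic, and every `g` with
`[H, g] ∩ H ⊆ K` lies in `H`, where `[H, g] = ⟨g⁻¹ h⁻¹ g h : h ∈ H⟩`. -/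
structure IsShodaPair {G : Type*} [Group G] [Finite G] (H K : Subgroup G) : Prop where
  le : K ≤ H
  cyclic_quotient : ∃ _ : (K.subgroupOf H).Normal, IsCyclic (H ⧸ K.subgroupOf H)
  mem_of_commutator_le : ∀ g : G,
    Subgroup.closure {a : G | ∃ h ∈ H, a = g⁻¹ * h⁻¹ * g * h} ⊓ H ≤ K → g ∈ H

/-- The linear character `lam` of `H` has kernel `K` (a subgroup of `G`). -/
def HasKernel {G : Type*} [Group G] (H K : Subgroup G) (lam : H →* ℂˣ) : Prop :=
  lam.ker.map H.subtype = K

/-- `e` is the idempotent `e_ℚ(lam^G)`, for a linear character `lam` of `H` with kernel `K`. -/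
def RealizesIdempotent {G : Type*} [Group G] [Finite G] (H K : Subgroup G)
    (e : MonoidAlgebra ℚ G) : Prop :=
  ∃ lam : H →* ℂˣ, HasKernel H K lam ∧ e = rationalIdempotent ⊤ (inducedChar H ⊤ lam)

/-- Two Shoda pairs are equivalent if they realize the same primitive central idempotent
of `ℚG`. -/
def ShodaEquivalent {G : Type*} [Group G] [Finite G] (s s' : Subgroup G × Subgroup G) : Prop :=
  ∃ e : MonoidAlgebra ℚ G, RealizesIdempotent s.1 s.2 e ∧ RealizesIdempotent s'.1 s'.2 e

/-- A set of representatives of the distinct equivalence classes of Shoda pairs of `G`. -/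
structure IsCompleteIrredundantShodaSet {G : Type*} [Group G] [Finite G]
    (S : Set (Subgroup G × Subgroup G)) : Prop where
  isShodaPair : ∀ s ∈ S, IsShodaPair s.1 s.2
  complete : ∀ H K : Subgroup G, IsShodaPair H K → ∃ s ∈ S, ShodaEquivalent (H, K) s
  irredundant : S.Pairwise fun s s' => ¬ ShodaEquivalent s s'

/-- The conjugate `e^g = g⁻¹ e g` of an element of the rational group algebra. -/
def conjElt {G : Type*} [Group G] (e : MonoidAlgebra ℚ G) (g : G) : MonoidAlgebra ℚ G :=
  MonoidAlgebra.of ℚ G g⁻¹ * e * MonoidAlgebra.of ℚ G g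

lemma conjElt_one {G : Type*} [Group G] (e : MonoidAlgebra ℚ G) : conjElt e 1 = e := by
  simp [conjElt, ← MonoidAlgebra.one_def]

lemma conjElt_mul {G : Type*} [Group G] (e : MonoidAlgebra ℚ G) (a b : G) :
    conjElt e (a * b) = conjElt (conjElt e a) b := by
  unfold conjElt
  rw [mul_inv_rev, map_mul, map_mul]
  simp only [mul_assoc]

/-- `Cen_M(e)`, the subgroup of those `g ∈ M` with `g⁻¹ e g = e`. -/
def cenIn {G : Type*} [Group G] (M : Subgroup G) (e : MonoidAlgebra ℚ G) : Subgroup G where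
  carrier := {g | g ∈ M ∧ conjElt e g = e}
  one_mem' := ⟨M.one_mem, conjElt_one e⟩
  mul_mem' := fun {a b} ha hb => ⟨M.mul_mem ha.1 hb.1, by rw [conjElt_mul, ha.2, hb.2]⟩
  inv_mem' := fun {a} ha => ⟨M.inv_mem ha.1, by
    conv_lhs => rw [← ha.2]
    rw [← conjElt_mul, mul_inv_cancel, conjElt_one]⟩

/-- `H = C 0 ≤ C 1 ≤ ⋯ ≤ C m = G` is a strong inductive chain for the linear character `lam`
of `H`: for all `i < m`, with `e = e_ℚ(lam^(C i))`,
the subgroup `C i` is normal in `Cen_(C (i+1)) (e)`, and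
the distinct `C (i+1)`-conjugates of `e` are mutually orthogonal. -/
structure IsStrongInductiveChain {G : Type*} [Group G] [Finite G] (H : Subgroup G)
    (lam : H →* ℂˣ) (m : ℕ) (C : ℕ → Subgroup G) : Prop where
  bot_eq : C 0 = H
  top_eq : C m = ⊤
  le_succ : ∀ i < m, C i ≤ C (i + 1)
  le_cen : ∀ i < m,
    C i ≤ cenIn (C (i + 1)) (rationalIdempotent (C i) (inducedChar H (C i) lam))
  normal_in_cen : ∀ i < m,
    ((C i).subgroupOf
      (cenIn (C (i + 1)) (rationalIdempotent (C i) (inducedChar H (C i) lam)))).Normal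
  orthogonal : ∀ i < m, ∀ g ∈ C (i + 1), ∀ g' ∈ C (i + 1),
    conjElt (rationalIdempotent (C i) (inducedChar H (C i) lam)) g ≠
      conjElt (rationalIdempotent (C i) (inducedChar H (C i) lam)) g' →
    conjElt (rationalIdempotent (C i) (inducedChar H (C i) lam)) g *
      conjElt (rationalIdempotent (C i) (inducedChar H (C i) lam)) g' = 0

/-- A generalized strong Shoda pair: a Shoda pair `(H, K)` with a chain from `H` to `G` that is a
strong inductive chain for the linear characters of `H` with kernel `K`. -/
def IsGeneralizedStrongShodaPair {G : Type*} [Group G] [Finite G] (H K : Subgroup G) : Prop :=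
  IsShodaPair H K ∧ ∃ (m : ℕ) (C : ℕ → Subgroup G),
    ∀ lam : H →* ℂˣ, HasKernel H K lam → IsStrongInductiveChain H lam m C

/-- A character of `G` that is induced from a linear character of `H` with kernel `K`, for some
generalized strong Shoda pair `(H, K)` of `G`. -/
def IsGeneralizedStronglyMonomialChar {G : Type*} [Group G] [Finite G] (χ : G → ℂ) : Prop :=
  ∃ H K : Subgroup G, IsGeneralizedStrongShodaPair H K ∧
    ∃ lam : H →* ℂˣ, HasKernel H K lam ∧
      ∀ g : G, χ g = inducedChar H ⊤ lam ⟨g, Subgroup.mem_top g⟩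

/-- Every irreducible complex character of `G` is generalized strongly monomial. -/
def IsGeneralizedStronglyMonomialGroup (G : Type*) [Group G] [Finite G] : Prop :=
  ∀ (V : Type) [AddCommGroup V] [Module ℂ V] [FiniteDimensional ℂ V] (ρ : Representation ℂ G V),
    ρ.IsIrreducible → IsGeneralizedStronglyMonomialChar ρ.character

/-- The names of the four generators. -/
inductive GenName : Type
  | x | y | z | w

/-- The defining relations (an equation `a = b` is encoded as `a * b⁻¹`):
`x^p = y^p = z^p = w^(2^n) = 1`, `x y = y x`, `y z = z y x`, `x z = z x`,
`w⁻¹ x w = x^(r^t)`, `w⁻¹ y w = z^k`, `w⁻¹ z w = y^q`. -/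
def gpRels (p n t : ℕ) (r k q : ℤ) : Set (FreeGroup GenName) :=
  let x := FreeGroup.of GenName.x
  let y := FreeGroup.of GenName.y
  let z := FreeGroup.of GenName.z
  let w := FreeGroup.of GenName.w
  { x ^ p, y ^ p, z ^ p, w ^ (2 ^ n),
    (x * y) * (y * x)⁻¹, (y * z) * (z * y * x)⁻¹, (x * z) * (z * x)⁻¹,
    (w⁻¹ * x * w) * (x ^ (r ^ t))⁻¹, (w⁻¹ * y * w) * (z ^ k)⁻¹, (w⁻¹ * z * w) * (y ^ q)⁻¹ }

/-- The group `G_{p^3 2^n}`: the semidirect product of the extraspecial group `P = ⟨x, y, z⟩` of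
order `p^3` with the cyclic group `⟨w⟩` of order `2^n`, given by its presentation. -/
abbrev Gp (p n t : ℕ) (r k q : ℤ) : Type := PresentedGroup (gpRels p n t r k q)

namespace Gp

variable (p n t : ℕ) (r k q : ℤ)

def x : Gp p n t r k q := PresentedGroup.of GenName.x

def y : Gp p n t r k q := PresentedGroup.of GenName.y

def z : Gp p n t r k q := PresentedGroup.of GenName.z

def w : Gp p n t r k q := PresentedGroup.of GenName.w

/-- The order is finite: every element has the form `w^d x^a y^b z^c`. -/
instance instFinite [NeZero p] : Finite (Gp p n t r k q) := by
  set x := x p n t r k q with hx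
  set y := y p n t r k q with hy
  set z := z p n t r k q with hz
  set w := w p n t r k q with hw
  have one {a : FreeGroup GenName} (h : a ∈ gpRels p n t r k q) :
      PresentedGroup.mk (gpRels p n t r k q) a = 1 := PresentedGroup.one_of_mem h
  have eq {a b : FreeGroup GenName} (h : a * b⁻¹ ∈ gpRels p n t r k q) :
      PresentedGroup.mk (gpRels p n t r k q) a = PresentedGroup.mk (gpRels p n t r k q) b :=
    PresentedGroup.mk_eq_mk_of_mul_inv_mem h
  have hxp : x ^ p = 1 := one (by simp [gpRels])
  have hyp : y ^ p = 1 := one (by simp [gpRels])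
  have hzp : z ^ p = 1 := one (by simp [gpRels])
  have hwp : w ^ (2 ^ n) = 1 := one (by simp [gpRels])
  have hxy : x * y = y * x := eq (by simp [gpRels])
  have hyz : y * z = z * y * x := eq (by simp [gpRels])
  have hxz : x * z = z * x := eq (by simp [gpRels])
  have hxw : w⁻¹ * x * w = x ^ (r ^ t) := eq (by simp [gpRels])
  have hyw : w⁻¹ * y * w = z ^ k := eq (by simp [gpRels])
  have hzw : w⁻¹ * z * w = y ^ q := eq (by simp [gpRels])
  have cxy : Commute x y := hxy
  have cxz : Commute x z := hxz
  have conj (g a : Gp p n t r k q) (m : ℤ) : g⁻¹ * a ^ m * g = (g⁻¹ * a * g) ^ m := by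
    have := conj_zpow (a := g⁻¹) (b := a) (i := m)
    rw [inv_inv] at this
    exact this.symm
  have h1 (l : ℤ) : z⁻¹ * y ^ l * z = y ^ l * x ^ l := by
    rw [conj, show z⁻¹ * y * z = y * x by rw [mul_assoc, hyz]; group, cxy.symm.mul_zpow]
  have h2 (l : ℤ) : (y ^ l)⁻¹ * z * y ^ l = z * x ^ (-l) := by
    have h := h1 l
    have h3 : y ^ l * z = z * (y ^ l * x ^ l) := by rw [← h]; group
    have h4 : z * y ^ l = y ^ l * z * x ^ (-l) := by rw [h3]; group
    rw [mul_assoc, h4]; group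
  have h5 (l m : ℤ) : z ^ m * y ^ l = x ^ (-l * m) * y ^ l * z ^ m := by
    have h := conj (y ^ l) z m
    rw [h2, (cxz.symm.zpow_right (-l)).mul_zpow, ← zpow_mul] at h
    have h6 : z ^ m * y ^ l = y ^ l * (z ^ m * x ^ (-l * m)) := by rw [← h]; group
    rw [h6, ((cxz.zpow_zpow (-l * m) m).symm).eq, ← mul_assoc,
      ((cxy.zpow_zpow (-l * m) l).symm).eq]
  have fin {g : Gp p n t r k q} {N : ℕ} (hN : 0 < N) (h : g ^ N = 1) :
      (Subgroup.zpowers g : Set (Gp p n t r k q)).Finite := by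
    have : IsOfFinOrder g := isOfFinOrder_iff_pow_eq_one.mpr ⟨N, hN, h⟩
    exact this.finite_zpowers
  have hp : 0 < p := Nat.pos_of_ne_zero (NeZero.ne p)
  let S : Set (Gp p n t r k q) := {g | ∃ d a b c : ℤ, g = w ^ d * x ^ a * y ^ b * z ^ c}
  have hS : S.Finite := by
    refine Set.Finite.subset ((((fin (by positivity) hwp).image2 (· * ·) (fin hp hxp)).image2
      (· * ·) (fin hp hyp)).image2 (· * ·) (fin hp hzp)) ?_
    rintro g ⟨d, a, b, c, rfl⟩
    exact ⟨_, ⟨_, ⟨_, ⟨d, rfl⟩, _, ⟨a, rfl⟩, rfl⟩, _, ⟨b, rfl⟩, rfl⟩, _, ⟨c, rfl⟩, rfl⟩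
  have mz : ∀ g ∈ S, g * z ∈ S := by
    rintro g ⟨d, a, b, c, rfl⟩
    exact ⟨d, a, b, c + 1, by rw [zpow_add_one]; group⟩
  have my : ∀ g ∈ S, g * y ∈ S := by
    rintro g ⟨d, a, b, c, rfl⟩
    refine ⟨d, a + -c, b + 1, c, ?_⟩
    have h := h5 1 c
    rw [zpow_one, neg_one_mul] at h
    rw [mul_assoc, h, zpow_add, zpow_add_one]
    simp only [mul_assoc]
    rw [← mul_assoc (y ^ b) (x ^ (-c)), ← (cxy.zpow_zpow (-c) b).eq]
    simp only [mul_assoc]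
  have mx : ∀ g ∈ S, g * x ∈ S := by
    rintro g ⟨d, a, b, c, rfl⟩
    refine ⟨d, a + 1, b, c, ?_⟩
    rw [mul_assoc, ← (cxz.zpow_right c).eq, ← mul_assoc, mul_assoc _ (y ^ b) x,
      ← (cxy.zpow_right b).eq, zpow_add_one]
    simp only [mul_assoc]
  have mw : ∀ g ∈ S, g * w ∈ S := by
    rintro g ⟨d, a, b, c, rfl⟩
    refine ⟨d + 1, r ^ t * a + -(q * c) * (k * b), q * c, k * b, ?_⟩
    have hx' : x ^ a * w = w * x ^ (r ^ t * a) := by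
      rw [zpow_mul, ← hxw, ← conj]; group
    have hy' : y ^ b * w = w * z ^ (k * b) := by
      rw [zpow_mul, ← hyw, ← conj]; group
    have hz' : z ^ c * w = w * y ^ (q * c) := by
      rw [zpow_mul, ← hzw, ← conj]; group
    rw [mul_assoc, hz', ← mul_assoc, mul_assoc _ (y ^ b) w, hy', ← mul_assoc,
      mul_assoc _ (x ^ a) w, hx', mul_assoc _ (z ^ _) (y ^ _), h5, zpow_add x, zpow_add_one w]
    simp only [mul_assoc]
  have mpow {v : Gp p n t r k q} (hv : ∀ g ∈ S, g * v ∈ S) (N : ℕ) : ∀ g ∈ S, g * v ^ N ∈ S := by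
    induction N with
    | zero => intro g hg; simpa using hg
    | succ N ih => intro g hg; rw [pow_succ, ← mul_assoc]; exact hv _ (ih g hg)
  have minv {v : Gp p n t r k q} {N : ℕ} (hN : 0 < N) (h : v ^ N = 1)
      (hv : ∀ g ∈ S, g * v ∈ S) : ∀ g ∈ S, g * v⁻¹ ∈ S := by
    have : v⁻¹ = v ^ (N - 1) := by
      rw [inv_eq_iff_mul_eq_one, ← pow_succ', Nat.sub_add_cancel hN, h]
    rw [this]
    exact mpow hv _
  have h2n : 0 < 2 ^ n := by positivity
  have all : ∀ g : Gp p n t r k q, g ∈ S := by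
    intro g
    have hg : g ∈ Subgroup.closure
        (Set.range (PresentedGroup.of : GenName → Gp p n t r k q)) := by
      rw [PresentedGroup.closure_range_of]; exact Subgroup.mem_top g
    refine Subgroup.closure_induction_right (p := fun g _ => g ∈ S) ⟨0, 0, 0, 0, by simp⟩ ?_ ?_ hg
    · rintro g _ _ ⟨i, rfl⟩ h
      cases i
      · exact mx g h
      · exact my g h
      · exact mz g h
      · exact mw g h
    · rintro g _ _ ⟨i, rfl⟩ h
      cases i
      · exact minv hp hxp mx g h
      · exact minv hp hyp my g h
      · exact minv hp hzp mz g h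
      · exact minv h2n hwp mw g h
  exact Set.finite_univ_iff.mp (hS.subset fun g _ => all g)

/-- `P = ⟨x, y, z⟩`. -/
def P : Subgroup (Gp p n t r k q) :=
  Subgroup.closure {x p n t r k q, y p n t r k q, z p n t r k q}

/-- `Q = ⟨x, y, w^(2^(n-1))⟩`. -/
def Q : Subgroup (Gp p n t r k q) :=
  Subgroup.closure {x p n t r k q, y p n t r k q, w p n t r k q ^ (2 ^ (n - 1))}

/-- `⟨P, w^(2^i)⟩`. -/
def PW (i : ℕ) : Subgroup (Gp p n t r k q) :=
  P p n t r k q ⊔ Subgroup.zpowers (w p n t r k q ^ (2 ^ i))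

/-- `⟨x, z^j y⟩`. -/
def XZY (j : ℕ) : Subgroup (Gp p n t r k q) :=
  Subgroup.closure {x p n t r k q, z p n t r k q ^ j * y p n t r k q}

/-- `J'` consists of one `j` from each class of `{1, …, p - 1}` under the relation
"`⟨x, z^i y⟩` and `⟨x, z^j y⟩` are conjugate in `G`". -/
def IsTransversal (J' : Finset ℕ) : Prop :=
  J' ⊆ Finset.Icc 1 (p - 1) ∧
    ∀ j ∈ Finset.Icc 1 (p - 1), ∃! i, i ∈ J' ∧
      ∃ g : Gp p n t r k q,
        (XZY p n t r k q j).map (MulAut.conj g).toMonoidHom = XZY p n t r k q i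

/-- The pairs `(G, ⟨P, w^(2^i)⟩)` for `0 ≤ i ≤ n`, the pairs `(P, ⟨x, z^j y⟩)` for `j ∈ J`, and
`(Q, ⟨y⟩)`, `(Q, ⟨y, w^(2^(n-1))⟩)`. -/
def pairs (J : Finset ℕ) : Set (Subgroup (Gp p n t r k q) × Subgroup (Gp p n t r k q)) :=
  {s | ∃ i ≤ n, s = (⊤, PW p n t r k q i)} ∪
  {s | ∃ j ∈ J, s = (P p n t r k q, XZY p n t r k q j)} ∪
  {(Q p n t r k q, Subgroup.closure {y p n t r k q}),
   (Q p n t r k q, Subgroup.closure {y p n t r k q, w p n t r k q ^ (2 ^ (n - 1))})}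

end Gp

end

/-! Everything is computed in coordinates `X a * Y b * Z c * w ^ d`, collected in `HeisenbergFrame`.
Let `α = r^t`, an element of order `2^(n-1)` modulo `p`. Modulo the centre `⟨x⟩` of `P`, the element
`w²` acts on `P` as the scalar `-α`, and `v = w^(2^(n-1))` fixes `x` and acts as `-1`. The
presentation does not collapse because `P` has a permutation model and the exponent of `w` is a
homomorphism.

Irreducible characters. By Frobenius reciprocity and Mackey's criterion (`norm_indChar`), an
irreducible representation with a vector on which `H` acts by `lam` has character `lam^G`, provided
`(H, K)` satisfies `Separates` (`character_eq_indChar`). So characters are recognised by common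
eigenvectors. Take an eigenvector of `x`. If `x` acts trivially, `P` acts through an abelian group.
Either `P` acts trivially and an eigenvector of `w` gives a pair `(G, ⟨P, w^(2^i)⟩)`, or `P` acts on
some vector by a nontrivial character, whose kernel is a line modulo `⟨x⟩`; the one line without a
slope is moved by `w` to slope `0`. If `x` acts nontrivially, a power of `z` moves the vector to one
fixed by `y`, and an eigenvalue `±1` of `v` selects one of the two pairs for `Q`
(`exists_listed_eigenvector`).

Completeness. The Shoda condition involves the subgroup generated by commutators, so it is formally
weaker than Mackey's; for this `G` it nevertheless implies Mackey's (`separates_of_isShodaPair`).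
Hence a Shoda pair induces the character of an irreducible representation, which also contains a
listed eigenvector, and the idempotents agree.

Irredundancy. The idempotent determines which subgroups `A` have nonzero fixed vectors, a condition
on `(H, K)` alone (`HasFixed`). Testing on `P`, `⟨P, w^(2^i)⟩`, the lines and `⟨y, v⟩` separates the
listed pairs (`eq_of_hasFixed_iff`). Slopes `i`, `j` are conjugate exactly when `i = j` or `q i j =
k`. As `q s² = k` has no solution (`mul_self_ne`), the nonzero slopes fall into classes of size two,
so `J` has `(p + 1) / 2` elements.

Strong chains. These are `G` alone, `P ≤ G` and `Q ≤ ⟨P, v⟩ ≤ G`. A conjugate of the idempotent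
either equals it, or the conjugating element carries something outside the kernel into the kernel,
and then the product is zero. At `⟨P, v⟩` all conjugates coincide, since primitive `p`-th roots of
unity have equal traces. -/

/-! ### Induced linear characters and Mackey's criterion -/

section InducedCharacters

open scoped Classical in
/-- A linear character of `H`, extended by zero to `G`. -/
noncomputable def extendZero {G : Type*} [Group G] (H : Subgroup G) (lam : H →* ℂˣ) (g : G) : ℂ :=
  if h : g ∈ H then (lam ⟨g, h⟩ : ℂ) else 0

/-- The character of `G` induced from a linear character of `H`. -/
noncomputable def indChar {G : Type*} [Group G] [Finite G] (H : Subgroup G) (lam : H →* ℂˣ)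
    (g : G) : ℂ :=
  inducedChar H ⊤ lam ⟨g, Subgroup.mem_top g⟩

lemma extendZero_of_mem {G : Type*} [Group G] {H : Subgroup G} (lam : H →* ℂˣ) {g : G}
    (h : g ∈ H) : extendZero H lam g = lam ⟨g, h⟩ := dif_pos h

lemma extendZero_of_notMem {G : Type*} [Group G] {H : Subgroup G} (lam : H →* ℂˣ) {g : G}
    (h : g ∉ H) : extendZero H lam g = 0 := dif_neg h

lemma extendZero_mul {G : Type*} [Group G] {H : Subgroup G} (lam : H →* ℂˣ) {a b : G}
    (hb : b ∈ H) : extendZero H lam (a * b) = extendZero H lam a * extendZero H lam b := by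
  by_cases ha : a ∈ H
  · rw [extendZero_of_mem lam ha, extendZero_of_mem lam hb, extendZero_of_mem lam (H.mul_mem ha hb),
      ← Units.val_mul, ← map_mul]
    rfl
  · rw [extendZero_of_notMem lam ha, extendZero_of_notMem lam, zero_mul]
    rwa [H.mul_mem_cancel_right hb]

lemma extendZero_one {G : Type*} [Group G] {H : Subgroup G} (lam : H →* ℂˣ) :
    extendZero H lam 1 = 1 := by
  rw [extendZero_of_mem lam H.one_mem]
  have : (⟨1, H.one_mem⟩ : H) = 1 := rfl
  rw [this, map_one, Units.val_one]

lemma extendZero_ne_zero {G : Type*} [Group G] {H : Subgroup G} (lam : H →* ℂˣ) {a : G}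
    (ha : a ∈ H) : extendZero H lam a ≠ 0 := by
  rw [extendZero_of_mem lam ha]; exact Units.ne_zero _

lemma extendZero_conj_of_mem {G : Type*} [Group G] {H : Subgroup G} (lam : H →* ℂˣ) {a t : G}
    (ht : t ∈ H) : extendZero H lam (t⁻¹ * a * t) = extendZero H lam a := by
  rw [extendZero_mul lam ht]
  by_cases ha : a ∈ H
  · rw [extendZero_mul lam ha, mul_right_comm, ← extendZero_mul lam ht, inv_mul_cancel,
      extendZero_one, one_mul]
  · rw [extendZero_of_notMem lam ha, extendZero_of_notMem lam, zero_mul]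
    rwa [H.mul_mem_cancel_left (H.inv_mem ht)]

lemma extendZero_inv {G : Type*} [Group G] [Finite G] {H : Subgroup G} (lam : H →* ℂˣ) (a : G) :
    extendZero H lam a⁻¹ = (starRingEnd ℂ) (extendZero H lam a) := by
  by_cases ha : a ∈ H
  · have h1 : extendZero H lam a⁻¹ * extendZero H lam a = 1 := by
      rw [← extendZero_mul lam ha, inv_mul_cancel, extendZero_one]
    have h2 : ‖extendZero H lam a‖ = 1 := by
      rw [extendZero_of_mem lam ha]
      refine Complex.norm_eq_one_of_pow_eq_one (n := Nat.card H) ?_ Nat.card_pos.ne'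
      rw [← Units.val_pow_eq_pow_val, ← map_pow, pow_card_eq_one', map_one, Units.val_one]
    have h3 : (starRingEnd ℂ) (extendZero H lam a) * extendZero H lam a = 1 := by
      rw [mul_comm, Complex.mul_conj, Complex.normSq_eq_norm_sq, h2]; simp
    exact mul_right_cancel₀ (extendZero_ne_zero lam ha) (h1.trans h3.symm)
  · rw [extendZero_of_notMem lam ha, extendZero_of_notMem lam (by rwa [H.inv_mem_iff]), map_zero]

lemma hasKernel_iff {G : Type*} [Group G] {H K : Subgroup G} {lam : H →* ℂˣ} :
    HasKernel H K lam ↔ ∀ a, a ∈ K ↔ extendZero H lam a = 1 := by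
  have key : ∀ a, a ∈ lam.ker.map H.subtype ↔ extendZero H lam a = 1 := by
    intro a
    constructor
    · rintro ⟨⟨b, hb⟩, h, rfl⟩
      rw [Subgroup.subtype_apply, extendZero_of_mem lam hb]
      rw [SetLike.mem_coe, MonoidHom.mem_ker] at h
      rw [h, Units.val_one]
    · intro h
      by_cases ha : a ∈ H
      · rw [extendZero_of_mem lam ha] at h
        exact ⟨⟨a, ha⟩, Units.ext h, rfl⟩
      · rw [extendZero_of_notMem lam ha] at h
        exact absurd h zero_ne_one
  constructor
  · rintro rfl; exact key
  · intro h
    ext a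
    rw [key, h]

lemma inducedChar_eq_sum {G : Type*} [Group G] [Fintype G] (H M : Subgroup G) (lam : H →* ℂˣ)
    (m : M) : inducedChar H M lam m =
      (Nat.card H : ℂ)⁻¹ * ∑ᶠ t : M, extendZero H lam ((t : G)⁻¹ * m * t) := rfl

lemma indChar_eq_sum {G : Type*} [Group G] [Fintype G] (H : Subgroup G) (lam : H →* ℂˣ) (g : G) :
    indChar H lam g = (Nat.card H : ℂ)⁻¹ * ∑ t : G, extendZero H lam (t⁻¹ * g * t) := by
  rw [indChar, inducedChar_eq_sum, ← finsum_eq_sum_of_fintype]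
  congr 1
  exact finsum_comp_equiv (Subgroup.topEquiv (G := G)).toEquiv
    (f := fun t => extendZero H lam (t⁻¹ * g * t))

lemma indChar_conj {G : Type*} [Group G] [Finite G] (H : Subgroup G) (lam : H →* ℂˣ) (g s : G) :
    indChar H lam (s * g * s⁻¹) = indChar H lam g := by
  have := Fintype.ofFinite G
  rw [indChar_eq_sum, indChar_eq_sum]
  congr 1
  refine Fintype.sum_equiv (Equiv.mulLeft s⁻¹) _ _ fun t => ?_
  congr 1
  simp [mul_assoc]

lemma indChar_inv {G : Type*} [Group G] [Finite G] (H : Subgroup G) (lam : H →* ℂˣ) (g : G) :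
    indChar H lam g⁻¹ = (starRingEnd ℂ) (indChar H lam g) := by
  have := Fintype.ofFinite G
  rw [indChar_eq_sum, indChar_eq_sum, map_mul, map_sum, map_inv₀, Complex.conj_natCast]
  congr 1
  refine Finset.sum_congr rfl fun t _ => ?_
  rw [← extendZero_inv]
  congr 1
  simp [mul_assoc]

/-- Frobenius reciprocity for class functions. -/
lemma sum_mul_indChar {G : Type*} [Group G] [Fintype G] (H : Subgroup G) (lam : H →* ℂˣ)
    (f : G → ℂ) (hf : ∀ g s, f (s * g * s⁻¹) = f g) :
    ∑ g, f g * indChar H lam g =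
      (Nat.card G : ℂ) * (Nat.card H : ℂ)⁻¹ * ∑ g, f g * extendZero H lam g := by
  simp_rw [indChar_eq_sum, Finset.mul_sum]
  rw [Finset.sum_comm]
  have : ∀ t : G, ∑ g, f g * ((Nat.card H : ℂ)⁻¹ * extendZero H lam (t⁻¹ * g * t)) =
      ∑ g, (Nat.card H : ℂ)⁻¹ * (f g * extendZero H lam g) := by
    intro t
    refine Fintype.sum_equiv (MulAut.conj t⁻¹).toEquiv _ _ fun g => ?_
    have h1 : (MulAut.conj t⁻¹).toEquiv g = t⁻¹ * g * t := by simp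
    have h2 : f (t⁻¹ * g * t) = f g := by simpa using hf g t⁻¹
    rw [h1, h2]; ring
  rw [Finset.sum_congr rfl fun t _ => this t, Finset.sum_const, Finset.card_univ,
    ← Nat.card_eq_fintype_card, nsmul_eq_mul, Finset.mul_sum]
  exact Finset.sum_congr rfl fun g _ => by ring

/-- The condition for the irreducibility of the characters induced from linear characters of `H`
with kernel `K`: distinct conjugates never agree on the intersection of their domains. -/
def Separates {G : Type*} [Group G] (H K : Subgroup G) : Prop :=
  ∀ g : G, (∀ h ∈ H, g⁻¹ * h * g ∈ H → g⁻¹ * h⁻¹ * g * h ∈ K) → g ∈ H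

/-- If `h` and its conjugate both lie in `H`, so does their commutator; thus Mackey's condition is
the stronger one. The converse needs the structure of the group, see `separates_of_isShodaPair`. -/
lemma Separates.mem_of_commutator_le {G : Type*} [Group G] {H K : Subgroup G}
    (hS : Separates H K) (g : G)
    (hg : Subgroup.closure {a : G | ∃ h ∈ H, a = g⁻¹ * h⁻¹ * g * h} ⊓ H ≤ K) : g ∈ H := by
  refine hS g fun h hh hgh => hg ⟨Subgroup.subset_closure ⟨h, hh, rfl⟩, ?_⟩
  refine H.mul_mem ?_ hh
  simpa [mul_assoc] using H.inv_mem hgh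

lemma card_subgroup_eq_sum {G : Type*} [Group G] [Fintype G] (H : Subgroup G) (lam : H →* ℂˣ) :
    ∑ g, extendZero H lam g⁻¹ * extendZero H lam g = Nat.card H := by
  classical
  have : ∀ g, extendZero H lam g⁻¹ * extendZero H lam g = if g ∈ H then 1 else 0 := by
    intro g
    by_cases hg : g ∈ H
    · rw [← extendZero_mul lam hg, inv_mul_cancel, extendZero_one, if_pos hg]
    · rw [extendZero_of_notMem lam hg, mul_zero, if_neg hg]
  rw [Finset.sum_congr rfl fun g _ => this g, Finset.sum_boole, Nat.card_eq_fintype_card,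
    Fintype.card_subtype]

/-- Orthogonality of two distinct linear characters of `H ∩ t H t⁻¹`: shifting the summation
variable by `h` multiplies the sum by a constant `c ≠ 1`. -/
lemma sum_extendZero_conj_eq_zero {G : Type*} [Group G] [Fintype G] {H K : Subgroup G}
    {lam : H →* ℂˣ} (hK : HasKernel H K lam) (hS : Separates H K) {t : G} (ht : t ∉ H) :
    ∑ g, extendZero H lam (t⁻¹ * g⁻¹ * t) * extendZero H lam g = 0 := by
  have : ∃ h ∈ H, t⁻¹ * h * t ∈ H ∧ t⁻¹ * h⁻¹ * t * h ∉ K := by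
    by_contra hcon
    push Not at hcon
    exact ht (hS t hcon)
  obtain ⟨h, hh, hth, hn⟩ := this
  have hth' : t⁻¹ * h⁻¹ * t ∈ H := by simpa [mul_assoc] using H.inv_mem hth
  set c := extendZero H lam (t⁻¹ * h⁻¹ * t * h)
  have hc : c ≠ 1 := by rwa [Ne, ← hasKernel_iff.mp hK]
  have hsum : ∑ g, extendZero H lam (t⁻¹ * g⁻¹ * t) * extendZero H lam g =
      c * ∑ g, extendZero H lam (t⁻¹ * g⁻¹ * t) * extendZero H lam g := by
    rw [Finset.mul_sum]
    refine (Fintype.sum_equiv (Equiv.mulLeft h) _ _ fun g => ?_).symm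
    have e1 : t⁻¹ * (h * g)⁻¹ * t = t⁻¹ * g⁻¹ * t * (t⁻¹ * h⁻¹ * t) := by group
    rw [Equiv.coe_mulLeft, e1, extendZero_mul lam hth']
    by_cases hg : g ∈ H
    · rw [extendZero_mul lam hg]
      simp only [c]
      rw [extendZero_mul lam hh]; ring
    · rw [extendZero_of_notMem lam hg, extendZero_of_notMem lam (g := h * g), mul_zero, mul_zero,
        mul_zero]
      rwa [H.mul_mem_cancel_left hh]
  have : (1 - c) * ∑ g, extendZero H lam (t⁻¹ * g⁻¹ * t) * extendZero H lam g = 0 := by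
    linear_combination hsum
  exact (mul_eq_zero.mp this).resolve_left (sub_ne_zero.mpr (Ne.symm hc))

/-- Mackey's criterion: the induced character has norm one. -/
lemma norm_indChar {G : Type*} [Group G] [Fintype G] {H K : Subgroup G} {lam : H →* ℂˣ}
    (hK : HasKernel H K lam) (hS : Separates H K) :
    ∑ g, indChar H lam g⁻¹ * indChar H lam g = Nat.card G := by
  classical
  have h0 : (Nat.card H : ℂ) ≠ 0 := Nat.cast_ne_zero.mpr Nat.card_pos.ne'
  have hcl : ∀ g s, indChar H lam (s * g * s⁻¹)⁻¹ = indChar H lam g⁻¹ := by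
    intro g s
    rw [← indChar_conj H lam g⁻¹ s]
    congr 1; group
  -- Reciprocity removes one of the two inductions. In the remaining sum over `t` only `t ∈ H`
  -- contributes, with `|H|` each.
  rw [sum_mul_indChar H lam (fun g => indChar H lam g⁻¹) hcl]
  simp_rw [indChar_eq_sum, mul_assoc, Finset.sum_mul, ← Finset.mul_sum]
  rw [Finset.sum_comm]
  have : ∀ t : G, ∑ g, extendZero H lam (t⁻¹ * (g⁻¹ * t)) * extendZero H lam g =
      if t ∈ H then (Nat.card H : ℂ) else 0 := by
    intro t
    simp_rw [← mul_assoc]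
    split_ifs with ht
    · rw [← card_subgroup_eq_sum H lam]
      exact Finset.sum_congr rfl fun g _ => by rw [extendZero_conj_of_mem lam ht]
    · exact sum_extendZero_conj_eq_zero hK hS ht
  rw [Finset.sum_congr rfl fun t _ => this t, Finset.sum_ite, Finset.sum_const_zero, add_zero,
    Finset.sum_const, nsmul_eq_mul, ← Fintype.card_subtype, ← Nat.card_eq_fintype_card]
  change (Nat.card G : ℂ) * ((Nat.card H : ℂ)⁻¹ * ((Nat.card H : ℂ)⁻¹ *
    ((Nat.card H : ℂ) * (Nat.card H : ℂ)))) = Nat.card G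
  field_simp

end InducedCharacters

/-! ### Complex representations and eigenvectors of subgroups -/

section Representations

open Matrix ComplexOrder in
/-- The character of a finite group at an inverse is the complex conjugate. -/
lemma character_inv {G V : Type*} [Group G] [Finite G] [AddCommGroup V] [Module ℂ V]
    [FiniteDimensional ℂ V] (ρ : Representation ℂ G V) (g : G) :
    ρ.character g⁻¹ = (starRingEnd ℂ) (ρ.character g) := by
  classical
  have := Fintype.ofFinite G
  let b := Module.finBasis ℂ V
  let A : G → Matrix (Fin (Module.finrank ℂ V)) (Fin (Module.finrank ℂ V)) ℂ :=
    fun g => LinearMap.toMatrix b b (ρ g)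
  have hA : ∀ g h, A (g * h) = A g * A h := by
    intro g h
    simp only [A, map_mul]
    exact LinearMap.toMatrix_mul b _ _
  have hA1 : A 1 = 1 := by simp only [A, map_one]; exact LinearMap.toMatrix_one b
  have htr : ∀ g, ρ.character g = (A g).trace := fun g =>
    LinearMap.trace_eq_matrix_trace ℂ b (ρ g)
  -- The averaged Hermitian form. The term of `h = 1` makes it positive definite, hence invertible,
  -- and invariance makes `A g⁻¹` similar to the conjugate transpose of `A g`.
  let S := ∑ h, (A h)ᴴ * A h
  have hS : IsUnit S := by
    have h1 : S = 1 + ∑ h ∈ Finset.univ.erase 1, (A h)ᴴ * A h := by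
      simp only [S]
      rw [← Finset.add_sum_erase _ _ (Finset.mem_univ (1 : G)), hA1]
      simp
    rw [h1]
    refine PosDef.isUnit (PosDef.add_posSemidef PosDef.one ?_)
    exact posSemidef_sum _ fun h _ => posSemidef_conjTranspose_mul_self (A h)
  have hinv : (A g)ᴴ * S * A g = S := by
    simp only [S, Finset.mul_sum, Finset.sum_mul]
    refine Fintype.sum_equiv (Equiv.mulRight g) _ _ fun h => ?_
    rw [Equiv.coe_mulRight, hA, conjTranspose_mul]
    simp only [Matrix.mul_assoc]
  obtain ⟨u, hu⟩ := hS
  have h2 : A g * A g⁻¹ = 1 := by rw [← hA, mul_inv_cancel, hA1]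
  have h3 : S * A g⁻¹ = (A g)ᴴ * S := by
    conv_lhs => rw [← hinv]
    rw [Matrix.mul_assoc, h2, Matrix.mul_one]
  have h4 : A g⁻¹ = u⁻¹.val * ((A g)ᴴ * u.val) := by
    rw [hu, ← h3, ← hu, ← Matrix.mul_assoc, Units.inv_mul, Matrix.one_mul]
  rw [htr, htr, h4, Matrix.trace_mul_comm, Matrix.mul_assoc, Units.mul_inv, Matrix.mul_one,
    Matrix.trace_conjTranspose]
  rfl

/-- `v` is an eigenvector of `H` with eigenvalues given by `lam`. -/
def IsEigenvector {G V : Type*} [Group G] [AddCommGroup V] [Module ℂ V]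
    (ρ : Representation ℂ G V) (H : Subgroup G) (lam : H →* ℂˣ) (v : V) : Prop :=
  v ≠ 0 ∧ ∀ h : H, ρ h v = (lam h : ℂ) • v

/-- The representation of `H` on `V`, twisted by the inverse of a linear character. -/
noncomputable def twist {G V : Type*} [Group G] [AddCommGroup V] [Module ℂ V]
    (ρ : Representation ℂ G V) (H : Subgroup G) (lam : H →* ℂˣ) : Representation ℂ H V where
  toFun h := ((lam h⁻¹ : ℂˣ) : ℂ) • ρ h
  map_one' := by simp
  map_mul' a b := by
    ext v
    simp only [mul_inv_rev, map_mul, Units.val_mul, LinearMap.smul_apply, Module.End.mul_apply,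
      map_smul, smul_smul, Subgroup.coe_mul]

/-- The integer is the multiplicity of `lam` in the restriction to `H`: the dimension of the
invariants of `twist`, which contain `v`. -/
lemma exists_multiplicity {G V : Type*} [Group G] [Fintype G] [AddCommGroup V] [Module ℂ V]
    [FiniteDimensional ℂ V] (ρ : Representation ℂ G V) (H : Subgroup G) (lam : H →* ℂˣ) {v : V}
    (hv : IsEigenvector ρ H lam v) :
    ∃ m : ℕ, 1 ≤ m ∧
      ∑ g, ρ.character g⁻¹ * extendZero H lam g = (Nat.card H : ℂ) * m := by
  classical
  have h0 : (Nat.card H : ℂ) ≠ 0 := Nat.cast_ne_zero.mpr Nat.card_pos.ne'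
  have : Invertible (Nat.card H : ℂ) := invertibleOfNonzero h0
  refine ⟨Module.finrank ℂ (twist ρ H lam).invariants, ?_, ?_⟩
  · rw [Nat.one_le_iff_ne_zero, Ne, Submodule.finrank_eq_zero]
    intro h
    have hmem : v ∈ (twist ρ H lam).invariants := by
      intro g
      change ((lam g⁻¹ : ℂˣ) : ℂ) • ρ g v = v
      rw [hv.2 g, smul_smul, ← Units.val_mul, ← map_mul, inv_mul_cancel, map_one, Units.val_one,
        one_smul]
    rw [h, Submodule.mem_bot] at hmem
    exact hv.1 hmem
  · rw [← Representation.card_inv_mul_sum_char_eq_finrank, ← mul_assoc, mul_inv_cancel₀ h0, one_mul]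
    have hc : ∀ h : H, (twist ρ H lam).character h =
        ρ.character (h : G) * extendZero H lam (h : G)⁻¹ := by
      intro h
      rw [extendZero_of_mem lam (H.inv_mem h.2), mul_comm, Representation.character,
        Representation.character, ← smul_eq_mul, ← map_smul]
      rfl
    rw [Finset.sum_congr rfl fun h _ => hc h]
    have h1 : ∑ g, ρ.character g⁻¹ * extendZero H lam g =
        ∑ g, ρ.character g * extendZero H lam g⁻¹ :=
      Fintype.sum_equiv (Equiv.inv G) _ _ fun g => by simp
    rw [h1, ← Finset.sum_filter_add_sum_filter_not Finset.univ (· ∈ H),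
      Finset.sum_eq_zero (s := Finset.univ.filter (· ∉ H)), add_zero]
    · exact Finset.sum_subtype _ (by simp) _
    · intro g hg
      rw [extendZero_of_notMem lam (by rw [H.inv_mem_iff]; simpa using hg), mul_zero]

/-- An irreducible representation that contains an eigenvector for `(H, lam)` has character
`lam^G`, provided that `lam^G` is irreducible. -/
theorem character_eq_indChar {G V : Type*} [Group G] [Finite G] [AddCommGroup V] [Module ℂ V]
    [FiniteDimensional ℂ V] (ρ : Representation ℂ G V) (hρ : ρ.IsIrreducible) {H K : Subgroup G}
    {lam : H →* ℂˣ} (hK : HasKernel H K lam) (hS : Separates H K) {v : V}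
    (hv : IsEigenvector ρ H lam v) : ρ.character = indChar H lam := by
  classical
  have := Fintype.ofFinite G
  have hH : (Nat.card H : ℂ) ≠ 0 := Nat.cast_ne_zero.mpr Nat.card_pos.ne'
  have hG : (Nat.card G : ℂ) ≠ 0 := Nat.cast_ne_zero.mpr Nat.card_pos.ne'
  have : Invertible (Nat.card G : ℂ) := invertibleOfNonzero hG
  obtain ⟨m, hm, hsum⟩ := exists_multiplicity ρ H lam hv
  have h1 : ∑ g, ρ.character g⁻¹ * indChar H lam g = Nat.card G * m := by
    rw [sum_mul_indChar H lam (fun g => ρ.character g⁻¹), hsum]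
    · field_simp
    · intro g s
      rw [← ρ.char_conj g⁻¹ s]
      congr 1; group
  have h2 : ∑ g, indChar H lam g⁻¹ * ρ.character g = Nat.card G * m := by
    rw [← h1]
    exact Fintype.sum_equiv (Equiv.inv G) _ _ fun g => by simp [mul_comm]
  have h3 : ∑ g, ρ.character g⁻¹ * ρ.character g = Nat.card G := by
    have := Representation.char_orthonormal ρ ρ
    rw [if_pos ⟨Representation.Equiv.refl ρ⟩, inv_mul_eq_iff_eq_mul₀ hG, mul_one] at this
    rw [← this]
    exact Finset.sum_congr rfl fun g _ => mul_comm _ _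
  have h4 := norm_indChar hK hS
  -- Both characters have norm one and their inner product is `m ≥ 1`, so this sum of squares is at
  -- most zero and the characters agree pointwise.
  have h5 : ∑ g, (Complex.normSq (ρ.character g - indChar H lam g) : ℂ) =
      2 * Nat.card G * (1 - m) := by
    have : ∀ g, (Complex.normSq (ρ.character g - indChar H lam g) : ℂ) =
        ρ.character g⁻¹ * ρ.character g + indChar H lam g⁻¹ * indChar H lam g -
        ρ.character g⁻¹ * indChar H lam g - indChar H lam g⁻¹ * ρ.character g := by
      intro g
      rw [Complex.normSq_eq_conj_mul_self, map_sub, ← character_inv, ← indChar_inv]; ring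
    rw [Finset.sum_congr rfl fun g _ => this g, Finset.sum_sub_distrib, Finset.sum_sub_distrib,
      Finset.sum_add_distrib, h1, h2, h3, h4]
    ring
  have h6 : ∑ g, Complex.normSq (ρ.character g - indChar H lam g) =
      2 * Nat.card G * (1 - (m : ℝ)) := by
    exact_mod_cast h5
  have h7 : ∑ g, Complex.normSq (ρ.character g - indChar H lam g) = 0 := by
    refine le_antisymm ?_ (Finset.sum_nonneg fun g _ => Complex.normSq_nonneg _)
    rw [h6]
    have : (1 : ℝ) ≤ m := by exact_mod_cast hm
    exact mul_nonpos_of_nonneg_of_nonpos (by positivity) (by linarith)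
  rw [Finset.sum_eq_zero_iff_of_nonneg fun g _ => Complex.normSq_nonneg _] at h7
  funext g
  exact sub_eq_zero.mp (Complex.normSq_eq_zero.mp (h7 g (Finset.mem_univ g)))

lemma exists_representation_of_isSimpleModule {G : Type} [Group G] [Finite G] (H : Subgroup G)
    (lam : H →* ℂˣ) (M : Type) [AddCommGroup M] [Module (MonoidAlgebra ℂ G) M]
    [IsSimpleModule (MonoidAlgebra ℂ G) M] (e : M) (he0 : e ≠ 0)
    (he : ∀ h : H, MonoidAlgebra.single (h : G) (1 : ℂ) • e =
      algebraMap ℂ (MonoidAlgebra ℂ G) (lam h : ℂ) • e) :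
    ∃ (V : Type) (_ : AddCommGroup V) (_ : Module ℂ V) (_ : FiniteDimensional ℂ V)
      (ρ : Representation ℂ G V), ρ.IsIrreducible ∧ ∃ v, IsEigenvector ρ H lam v := by
  let : Module (MonoidAlgebra ℂ G) (RestrictScalars ℂ (MonoidAlgebra ℂ G) M) :=
    RestrictScalars.moduleOrig ℂ (MonoidAlgebra ℂ G) M
  have h1 : Module.Finite (MonoidAlgebra ℂ G) (RestrictScalars ℂ (MonoidAlgebra ℂ G) M) :=
    inferInstanceAs (Module.Finite (MonoidAlgebra ℂ G) M)
  have h2 : Module.Finite ℂ (RestrictScalars ℂ (MonoidAlgebra ℂ G) M) :=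
    Module.Finite.trans (MonoidAlgebra ℂ G) _
  exact ⟨_, _, _, h2, Representation.ofModule (k := ℂ) (G := G) M,
    (Representation.isSimpleModule_iff_irreducible_ofModule _).mp inferInstance, e, he0, he⟩

/-- Every linear character of a subgroup occurs in an irreducible representation. -/
theorem exists_irreducible_eigenvector {G : Type} [Group G] [Finite G] (H : Subgroup G)
    (lam : H →* ℂˣ) :
    ∃ (V : Type) (_ : AddCommGroup V) (_ : Module ℂ V) (_ : FiniteDimensional ℂ V)
      (ρ : Representation ℂ G V), ρ.IsIrreducible ∧ ∃ v, IsEigenvector ρ H lam v := by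
  classical
  have := Fintype.ofFinite G
  -- A multiple of the idempotent of `lam`; it generates a left ideal on whose generator `H` acts by
  -- `lam`.
  let e : (MonoidAlgebra ℂ G) := ∑ h : H, MonoidAlgebra.single (h : G) ((lam h⁻¹ : ℂˣ) : ℂ)
  have he : ∀ h : H, MonoidAlgebra.single (h : G) (1 : ℂ) * e = (lam h : ℂ) • e := by
    intro h
    simp only [e, Finset.mul_sum, Finset.smul_sum]
    refine Fintype.sum_equiv (Equiv.mulLeft h) _ _ fun g => ?_
    rw [MonoidAlgebra.single_mul_single, MonoidAlgebra.smul_single, Equiv.coe_mulLeft,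
      one_mul, smul_eq_mul, ← Units.val_mul, mul_inv_rev, map_mul, mul_left_comm, ← map_mul lam h,
      mul_inv_cancel, map_one, mul_one]
    rfl
  have he0 : e ≠ 0 := by
    intro h
    have h1 : e.coeff 1 = 1 := by
      simp only [e]
      rw [MonoidAlgebra.coeff_sum, Finsupp.finsetSum_apply, Finset.sum_eq_single 1]
      · simp
      · intro b _ hb
        rw [MonoidAlgebra.coeff_single, Finsupp.single_apply, if_neg]
        exact fun h => hb (Subtype.ext h)
      · simp
    rw [h] at h1
    exact zero_ne_one h1
  let N : Submodule (MonoidAlgebra ℂ G) (MonoidAlgebra ℂ G) := Submodule.span (MonoidAlgebra ℂ G) {e}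
  have heN : e ∈ N := Submodule.mem_span_singleton_self e
  have : Nontrivial N := ⟨⟨e, heN⟩, 0, fun h => he0 (congrArg Subtype.val h)⟩
  have : Module.Finite (MonoidAlgebra ℂ G) N := Module.Finite.span_singleton (MonoidAlgebra ℂ G) e
  -- In a simple quotient the image of `e` is nonzero, because `e` generates and the submodule is
  -- proper.
  obtain ⟨J, hJ⟩ := IsCoatomic.exists_coatom (α := Submodule (MonoidAlgebra ℂ G) N)
  have hsimple : IsSimpleModule (MonoidAlgebra ℂ G) (N ⧸ J) := isSimpleModule_iff_isCoatom.mpr hJ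
  refine exists_representation_of_isSimpleModule H lam (N ⧸ J)
    (Submodule.Quotient.mk ⟨e, heN⟩ : N ⧸ J) ?_ ?_
  · intro h
    have h3 : (⟨e, heN⟩ : N) ∈ J := (Submodule.Quotient.mk_eq_zero J).mp h
    refine hJ.1 (eq_top_iff.mpr fun u _ => ?_)
    obtain ⟨c, hc⟩ := Submodule.mem_span_singleton.mp u.2
    have : u = c • (⟨e, heN⟩ : N) := Subtype.ext hc.symm
    rw [this]
    exact J.smul_mem c h3
  · intro h
    rw [← Submodule.Quotient.mk_smul, ← Submodule.Quotient.mk_smul]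
    congr 1
    refine Subtype.ext ?_
    change MonoidAlgebra.single (h : G) (1 : ℂ) * e = algebraMap ℂ (MonoidAlgebra ℂ G) (lam h : ℂ) * e
    rw [he, Algebra.smul_def]

end Representations

/-! ### Shoda pairs and their linear characters -/

section ShodaPairs

lemma isShodaPair_of_hom {G A : Type*} [Group G] [Finite G] [Group A] [IsCyclic A]
    {H K : Subgroup G} (hle : K ≤ H) (f : H →* A) (hf : ∀ h : H, f h = 1 ↔ (h : G) ∈ K)
    (hS : Separates H K) : IsShodaPair H K where
  le := hle
  cyclic_quotient := by
    have hker : K.subgroupOf H = f.ker := by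
      ext h
      rw [Subgroup.mem_subgroupOf, MonoidHom.mem_ker, hf]
    rw [hker]
    exact ⟨inferInstance, isCyclic_of_injective _ (QuotientGroup.kerLift_injective f)⟩
  mem_of_commutator_le := hS.mem_of_commutator_le

/-- A finite cyclic quotient is isomorphic to the group of complex roots of unity of its order. -/
lemma IsShodaPair.exists_hasKernel {G : Type*} [Group G] [Finite G] {H K : Subgroup G}
    (h : IsShodaPair H K) : ∃ lam : H →* ℂˣ, HasKernel H K lam := by
  obtain ⟨hn, hc⟩ := h.cyclic_quotient
  have : NeZero (Nat.card (H ⧸ K.subgroupOf H)) := ⟨Nat.card_pos.ne'⟩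
  let e : H ⧸ K.subgroupOf H ≃* rootsOfUnity (Nat.card (H ⧸ K.subgroupOf H)) ℂ :=
    mulEquivOfCyclicCardEq (by
      rw [HasEnoughRootsOfUnity.natCard_rootsOfUnity])
  refine ⟨(rootsOfUnity _ ℂ).subtype.comp (e.toMonoidHom.comp (QuotientGroup.mk' _)), ?_⟩
  have : ((rootsOfUnity (Nat.card (H ⧸ K.subgroupOf H)) ℂ).subtype.comp
      (e.toMonoidHom.comp (QuotientGroup.mk' _))).ker = K.subgroupOf H := by
    ext a
    simp
  rw [HasKernel, this, Subgroup.subgroupOf_map_subtype, inf_eq_left.mpr h.le]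

lemma HasKernel.le {G : Type*} [Group G] {H K : Subgroup G} {lam : H →* ℂˣ}
    (h : HasKernel H K lam) : K ≤ H := by
  intro a ha
  by_contra hc
  rw [hasKernel_iff.mp h, extendZero_of_notMem lam hc] at ha
  exact zero_ne_one ha

end ShodaPairs

/-! ### Rational traces and what the idempotent remembers -/

section Idempotents

lemma isIntegral_inducedChar {G : Type*} [Group G] [Finite G] (H M : Subgroup G) (lam : H →* ℂˣ)
    (m : M) : IsIntegral ℚ (inducedChar H M lam m) := by
  have := Fintype.ofFinite G
  classical
  rw [inducedChar_eq_sum, finsum_eq_sum_of_fintype]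
  refine IsIntegral.mul ?_ (IsIntegral.sum _ fun t _ => ?_)
  · have : (Nat.card H : ℂ)⁻¹ = algebraMap ℚ ℂ (Nat.card H : ℚ)⁻¹ := by simp
    rw [this]; exact isIntegral_algebraMap
  · by_cases h : (t : G)⁻¹ * m * t ∈ H
    · refine IsIntegral.of_pow (Nat.card_pos (α := H)) ?_
      rw [extendZero_of_mem lam h, ← Units.val_pow_eq_pow_val, ← map_pow, pow_card_eq_one', map_one,
        Units.val_one]
      exact isIntegral_one
    · rw [extendZero_of_notMem lam h]; exact isIntegral_zero

instance finiteDimensional_charField {G : Type*} [Group G] [Finite G] (H M : Subgroup G)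
    (lam : H →* ℂˣ) : FiniteDimensional ℚ (charField (inducedChar H M lam)) := by
  refine IntermediateField.finiteDimensional_adjoin ?_
  rintro _ ⟨m, rfl⟩
  exact isIntegral_inducedChar H M lam m

/-- The rational trace `∑ σ, σ (χ 1 * χ m)`, extended by zero outside `M`. -/
noncomputable def traceCoeff {G : Type*} [Group G] (M : Subgroup G) (χ : M → ℂ) (g : G) : ℚ :=
  open scoped Classical in
  if h : g ∈ M then Algebra.trace ℚ (charField χ) (charValue χ 1 * charValue χ ⟨g, h⟩) else 0

lemma coeff_rationalIdempotent {G : Type*} [Group G] [Finite G] (M : Subgroup G) (χ : M → ℂ)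
    (g : G) : (rationalIdempotent M χ).coeff g = (Nat.card M : ℚ)⁻¹ * traceCoeff M χ g⁻¹ := by
  classical
  have := Fintype.ofFinite G
  rw [rationalIdempotent, finsum_eq_sum_of_fintype, MonoidAlgebra.coeff_sum,
    Finsupp.finsetSum_apply, traceCoeff]
  simp_rw [MonoidAlgebra.coeff_single, Finsupp.single_apply]
  split_ifs with h
  · rw [Finset.sum_eq_single ⟨g⁻¹, h⟩]
    · simp
    · intro b _ hb
      rw [if_neg]
      rintro rfl
      exact hb (Subtype.ext (by simp))
    · simp
  · rw [mul_zero]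
    refine Finset.sum_eq_zero fun b _ => if_neg ?_
    rintro rfl
    exact h (by simp)

/-- Rational linear relations between character values hold for the traces. -/
lemma sum_traceCoeff {G ι : Type*} [Group G] (M : Subgroup G) (χ : M → ℂ)
    [FiniteDimensional ℚ (charField χ)] (s : Finset ι) (c : ι → ℚ) (u : ι → M) {d r : ℚ}
    (hd : χ 1 = d) (hr : ∑ i ∈ s, (c i : ℂ) * χ (u i) = r) :
    ∑ i ∈ s, c i * traceCoeff M χ (u i) = Module.finrank ℚ (charField χ) * (d * r) := by
  have h1 : ∀ i, traceCoeff M χ (u i) =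
      Algebra.trace ℚ (charField χ) (charValue χ 1 * charValue χ (u i)) :=
    fun i => dif_pos (u i).2
  simp_rw [h1]
  have h2 : ∑ i ∈ s, c i • (charValue χ 1 * charValue χ (u i)) =
      algebraMap ℚ (charField χ) (d * r) := by
    have h0 : Function.Injective (charField χ).val := Subtype.val_injective
    refine h0 ?_
    rw [map_sum]
    have h3 : ∀ i ∈ s, (charField χ).val (c i • (charValue χ 1 * charValue χ (u i))) =
        d * (c i * χ (u i)) := by
      intro i _
      rw [IntermediateField.coe_val, IntermediateField.coe_smul, IntermediateField.coe_mul, Algebra.smul_def]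
      simp only [charValue, hd]
      simp
      ring
    rw [Finset.sum_congr rfl h3, ← Finset.mul_sum, hr]
    simp
  rw [← nsmul_eq_mul, ← Algebra.trace_algebraMap, ← h2, map_sum]
  simp

lemma traceCoeff_of_eq_rat {G : Type*} [Group G] (M : Subgroup G) (χ : M → ℂ)
    [FiniteDimensional ℚ (charField χ)] {m : M} {d r : ℚ} (hd : χ 1 = d) (hr : χ m = r) :
    traceCoeff M χ m = Module.finrank ℚ (charField χ) * (d * r) := by
  have := sum_traceCoeff M χ {()} (fun _ => 1) (fun _ => m) (r := r) hd (by simpa using hr)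
  simpa using this

lemma finrank_charField_pos {G : Type*} [Group G] (M : Subgroup G) (χ : M → ℂ)
    [FiniteDimensional ℚ (charField χ)] : (0 : ℚ) < Module.finrank ℚ (charField χ) := by
  exact_mod_cast Module.finrank_pos

/-- Traces of primitive roots of unity of the same order agree. -/
lemma trace_eq_of_isPrimitiveRoot {K : Type*} [Field K] [Algebra ℚ K] [FiniteDimensional ℚ K]
    {k : ℕ} (hk : 0 < k) {a b : K} (ha : IsPrimitiveRoot a k) (hb : IsPrimitiveRoot b k) :
    Algebra.trace ℚ K a = Algebra.trace ℚ K b := by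
  have : CharZero K := algebraRat.charZero K
  -- The trace depends only on the minimal polynomial, here cyclotomic. The `convert` identifies two
  -- `ℚ`-algebra structures on `K`.
  have h0 : ∀ c : K, IsPrimitiveRoot c k → minpoly ℚ c = Polynomial.cyclotomic k ℚ := by
    intro c hc
    convert (Polynomial.cyclotomic_eq_minpoly_rat hc hk).symm
    exact Subsingleton.elim _ _
  have h : minpoly ℚ a = minpoly ℚ b := (h0 a ha).trans (h0 b hb).symm
  have h1 : ∀ c : K, (Module.finrank (IntermediateField.adjoin ℚ {c}) K : ℚ) =
      Module.finrank ℚ K / (minpoly ℚ c).natDegree := by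
    intro c
    have h2 := IntermediateField.adjoin.finrank (Algebra.IsIntegral.isIntegral (R := ℚ) c)
    have h3 := Module.finrank_mul_finrank ℚ (IntermediateField.adjoin ℚ {c}) K
    have h4 : ((minpoly ℚ c).natDegree : ℚ) ≠ 0 := by
      exact_mod_cast (minpoly.natDegree_pos (Algebra.IsIntegral.isIntegral (R := ℚ) c)).ne'
    rw [eq_div_iff h4, ← h3, ← h2]
    push_cast
    ring
  rw [trace_eq_finrank_mul_minpoly_nextCoeff, trace_eq_finrank_mul_minpoly_nextCoeff, h1, h1, h]

/-- For `c ≠ 0` the character field contains the roots of unity themselves, and there they are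
Galois conjugate. This makes traces insensitive to the choice of `lam`. -/
lemma traceCoeff_eq_of_isPrimitiveRoot {G : Type*} [Group G] (M : Subgroup G) (χ : M → ℂ)
    [FiniteDimensional ℚ (charField χ)] {m m' : M} {d c : ℚ} {ζ ζ' : ℂ} {k : ℕ} (hk : 0 < k)
    (hd : χ 1 = d) (hζ : IsPrimitiveRoot ζ k) (hζ' : IsPrimitiveRoot ζ' k)
    (hm : χ m = c * ζ) (hm' : χ m' = c * ζ') :
    traceCoeff M χ m = traceCoeff M χ m' := by
  by_cases hc : c = 0
  · rw [traceCoeff_of_eq_rat M χ (r := 0) hd (by simp [hm, hc]),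
      traceCoeff_of_eq_rat M χ (r := 0) hd (by simp [hm', hc])]
  have hc' : (c : ℂ) ≠ 0 := by exact_mod_cast hc
  have key : ∀ (m : M) (ζ : ℂ), IsPrimitiveRoot ζ k → χ m = c * ζ →
      ∃ z : charField χ, IsPrimitiveRoot z k ∧
        traceCoeff M χ m = d * c * Algebra.trace ℚ (charField χ) z := by
    intro m ζ hζ hm
    refine ⟨c⁻¹ • charValue χ m, ?_, ?_⟩
    · have h1 : ((c⁻¹ • charValue χ m : charField χ) : ℂ) = ζ := by
        rw [IntermediateField.coe_smul, Algebra.smul_def]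
        simp only [charValue, hm]
        simp [hc']
      refine IsPrimitiveRoot.of_map_of_injective (f := (charField χ).val) ?_
        (charField χ).val.injective
      simpa [h1] using hζ
    · have h1 : traceCoeff M χ m =
        Algebra.trace ℚ (charField χ) (charValue χ 1 * charValue χ m) := dif_pos m.2
      have h2 : charValue χ 1 * charValue χ m = d • charValue χ m := by
        refine Subtype.ext ?_
        rw [IntermediateField.coe_smul, IntermediateField.coe_mul, Algebra.smul_def]
        simp [charValue, hd]
      rw [h1, h2, map_smul, map_smul, smul_eq_mul, smul_eq_mul]
      field_simp
  obtain ⟨z, hz, h1⟩ := key m ζ hζ hm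
  obtain ⟨z', hz', h1'⟩ := key m' ζ' hζ' hm'
  rw [h1, h1', trace_eq_of_isPrimitiveRoot hk hz hz']

lemma indChar_one {G : Type*} [Group G] [Finite G] (H : Subgroup G) (lam : H →* ℂˣ) :
    indChar H lam 1 = ((Nat.card H : ℚ)⁻¹ * Nat.card G : ℚ) := by
  have := Fintype.ofFinite G
  rw [indChar_eq_sum]
  simp [extendZero_one]

/-- Some conjugate of `A` meets `H` in a subgroup of `K`. -/
def HasFixed {G : Type*} [Group G] (A H K : Subgroup G) : Prop :=
  ∃ t : G, ∀ h ∈ H, t * h * t⁻¹ ∈ A → h ∈ K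

open scoped Classical in
-- On the intersection of `H` with a conjugate of `A`, `lam` is either trivial, and the sum counts
-- elements, or nontrivial, and the sum vanishes.
lemma sum_extendZero_conj {G : Type*} [Group G] [Fintype G] {H K : Subgroup G} {lam : H →* ℂˣ}
    (hK : HasKernel H K lam) (A : Subgroup G) (t : G) :
    ∃ r : ℚ, ∑ g : A, extendZero H lam (t⁻¹ * g * t) = r ∧ 0 ≤ r ∧
      (0 < r ↔ ∀ h ∈ H, t * h * t⁻¹ ∈ A → h ∈ K) := by
  by_cases hc : ∀ h ∈ H, t * h * t⁻¹ ∈ A → h ∈ K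
  · have h1 : ∀ g : A, extendZero H lam (t⁻¹ * g * t) =
        if t⁻¹ * g * t ∈ H then ((1 : ℕ) : ℂ) else ((0 : ℕ) : ℂ) := by
      intro g
      split_ifs with hg
      · rw [Nat.cast_one, ← hasKernel_iff.mp hK]
        exact hc _ hg (by simp [mul_assoc])
      · rw [extendZero_of_notMem lam hg, Nat.cast_zero]
    refine ⟨((∑ g : A, if t⁻¹ * g * t ∈ H then 1 else 0 : ℕ) : ℚ), ?_, Nat.cast_nonneg _, ?_⟩
    · rw [Finset.sum_congr rfl fun g _ => h1 g]
      simp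
    · refine iff_of_true ?_ hc
      rw [Nat.cast_pos]
      refine Finset.sum_pos' (fun _ _ => Nat.zero_le _) ⟨1, Finset.mem_univ _, ?_⟩
      simp [H.one_mem]
  · refine ⟨0, ?_, le_rfl, iff_of_false (lt_irrefl 0) hc⟩
    push Not at hc
    obtain ⟨h, hh, hA, hn⟩ := hc
    have hc1 : extendZero H lam h ≠ 1 := by rwa [Ne, ← hasKernel_iff.mp hK]
    have hsum : ∑ g : A, extendZero H lam (t⁻¹ * g * t) =
        extendZero H lam h * ∑ g : A, extendZero H lam (t⁻¹ * g * t) := by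
      rw [Finset.mul_sum]
      refine (Fintype.sum_equiv (Equiv.mulRight ⟨_, hA⟩) _ _ fun g => ?_).symm
      rw [mul_comm, ← extendZero_mul lam hh]
      congr 1
      simp [mul_assoc]
    have : (1 - extendZero H lam h) * ∑ g : A, extendZero H lam (t⁻¹ * g * t) = 0 := by
      linear_combination hsum
    rw [(mul_eq_zero.mp this).resolve_left (sub_ne_zero.mpr (Ne.symm hc1)), Rat.cast_zero]

open scoped Classical in
-- The sum is `|A|` times the multiplicity of the trivial character of `A`. It splits over `t` into
-- nonnegative terms, so it is positive once one of them is.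
lemma sum_indChar_subgroup {G : Type*} [Group G] [Fintype G] {H K : Subgroup G} {lam : H →* ℂˣ}
    (hK : HasKernel H K lam) (A : Subgroup G) :
    ∃ r : ℚ, ∑ g : A, indChar H lam g = r ∧ (0 < r ↔ HasFixed A H K) := by
  choose f h1 h2 h3 using sum_extendZero_conj hK A
  refine ⟨(Nat.card H : ℚ)⁻¹ * ∑ t, f t, ?_, ?_⟩
  · simp_rw [indChar_eq_sum, ← Finset.mul_sum]
    rw [Finset.sum_comm, Finset.sum_congr rfl fun t _ => h1 t]
    push_cast
    rfl
  · have hpos : (0 : ℚ) < (Nat.card H : ℚ)⁻¹ := inv_pos.mpr (by exact_mod_cast Nat.card_pos)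
    rw [mul_pos_iff_of_pos_left hpos, Finset.sum_pos_iff_of_nonneg fun t _ => h2 t]
    simp only [Finset.mem_univ, true_and, h3, HasFixed]

lemma traceCoeff_eq_of_rationalIdempotent_eq {G : Type*} [Group G] [Finite G] {M : Subgroup G}
    {χ χ' : M → ℂ} (h : rationalIdempotent M χ = rationalIdempotent M χ') (g : G) :
    traceCoeff M χ g = traceCoeff M χ' g := by
  have h1 := coeff_rationalIdempotent M χ g⁻¹
  rw [h, coeff_rationalIdempotent, inv_inv] at h1
  have h0 : (Nat.card M : ℚ)⁻¹ ≠ 0 := inv_ne_zero (by exact_mod_cast Nat.card_pos.ne')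
  exact (mul_left_cancel₀ h0 h1).symm

open scoped Classical in
-- The character sum over `A` is rational, so passing to traces only multiplies it by the degree of
-- the character field and by the degree of the character, both positive.
lemma sum_traceCoeff_subgroup_pos_iff {G : Type*} [Group G] [Fintype G] {H K : Subgroup G}
    {lam : H →* ℂˣ} (hK : HasKernel H K lam) (A : Subgroup G) :
    0 < ∑ g : A, traceCoeff ⊤ (inducedChar H ⊤ lam) (g : G) ↔ HasFixed A H K := by
  obtain ⟨r, h1, h2⟩ := sum_indChar_subgroup hK A
  have := sum_traceCoeff ⊤ (inducedChar H ⊤ lam) Finset.univ (fun _ : A => 1)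
    (fun g => ⟨g, Subgroup.mem_top _⟩) (r := r) (indChar_one H lam)
    (by simp only [Rat.cast_one, one_mul]; exact h1)
  simp only [one_mul] at this
  rw [this, mul_pos_iff_of_pos_left (finrank_charField_pos _ _), mul_pos_iff_of_pos_left, h2]
  have hH : (0 : ℚ) < Nat.card H := by exact_mod_cast Nat.card_pos
  have hG : (0 : ℚ) < Nat.card G := by exact_mod_cast Nat.card_pos
  positivity

/-- Equivalent pairs cannot be distinguished by the multiplicity of the trivial character on
subgroups. -/
theorem ShodaEquivalent.hasFixed_iff {G : Type*} [Group G] [Finite G] {H K H' K' : Subgroup G}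
    (h : ShodaEquivalent (H, K) (H', K')) (A : Subgroup G) :
    HasFixed A H K ↔ HasFixed A H' K' := by
  classical
  have := Fintype.ofFinite G
  obtain ⟨e, ⟨lam, hK, rfl⟩, ⟨lam', hK', he⟩⟩ := h
  rw [← sum_traceCoeff_subgroup_pos_iff hK, ← sum_traceCoeff_subgroup_pos_iff hK']
  simp_rw [traceCoeff_eq_of_rationalIdempotent_eq he]

end Idempotents

/-! ### Arithmetic in the Heisenberg frame -/

/-- Coordinates on the semidirect product of the Heisenberg group over `ZMod p` with a cyclic
group of order `2 ^ n`: every element is uniquely `X a * Y b * Z c * w ^ d`. -/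
structure HeisenbergFrame (G : Type) [Group G] (p n : ℕ) (α k q : ZMod p) where
  X : ZMod p → G
  Y : ZMod p → G
  Z : ZMod p → G
  w : G
  D : G →* Multiplicative (ZMod (2 ^ n))
  X_add : ∀ a b, X (a + b) = X a * X b
  Y_add : ∀ a b, Y (a + b) = Y a * Y b
  Z_add : ∀ a b, Z (a + b) = Z a * Z b
  X_mul_Y : ∀ a b, X a * Y b = Y b * X a
  X_mul_Z : ∀ a c, X a * Z c = Z c * X a
  Y_mul_Z : ∀ b c, Y b * Z c = Z c * Y b * X (b * c)
  conj_X : ∀ a, w⁻¹ * X a * w = X (α * a)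
  conj_Y : ∀ b, w⁻¹ * Y b * w = Z (k * b)
  conj_Z : ∀ c, w⁻¹ * Z c * w = Y (q * c)
  w_pow : w ^ 2 ^ n = 1
  D_X : ∀ a, D (X a) = 1
  D_Y : ∀ b, D (Y b) = 1
  D_Z : ∀ c, D (Z c) = 1
  D_w : D w = Multiplicative.ofAdd 1
  exists_eq : ∀ g, ∃ (a b c : ZMod p) (d : ℕ), g = X a * Y b * Z c * w ^ d
  eq_zero : ∀ a b c, X a * Y b * Z c = 1 → a = 0 ∧ b = 0 ∧ c = 0
  ne_two : p ≠ 2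
  three_le : 3 ≤ n
  -- This is the compatibility of the action of `w` with the relation `y z = z y x`.
  alpha_eq : α = -(k * q)
  orderOf_alpha : orderOf α = 2 ^ (n - 1)

set_option linter.unusedSectionVars false

namespace HeisenbergFrame

variable {G : Type} [Group G] {p n : ℕ} {α k q : ZMod p} [Fact p.Prime]
  (F : HeisenbergFrame G p n α k q)

/-- The element of the Heisenberg group with the given coordinates. -/
def E (a b c : ZMod p) : G := F.X a * F.Y b * F.Z c

/-- The central involution of the quotient by the Heisenberg group. -/
def v : G := F.w ^ 2 ^ (n - 1)

/-- The class of `v` in the quotient by the Heisenberg group. -/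
def half (_ : HeisenbergFrame G p n α k q) : Multiplicative (ZMod (2 ^ n)) :=
  Multiplicative.ofAdd ((2 ^ (n - 1) : ℕ) : ZMod (2 ^ n))

lemma X_zero : F.X 0 = 1 := by
  have := F.X_add 0 0
  rwa [add_zero, left_eq_mul] at this

lemma Y_zero : F.Y 0 = 1 := by
  have := F.Y_add 0 0
  rwa [add_zero, left_eq_mul] at this

lemma Z_zero : F.Z 0 = 1 := by
  have := F.Z_add 0 0
  rwa [add_zero, left_eq_mul] at this

lemma X_eq (a : ZMod p) : F.X a = F.E a 0 0 := by simp [E, Y_zero, Z_zero]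

lemma Y_eq (b : ZMod p) : F.Y b = F.E 0 b 0 := by simp [E, X_zero, Z_zero]

lemma Z_eq (c : ZMod p) : F.Z c = F.E 0 0 c := by simp [E, X_zero, Y_zero]

lemma E_zero : F.E 0 0 0 = 1 := by rw [← X_eq, X_zero]

lemma Z_mul_Y (b c : ZMod p) : F.Z c * F.Y b = F.X (-(b * c)) * F.Y b * F.Z c := by
  have h1 := F.Y_mul_Z b c
  rw [mul_assoc, h1, mul_assoc, ← F.X_mul_Y, ← mul_assoc (F.Z c), ← F.X_mul_Z, ← mul_assoc,
    ← mul_assoc, ← F.X_add, neg_add_cancel, X_zero, one_mul]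

lemma E_mul (a b c a' b' c' : ZMod p) :
    F.E a b c * F.E a' b' c' = F.E (a + a' - c * b') (b + b') (c + c') := by
  have h1 : F.Z c * (F.X a' * F.Y b' * F.Z c') =
      F.X a' * F.X (-(b' * c)) * F.Y b' * F.Z c * F.Z c' := by
    rw [← mul_assoc, ← mul_assoc, ← F.X_mul_Z, mul_assoc (F.X a'), Z_mul_Y]
    simp only [mul_assoc]
  have h2 : ∀ e, F.Y b * F.X e = F.X e * F.Y b := fun e => (F.X_mul_Y e b).symm
  rw [E, E, E, mul_assoc, h1, ← F.X_add]
  have h3 : F.X a * F.Y b * (F.X (a' + -(b' * c)) * F.Y b' * F.Z c * F.Z c') =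
      F.X a * (F.Y b * F.X (a' + -(b' * c))) * F.Y b' * F.Z c * F.Z c' := by
    simp only [mul_assoc]
  rw [h3, h2]
  have h4 : F.X a * (F.X (a' + -(b' * c)) * F.Y b) * F.Y b' * F.Z c * F.Z c' =
      (F.X a * F.X (a' + -(b' * c))) * (F.Y b * F.Y b') * (F.Z c * F.Z c') := by
    simp only [mul_assoc]
  rw [h4, ← F.X_add, ← F.Y_add, ← F.Z_add]
  congr 3
  ring

lemma E_inv (a b c : ZMod p) : (F.E a b c)⁻¹ = F.E (-a - b * c) (-b) (-c) := by
  rw [inv_eq_iff_mul_eq_one, E_mul, ← F.E_zero]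
  congr 1 <;> ring

lemma E_eq_one {a b c : ZMod p} (h : F.E a b c = 1) : a = 0 ∧ b = 0 ∧ c = 0 := F.eq_zero a b c h

lemma E_inj {a b c a' b' c' : ZMod p} :
    F.E a b c = F.E a' b' c' ↔ a = a' ∧ b = b' ∧ c = c' := by
  constructor
  · intro h
    have h1 : F.E a b c * (F.E a' b' c')⁻¹ = 1 := by rw [h, mul_inv_cancel]
    rw [E_inv, E_mul] at h1
    obtain ⟨h2, h3, h4⟩ := F.E_eq_one h1
    have hb : b = b' := by linear_combination h3
    have hc : c = c' := by linear_combination h4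
    subst hb hc
    exact ⟨by linear_combination h2, rfl, rfl⟩
  · rintro ⟨rfl, rfl, rfl⟩; rfl

lemma E_conj (a b c a' b' c' : ZMod p) :
    (F.E a' b' c')⁻¹ * F.E a b c * F.E a' b' c' = F.E (a + (b * c' - b' * c)) b c := by
  rw [E_inv, E_mul, E_mul]
  congr 1 <;> ring

lemma X_inv (a : ZMod p) : (F.X a)⁻¹ = F.X (-a) := by
  rw [X_eq, X_eq, E_inv]; congr 1 <;> ring

lemma X_mul_E (e a b c : ZMod p) : F.X e * F.E a b c = F.E (e + a) b c := by
  rw [X_eq, E_mul]; congr 1 <;> ring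

lemma E_mul_X (e a b c : ZMod p) : F.E a b c * F.X e = F.E (a + e) b c := by
  rw [X_eq, E_mul]; congr 1 <;> ring

lemma X_comm_E (e a b c : ZMod p) : F.X e * F.E a b c = F.E a b c * F.X e := by
  rw [X_mul_E, E_mul_X, add_comm]

lemma X_natCast_mul (m : ℕ) (a : ZMod p) : F.X (m * a) = F.X a ^ m := by
  induction m with
  | zero => simp [X_zero]
  | succ m ih => rw [pow_succ, ← ih, ← F.X_add]; congr 1; push_cast; ring

lemma E_pow (m : ℕ) (a b c : ZMod p) :
    ∃ a', F.E a b c ^ m = F.E a' (m * b) (m * c) := by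
  induction m with
  | zero => exact ⟨0, by simp [E_zero]⟩
  | succ m ih =>
    obtain ⟨a', h⟩ := ih
    rw [pow_succ, h, E_mul]
    exact ⟨_, by congr 1 <;> (push_cast; ring)⟩

lemma two_ne_zero' (F : HeisenbergFrame G p n α k q) : (2 : ZMod p) ≠ 0 := by
  have := F.ne_two
  intro h
  have h1 : ((2 : ℕ) : ZMod p) = 0 := by exact_mod_cast h
  rw [ZMod.natCast_eq_zero_iff] at h1
  exact this ((Nat.prime_dvd_prime_iff_eq Fact.out Nat.prime_two).mp h1)

lemma D_E (a b c : ZMod p) : F.D (F.E a b c) = 1 := by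
  simp [E, F.D_X, F.D_Y, F.D_Z]

lemma D_w_pow (d : ℕ) : F.D (F.w ^ d) = Multiplicative.ofAdd (d : ZMod (2 ^ n)) := by
  rw [map_pow, F.D_w, ← ofAdd_nsmul, nsmul_one]

lemma D_v : F.D F.v = F.half := F.D_w_pow _

lemma w_pow_eq_one_of_D {d : ℕ} (h : F.D (F.w ^ d) = 1) : F.w ^ d = 1 := by
  rw [D_w_pow, ofAdd_eq_one, ZMod.natCast_eq_zero_iff] at h
  obtain ⟨e, rfl⟩ := h
  rw [pow_mul, F.w_pow, one_pow]

lemma exists_E_of_D {g : G} (h : F.D g = 1) : ∃ a b c, g = F.E a b c := by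
  obtain ⟨a, b, c, d, rfl⟩ := F.exists_eq g
  have h1 : F.D (F.w ^ d) = 1 := by
    change F.D (F.E a b c * F.w ^ d) = 1 at h
    rwa [map_mul, D_E, one_mul] at h
  exact ⟨a, b, c, by rw [F.w_pow_eq_one_of_D h1, mul_one]; rfl⟩

lemma D_conj (g h : G) : F.D (g⁻¹ * h * g) = F.D h := by
  rw [map_mul, map_mul, map_inv, mul_comm _ (F.D h), mul_assoc, inv_mul_cancel, mul_one]

lemma D_comm (g h : G) : F.D (g⁻¹ * h⁻¹ * g * h) = 1 := by
  rw [map_mul, D_conj, map_inv, inv_mul_cancel]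

/-- Conjugation by `w` exchanges the `y` and `z` directions. Restoring the order of the two factors
produces the term `b * c`. -/
lemma conj_E (a b c : ZMod p) :
    F.w⁻¹ * F.E a b c * F.w = F.E (α * (a + b * c)) (q * c) (k * b) := by
  have h1 : F.w⁻¹ * F.E a b c * F.w =
      (F.w⁻¹ * F.X a * F.w) * (F.w⁻¹ * F.Y b * F.w) * (F.w⁻¹ * F.Z c * F.w) := by
    rw [E]; group
  rw [h1, F.conj_X, F.conj_Y, F.conj_Z, X_eq, Y_eq, Z_eq, E_mul, E_mul]
  congr 1
  · linear_combination -(b * c) * F.alpha_eq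
  · ring
  · ring

/-- Conjugating twice by `w` multiplies `b` and `c` by `k * q = -α`, and the two reordering
corrections in the central coordinate cancel. -/
lemma conj_sq_pow_E (m : ℕ) (a b c : ZMod p) :
    (F.w ^ (2 * m))⁻¹ * F.E a b c * F.w ^ (2 * m) =
      F.E (α ^ (2 * m) * a) ((-α) ^ m * b) ((-α) ^ m * c) := by
  induction m with
  | zero => simp
  | succ m ih =>
    have h1 : (F.w ^ (2 * (m + 1)))⁻¹ * F.E a b c * F.w ^ (2 * (m + 1)) =
        F.w⁻¹ * (F.w⁻¹ * ((F.w ^ (2 * m))⁻¹ * F.E a b c * F.w ^ (2 * m)) * F.w) * F.w := by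
      rw [show 2 * (m + 1) = 2 * m + 1 + 1 by ring, pow_succ, pow_succ]
      simp only [mul_inv_rev, mul_assoc]
    rw [h1, ih, conj_E, conj_E, pow_succ (-α), show 2 * (m + 1) = 2 * m + 1 + 1 by ring,
      pow_succ α, pow_succ α]
    have h2 : k * q = -α := by linear_combination F.alpha_eq
    congr 1
    · linear_combination α * (-α) ^ m * (-α) ^ m * b * c * h2
    · linear_combination (-α) ^ m * b * h2
    · linear_combination (-α) ^ m * c * h2

/-- Half the order of `α` gives the square root `-1` of `1`; the sign in front of `α` is harmless
because `n ≥ 3` makes the exponent even. -/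
lemma alpha_pow_half (F : HeisenbergFrame G p n α k q) : (-α) ^ 2 ^ (n - 2) = -1 := by
  have hn := F.three_le
  have h1 : α ^ 2 ^ (n - 1) = 1 := by rw [← F.orderOf_alpha, pow_orderOf_eq_one]
  have h2 : α ^ 2 ^ (n - 2) ≠ 1 := by
    intro h
    have := orderOf_dvd_of_pow_eq_one h
    rw [F.orderOf_alpha, Nat.pow_dvd_pow_iff_le_right (by norm_num)] at this
    omega
  have h3 : (α ^ 2 ^ (n - 2)) ^ 2 = 1 := by
    rw [← pow_mul, ← pow_succ, show n - 2 + 1 = n - 1 by omega, h1]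
  have h4 : Even (2 ^ (n - 2)) := (Nat.even_pow' (by omega)).mpr even_two
  rw [h4.neg_pow]
  rw [sq] at h3
  exact (mul_self_eq_one_iff.mp h3).resolve_left h2

lemma conj_v_E (a b c : ZMod p) : F.v⁻¹ * F.E a b c * F.v = F.E a (-b) (-c) := by
  have hn := F.three_le
  have h1 : F.v = F.w ^ (2 * 2 ^ (n - 2)) := by
    rw [v, ← pow_succ', show n - 2 + 1 = n - 1 by omega]
  have h2 : α ^ (2 * 2 ^ (n - 2)) = 1 := by
    rw [← pow_succ', show n - 2 + 1 = n - 1 by omega, ← F.orderOf_alpha, pow_orderOf_eq_one]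
  rw [h1, conj_sq_pow_E, h2, F.alpha_pow_half]
  congr 1 <;> ring

lemma v_sq : F.v * F.v = 1 := by
  have hn := F.three_le
  rw [v, ← pow_add, ← two_mul, ← pow_succ', show n - 1 + 1 = n by omega, F.w_pow]

lemma v_inv : F.v⁻¹ = F.v := inv_eq_of_mul_eq_one_left F.v_sq

lemma half_ne_one : F.half ≠ 1 := by
  have hn := F.three_le
  rw [half, Ne, ofAdd_eq_one, ZMod.natCast_eq_zero_iff, Nat.pow_dvd_pow_iff_le_right (by norm_num)]
  omega

lemma half_mul_half : F.half * F.half = 1 := by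
  rw [← D_v, ← map_mul, v_sq, map_one]

lemma exists_E_mul_v {g : G} (h : F.D g = F.half) : ∃ a b c, g = F.E a b c * F.v := by
  have h1 : F.D (g * F.v) = 1 := by rw [map_mul, h, D_v, half_mul_half]
  obtain ⟨a, b, c, h2⟩ := F.exists_E_of_D h1
  exact ⟨a, b, c, by rw [← h2, mul_assoc, v_sq, mul_one]⟩

lemma E_mul_v_conj (a b c a' b' c' : ZMod p) :
    (F.E a' b' c' * F.v)⁻¹ * F.E a b c * (F.E a' b' c' * F.v) =
      F.E (a + (b * c' - b' * c)) (-b) (-c) := by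
  rw [← conj_v_E, ← E_conj F a b c a' b' c']; group

lemma conj_of_D_half {g : G} (h : F.D g = F.half) (a b c : ZMod p) :
    ∃ a', g⁻¹ * F.E a b c * g = F.E a' (-b) (-c) := by
  obtain ⟨a', b', c', rfl⟩ := F.exists_E_mul_v h
  exact ⟨_, F.E_mul_v_conj ..⟩

lemma conj_w_pow_X (d : ℕ) (a : ZMod p) :
    (F.w ^ d)⁻¹ * F.X a * F.w ^ d = F.X (α ^ d * a) := by
  induction d with
  | zero => simp
  | succ d ih =>
    have h1 : (F.w ^ (d + 1))⁻¹ * F.X a * F.w ^ (d + 1) =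
        F.w⁻¹ * ((F.w ^ d)⁻¹ * F.X a * F.w ^ d) * F.w := by
      rw [pow_succ]; simp only [mul_inv_rev, mul_assoc]
    rw [h1, ih, F.conj_X]; congr 1; ring

lemma alpha_ne_zero (F : HeisenbergFrame G p n α k q) : α ≠ 0 := by
  intro h
  have h1 := F.orderOf_alpha
  rw [h, orderOf_zero] at h1
  exact absurd h1 (by positivity)

lemma k_ne_zero (F : HeisenbergFrame G p n α k q) : k ≠ 0 := fun h => F.alpha_ne_zero (by rw [F.alpha_eq, h]; ring)

lemma q_ne_zero (F : HeisenbergFrame G p n α k q) : q ≠ 0 := fun h => F.alpha_ne_zero (by rw [F.alpha_eq, h]; ring)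

/-- The centre of `P` is acted on through powers of `α`, whose order is half that of `w`. So the
centraliser of `x` is `P` together with the coset of `v`. -/
lemma conj_X_eq (g : G) : ∃ s : ZMod p, s ≠ 0 ∧ (∀ a, g⁻¹ * F.X a * g = F.X (s * a)) ∧
    (s = 1 ↔ F.D g = 1 ∨ F.D g = F.half) := by
  obtain ⟨a, b, c, d, rfl⟩ := F.exists_eq g
  refine ⟨α ^ d, pow_ne_zero d F.alpha_ne_zero, fun e => ?_, ?_⟩
  · rw [← conj_w_pow_X]
    change (F.E a b c * F.w ^ d)⁻¹ * F.X e * (F.E a b c * F.w ^ d) = _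
    rw [mul_inv_rev, mul_assoc, mul_assoc, ← mul_assoc (F.X e), X_comm_E]
    simp only [mul_assoc, inv_mul_cancel_left]
  · change _ ↔ F.D (F.E a b c * F.w ^ d) = 1 ∨ F.D (F.E a b c * F.w ^ d) = F.half
    have hn := F.three_le
    rw [map_mul, D_E, one_mul, D_w_pow, ← orderOf_dvd_iff_pow_eq_one, F.orderOf_alpha, half,
      ofAdd_eq_one, ZMod.natCast_eq_zero_iff]
    have h2 : (2 : ℕ) ^ n = 2 * 2 ^ (n - 1) := by rw [← pow_succ', show n - 1 + 1 = n by omega]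
    constructor
    · rintro ⟨e, rfl⟩
      rcases Nat.even_or_odd' e with ⟨m, rfl | rfl⟩
      · left; exact ⟨m, by rw [h2]; ring⟩
      · right
        rw [show 2 ^ (n - 1) * (2 * m + 1) = 2 ^ n * m + 2 ^ (n - 1) by rw [h2]; ring]
        congr 1
        push_cast
        have : (2 : ZMod (2 ^ n)) ^ n = 0 := by exact_mod_cast ZMod.natCast_self (2 ^ n)
        rw [this]; ring
    · rintro (h | h)
      · exact (Dvd.intro_left 2 h2.symm).trans h
      · have h3 : ((d : ℕ) : ZMod (2 ^ n)) = ((2 ^ (n - 1) : ℕ) : ZMod (2 ^ n)) := h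
        rw [ZMod.natCast_eq_natCast_iff] at h3
        have h4 : d ≡ 2 ^ (n - 1) [MOD 2 ^ (n - 1)] := h3.of_dvd (Dvd.intro_left 2 h2.symm)
        exact (Nat.modEq_zero_iff_dvd.mp (h4.trans (by simp [Nat.ModEq])))

/-- A cyclic `2`-group has a single involution, contained in each of its nontrivial subgroups. -/
lemma exists_pow_D {g : G} (h : F.D g ≠ 1) : ∃ m : ℕ, F.D (g ^ m) = F.half := by
  have hn := F.three_le
  have h1 : orderOf (F.D g) ∣ 2 ^ n := by
    refine orderOf_dvd_of_pow_eq_one ?_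
    rw [← ofAdd_toAdd (F.D g), ← ofAdd_nsmul, ofAdd_eq_one, nsmul_eq_mul, ZMod.natCast_self,
      zero_mul]
  obtain ⟨e, he, h2⟩ := (Nat.dvd_prime_pow Nat.prime_two).mp h1
  have he0 : e ≠ 0 := by
    rintro rfl
    exact h (orderOf_eq_one_iff.mp (by simpa using h2))
  refine ⟨2 ^ (e - 1), ?_⟩
  have h3 : F.D (g ^ 2 ^ (e - 1)) ≠ 1 := by
    rw [map_pow]
    intro h4
    have := orderOf_dvd_of_pow_eq_one h4
    rw [h2, Nat.pow_dvd_pow_iff_le_right (by norm_num)] at this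
    omega
  have h4 : F.D (g ^ 2 ^ (e - 1)) * F.D (g ^ 2 ^ (e - 1)) = 1 := by
    rw [← map_mul, ← pow_add, ← two_mul, ← pow_succ', show e - 1 + 1 = e by omega, map_pow, ← h2,
      pow_orderOf_eq_one]
  set z := F.D (g ^ 2 ^ (e - 1))
  have : NeZero (2 ^ n) := ⟨by positivity⟩
  have h5 : (2 : ℕ) ^ n = 2 * 2 ^ (n - 1) := by rw [← pow_succ', show n - 1 + 1 = n by omega]
  have h6 : z = Multiplicative.ofAdd ((z.toAdd.val : ℕ) : ZMod (2 ^ n)) := by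
    rw [ZMod.natCast_val, ZMod.cast_id, ofAdd_toAdd]
  have h7 : (2 * z.toAdd.val : ℕ) = (0 : ZMod (2 ^ n)) := by
    have : z.toAdd + z.toAdd = 0 := h4
    push_cast
    rw [ZMod.natCast_val, ZMod.cast_id, two_mul, this]
  rw [ZMod.natCast_eq_zero_iff] at h7
  replace h7 := h5.symm.dvd.trans h7
  obtain ⟨m, hm⟩ := Nat.dvd_of_mul_dvd_mul_left (by norm_num) h7
  have hlt := ZMod.val_lt z.toAdd
  rw [h6, half, hm]
  replace hlt := hlt.trans_eq h5
  rw [hm, mul_comm] at hlt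
  have hm2 : m < 2 := lt_of_mul_lt_mul_right hlt (by positivity)
  have hm0 : m ≠ 0 := by
    rintro rfl
    apply h3
    rw [h6, hm]; simp
  have : m = 1 := by omega
  rw [this, mul_one]

/-- Conjugation by `v` inverts modulo the centre. The central coordinate is then corrected by an
element of `P`, since `b * c' - b' * c` takes every value. -/
lemma exists_inverting (a b c : ZMod p) (h : b ≠ 0 ∨ c ≠ 0) :
    ∃ g, F.D g = F.half ∧ g⁻¹ * F.E a b c * g = (F.E a b c)⁻¹ := by
  have : ∃ b' c' : ZMod p, b * c' - b' * c = -2 * a - b * c := by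
    by_cases hb : b = 0
    · have hc := h.resolve_left (not_not.mpr hb)
      exact ⟨(2 * a + b * c) / c, 0, by field_simp; ring⟩
    · exact ⟨0, (-2 * a - b * c) / b, by field_simp; ring⟩
  obtain ⟨b', c', h1⟩ := this
  refine ⟨F.E 0 b' c' * F.v, by rw [map_mul, D_E, D_v, one_mul], ?_⟩
  rw [E_mul_v_conj, E_inv, h1]
  congr 1; ring

/-- For a noncentral element the `p`-th power is central, hence fixed by the inverting element, but
it is also inverted by it; and `p` is odd. -/
lemma E_pow_prime (a b c : ZMod p) : F.E a b c ^ p = 1 := by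
  by_cases h : b ≠ 0 ∨ c ≠ 0
  · obtain ⟨e, he⟩ := F.E_pow p a b c
    rw [CharP.cast_eq_zero, zero_mul, zero_mul, ← X_eq] at he
    obtain ⟨g, hgD, hg⟩ := F.exists_inverting a b c h
    obtain ⟨s, -, hs, hs1⟩ := F.conj_X_eq g
    rw [hs1.mpr (Or.inr hgD)] at hs
    have h1 : g⁻¹ * F.E a b c ^ p * g = (F.E a b c ^ p)⁻¹ := by
      have := conj_pow (i := p) (a := g⁻¹) (b := F.E a b c)
      rw [inv_inv, hg, inv_pow] at this
      exact this.symm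
    rw [he, hs, one_mul, X_inv, X_eq, X_eq, E_inj] at h1
    have h2 : 2 * e = 0 := by linear_combination h1.1
    rw [he, (mul_eq_zero.mp h2).resolve_left F.two_ne_zero', X_zero]
  · push Not at h
    rw [h.1, h.2, ← X_eq, ← X_natCast_mul, CharP.cast_eq_zero, zero_mul, X_zero]

end HeisenbergFrame

/-! ### Every Shoda pair satisfies Mackey's criterion -/

section KernelLemmas

variable {G : Type*} [Group G] {H K : Subgroup G} {lam : H →* ℂˣ}

lemma HasKernel.commutator_mem (hK : HasKernel H K lam) {a b : G} (ha : a ∈ H) (hb : b ∈ H) :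
    a⁻¹ * b⁻¹ * a * b ∈ K := by
  rw [hasKernel_iff.mp hK, extendZero_mul lam hb, extendZero_mul lam ha,
    extendZero_mul lam (H.inv_mem hb), mul_right_comm (extendZero H lam a⁻¹),
    ← extendZero_mul lam ha, inv_mul_cancel, extendZero_one, one_mul, ← extendZero_mul lam hb,
    inv_mul_cancel, extendZero_one]

lemma HasKernel.conj_mem (hK : HasKernel H K lam) {a b : G} (ha : a ∈ H) (hb : b ∈ K) :
    a⁻¹ * b * a ∈ K := by
  rw [hasKernel_iff.mp hK, extendZero_conj_of_mem lam ha, ← hasKernel_iff.mp hK]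
  exact hb

lemma IsShodaPair.mem_of_forall [Finite G] (h : IsShodaPair H K) (A : Subgroup G) (g : G)
    (hA : ∀ a ∈ H, g⁻¹ * a⁻¹ * g * a ∈ A) (hAK : A ⊓ H ≤ K) : g ∈ H := by
  refine h.mem_of_commutator_le g (le_trans (inf_le_inf_right H ?_) hAK)
  rw [Subgroup.closure_le]
  rintro _ ⟨a, ha, rfl⟩
  exact hA a ha

end KernelLemmas

namespace HeisenbergFrame

variable {G : Type} [Group G] {p n : ℕ} {α k q : ZMod p} [Fact p.Prime]
  (F : HeisenbergFrame G p n α k q)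

/-- The centre of the Heisenberg group. -/
def center : Subgroup G where
  carrier := Set.range F.X
  one_mem' := ⟨0, F.X_zero⟩
  mul_mem' := by rintro _ _ ⟨a, rfl⟩ ⟨b, rfl⟩; exact ⟨a + b, F.X_add a b⟩
  inv_mem' := by rintro _ ⟨a, rfl⟩; exact ⟨-a, (F.X_inv a).symm⟩

lemma X_mem_of_ne_zero {H : Subgroup G} {a : ZMod p} (h : F.X a ∈ H) (ha : a ≠ 0) (b : ZMod p) :
    F.X b ∈ H := by
  have h1 : F.X b = F.X a ^ (b * a⁻¹).val := by
    rw [← X_natCast_mul, ZMod.natCast_val, ZMod.cast_id, inv_mul_cancel_right₀ ha]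
  rw [h1]
  exact H.pow_mem h _

lemma E_mem_of_mul {H : Subgroup G} {a b c : ZMod p} (hX : F.X 1 ∈ H) (h : F.E a b c ∈ H)
    (s a' : ZMod p) : F.E a' (s * b) (s * c) ∈ H := by
  obtain ⟨a'', h1⟩ := F.E_pow s.val a b c
  rw [ZMod.natCast_val, ZMod.cast_id] at h1
  have h2 : F.E a' (s * b) (s * c) = F.X (a' - a'') * F.E a b c ^ s.val := by
    rw [h1, X_mul_E]; congr 1; ring
  rw [h2]
  exact H.mul_mem (F.X_mem_of_ne_zero hX one_ne_zero _) (H.pow_mem h _)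

lemma comm_E (a b c a' b' c' : ZMod p) :
    (F.E a' b' c')⁻¹ * (F.E a b c)⁻¹ * F.E a' b' c' * F.E a b c = F.X (b' * c - b * c') := by
  rw [E_inv F a b c, E_conj, E_mul, X_eq]; congr 1 <;> ring

variable [Finite G] {H K : Subgroup G}

/-- Commutators with `x` lie in the normal subgroup `⟨x⟩` of prime order, which would meet `H`
trivially if `x ∉ H`. -/
lemma X_mem_of_isShodaPair (h : IsShodaPair H K) : F.X 1 ∈ H := by
  by_contra hX
  refine hX (h.mem_of_forall F.center (F.X 1) ?_ ?_)
  · intro a _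
    obtain ⟨s, -, hs, -⟩ := F.conj_X_eq a
    rw [mul_assoc, mul_assoc, ← mul_assoc a⁻¹, hs, X_inv, ← F.X_add]
    exact ⟨_, rfl⟩
  · rintro _ ⟨⟨a, rfl⟩, ha⟩
    by_cases h0 : a = 0
    · rw [h0, X_zero]; exact K.one_mem
    · exact absurd (F.X_mem_of_ne_zero ha h0 1) hX

lemma eq_top_of_isShodaPair (h : IsShodaPair H K) (hK : F.D.ker ⊓ H ≤ K) (g : G) : g ∈ H :=
  h.mem_of_forall F.D.ker g (fun a _ => F.D_comm g a) hK

/-- If `H` contains the Heisenberg group, then it is normal and the two conditions agree. -/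
lemma separates_of_ker_le (h : IsShodaPair H K) (hH : F.D.ker ≤ H) : Separates H K := by
  intro g hg
  have h1 : ∀ a ∈ H, g⁻¹ * a⁻¹ * g * a ∈ K := by
    intro a ha
    refine hg a ha ?_
    have h2 : g⁻¹ * a * g = g⁻¹ * (a⁻¹)⁻¹ * g * a⁻¹ * a := by group
    rw [h2]
    exact H.mul_mem (hH (F.D_comm g a⁻¹)) ha
  exact h.mem_of_forall K g h1 inf_le_left

/-- Suppose `x ∈ K`. If `H ≤ P`, the commutators of `H` with `P` are central, so the Shoda condition
puts `P` inside `H`. Otherwise some element of `H` inverts `P` modulo the centre, and its commutator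
with `u` puts `u` into `K`. -/
lemma X_notMem_of_isShodaPair {lam : H →* ℂˣ} (h : IsShodaPair H K) (hlam : HasKernel H K lam)
    {u : G} (hu : u ∈ F.D.ker) (huH : u ∈ H) (huK : u ∉ K) (hH : ¬ F.D.ker ≤ H) : F.X 1 ∉ K := by
  intro hX
  obtain ⟨a, b, c, rfl⟩ := F.exists_E_of_D hu
  by_cases hP : H ≤ F.D.ker
  · refine hH fun g hg => h.mem_of_forall F.center g ?_ ?_
    · intro e he
      obtain ⟨a1, b1, c1, rfl⟩ := F.exists_E_of_D (hP he)
      obtain ⟨a2, b2, c2, rfl⟩ := F.exists_E_of_D hg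
      exact ⟨_, (F.comm_E ..).symm⟩
    · rintro _ ⟨⟨e, rfl⟩, -⟩
      exact F.X_mem_of_ne_zero hX one_ne_zero e
  · obtain ⟨g, hg, hgP⟩ := SetLike.not_le_iff_exists.mp hP
    obtain ⟨m, hm⟩ := F.exists_pow_D hgP
    obtain ⟨a', h1⟩ := F.conj_of_D_half hm a b c
    -- Up to the centre this commutator is `u⁻²`; the exponent `-1/2` modulo `p` recovers `u`.
    have h2 := hlam.commutator_mem (a := F.E a b c) (b := g ^ m) huH (H.pow_mem hg m)
    rw [mul_assoc, mul_assoc, ← mul_assoc (g ^ m)⁻¹, h1, E_inv, E_mul] at h2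
    have h3 := F.E_mem_of_mul hX h2 (-(2 : ZMod p)⁻¹) a
    have h4 := F.two_ne_zero'
    have e1 : -(2 : ZMod p)⁻¹ * (-b + -b) = b := by field_simp; ring
    have e2 : -(2 : ZMod p)⁻¹ * (-c + -c) = c := by field_simp; ring
    rw [e1, e2] at h3
    exact huK h3

lemma X_eq_zero_of_mem {K : Subgroup G} (hX : F.X 1 ∉ K) {a : ZMod p} (ha : F.X a ∈ K) : a = 0 := by
  by_contra h0
  exact hX (F.X_mem_of_ne_zero ha h0 1)

lemma D_of_centralizes {g : G} (h : g⁻¹ * (F.X 1)⁻¹ * g * F.X 1 = 1) :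
    F.D g = 1 ∨ F.D g = F.half := by
  obtain ⟨s, -, h1, h2⟩ := F.conj_X_eq g
  rw [← h2]
  rw [X_inv, h1, ← F.X_add, X_eq] at h
  obtain ⟨h3, -⟩ := F.E_eq_one h
  linear_combination -h3

lemma D_of_mem {lam : H →* ℂˣ} (hlam : HasKernel H K lam) (hXH : F.X 1 ∈ H) (hX : F.X 1 ∉ K)
    {g : G} (hg : g ∈ H) : F.D g = 1 ∨ F.D g = F.half := by
  refine F.D_of_centralizes ?_
  have h1 := hlam.commutator_mem hg hXH
  obtain ⟨s, -, h2, -⟩ := F.conj_X_eq g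
  rw [X_inv, h2, ← F.X_add] at h1 ⊢
  rw [F.X_eq_zero_of_mem hX h1, X_zero]

/-- `H` meets the Heisenberg group in more than the centre. -/
lemma exists_noncentral {lam : H →* ℂˣ} (h : IsShodaPair H K) (hlam : HasKernel H K lam)
    (hX : F.X 1 ∉ K) : ∃ a b c, F.E a b c ∈ H ∧ (b ≠ 0 ∨ c ≠ 0) := by
  have hXH := F.X_mem_of_isShodaPair h
  by_contra hcon
  push Not at hcon
  have hcen : ∀ g ∈ H, F.D g = 1 → ∃ a, g = F.X a := by
    intro g hg hD
    obtain ⟨a, b, c, rfl⟩ := F.exists_E_of_D hD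
    obtain ⟨rfl, rfl⟩ := hcon a b c hg
    exact ⟨a, (F.X_eq a).symm⟩
  by_cases hP : H ≤ F.D.ker
  · have hY : F.Y 1 ∈ H := by
      refine h.mem_of_forall ⊥ (F.Y 1) ?_ (by simp)
      intro a ha
      obtain ⟨e, rfl⟩ := hcen a ha (hP ha)
      rw [Subgroup.mem_bot, X_inv, Y_eq, mul_assoc _ (F.X (-e)), X_comm_E, ← mul_assoc,
        inv_mul_cancel, one_mul, ← F.X_add, neg_add_cancel, X_zero]
    rw [Y_eq] at hY
    exact one_ne_zero (hcon 0 1 0 hY).1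
  · obtain ⟨g, hg, hgP⟩ := SetLike.not_le_iff_exists.mp hP
    have hgD := (F.D_of_mem hlam hXH hX hg).resolve_left hgP
    obtain ⟨a1, h1⟩ := F.conj_of_D_half hgD 0 1 0
    -- This is `y⁻¹ * (g⁻¹ y g)`. Since `g²` lies in the centre of `P`, conjugation by `g` inverts
    -- it.
    set u := F.E 0 (-1) 0 * F.E a1 (-1) (-0) with hu
    have hu' : u = F.E a1 (-2) 0 := by rw [hu, E_mul]; congr 1 <;> ring
    obtain ⟨e2, h2⟩ := hcen (g * g) (H.mul_mem hg hg)
      (by rw [map_mul, hgD, half_mul_half])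
    have h3 : g⁻¹ * u * g = u⁻¹ := by
      have h5 : u = (F.E 0 1 0)⁻¹ * (g⁻¹ * F.E 0 1 0 * g) := by
        rw [h1, E_inv, hu]; congr 2 <;> ring
      have h6 : g⁻¹ * u * g = (g⁻¹ * F.E 0 1 0 * g)⁻¹ * ((g * g)⁻¹ * F.E 0 1 0 * (g * g)) := by
        rw [h5]; group
      have h7 : (g * g)⁻¹ * F.E 0 1 0 * (g * g) = F.E 0 1 0 := by
        rw [h2, mul_assoc, ← X_comm_E, inv_mul_cancel_left]
      rw [h6, h7, h5]; group
    have h8 : u ∈ H := by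
      refine h.mem_of_forall (Subgroup.zpowers u) u ?_ ?_
      · intro a ha
        rcases F.D_of_mem hlam hXH hX ha with hD | hD
        · obtain ⟨e, rfl⟩ := hcen a ha hD
          have : u⁻¹ * (F.X e)⁻¹ * u * F.X e = 1 := by
            rw [hu', mul_assoc, ← X_comm_E]; group
          rw [this]; exact Subgroup.one_mem _
        · obtain ⟨e, he⟩ := hcen (g⁻¹ * a) (H.mul_mem (H.inv_mem hg) ha)
            (by rw [map_mul, map_inv, hgD, hD, inv_mul_cancel])
          have ha' : a = g * F.X e := by rw [← he, mul_inv_cancel_left]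
          have h9 : a⁻¹ * u * a = u⁻¹ := by
            have : a⁻¹ * u * a = (F.X e)⁻¹ * (g⁻¹ * u * g) * F.X e := by rw [ha']; group
            rw [this, h3, hu', E_inv, mul_assoc, ← X_comm_E, inv_mul_cancel_left]
          have h10 : u⁻¹ * a⁻¹ * u * a = u⁻¹ * u⁻¹ := by
            rw [← h9]; group
          rw [h10]
          exact Subgroup.mul_mem _ (Subgroup.inv_mem _ (Subgroup.mem_zpowers u))
            (Subgroup.inv_mem _ (Subgroup.mem_zpowers u))
      · rintro x ⟨hx, hxH⟩
        obtain ⟨m, rfl⟩ := (mem_powers_iff_mem_zpowers (x := u)).mpr hx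
        simp only at hxH ⊢
        obtain ⟨a', h9⟩ := F.E_pow m a1 (-2) 0
        rw [← hu'] at h9
        rw [h9] at hxH
        have h10 := (hcon _ _ _ hxH).1
        have h11 : (m : ZMod p) = 0 := by
          have := F.two_ne_zero'
          have h12 : (m : ZMod p) * 2 = 0 := by linear_combination -h10
          exact (mul_eq_zero.mp h12).resolve_right this
        rw [ZMod.natCast_eq_zero_iff] at h11
        obtain ⟨j, rfl⟩ := h11
        rw [pow_mul, hu', E_pow_prime, one_pow]
        exact K.one_mem
    rw [hu'] at h8
    exact F.two_ne_zero' (neg_eq_zero.mp (hcon _ _ _ h8).1)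

/-- A noncentral element of `H` can be corrected by a central element to lie in the kernel. -/
lemma exists_E_mem_kernel {lam : H →* ℂˣ} (hlam : HasKernel H K lam) (hXH : F.X 1 ∈ H)
    (hX : F.X 1 ∉ K) {a b c : ZMod p} (h : F.E a b c ∈ H) : ∃ a', F.E a' b c ∈ K := by
  have hp : p.Prime := Fact.out
  have hX' : extendZero H lam (F.X 1) ≠ 1 := fun h => hX ((hasKernel_iff.mp hlam _).mpr h)
  have hpow : ∀ (m : ℕ) (g : G), g ∈ H →
      extendZero H lam (g ^ m) = extendZero H lam g ^ m := by
    intro m g hg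
    induction m with
    | zero => rw [pow_zero, pow_zero, extendZero_one]
    | succ m ih => rw [pow_succ, extendZero_mul lam hg, ih, pow_succ]
  have hXp : extendZero H lam (F.X 1) ^ p = 1 := by
    rw [← hpow _ _ hXH, ← X_natCast_mul, CharP.cast_eq_zero, zero_mul, X_zero, extendZero_one]
  -- The value at `x` generates all `p`-th roots of unity, so a power of `x` cancels the value at
  -- the given element.
  have hprim : IsPrimitiveRoot (extendZero H lam (F.X 1)) p := by
    have h1 := IsPrimitiveRoot.orderOf (extendZero H lam (F.X 1))
    rwa [orderOf_eq_prime hXp hX'] at h1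
  have hup : extendZero H lam (F.E a b c) ^ p = 1 := by
    rw [← hpow _ _ h, E_pow_prime, extendZero_one]
  obtain ⟨i, -, hi⟩ := hprim.eq_pow_of_pow_eq_one hup
  have hXi : F.X i = F.X 1 ^ i := by rw [← X_natCast_mul, mul_one]
  refine ⟨-i + a, ?_⟩
  rw [hasKernel_iff.mp hlam, ← X_mul_E, ← X_inv, extendZero_mul lam h, ← hi, ← hpow _ _ hXH, ← hXi,
    ← extendZero_mul lam, inv_mul_cancel, extendZero_one]
  rw [hXi]
  exact H.pow_mem hXH i

/-- If `K` contains `H ∩ P` then `H = G`, and if `H` contains `P` then all the relevant commutators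
lie in `H`. In the remaining case `x ∉ K`, and `H` contains `x`, a noncentral `u ∈ K` and an element
over `half`. An element meeting Mackey's hypothesis centralises `x`; after division by an element of
`H` it lies in `P` and commutes with `u`, so it lies in `⟨x, u⟩ ≤ H`. -/
theorem separates_of_isShodaPair (F : HeisenbergFrame G p n α k q) (h : IsShodaPair H K) : Separates H K := by
  obtain ⟨lam, hlam⟩ := h.exists_hasKernel
  have hXH := F.X_mem_of_isShodaPair h
  by_cases h1 : F.D.ker ⊓ H ≤ K
  · exact fun g _ => F.eq_top_of_isShodaPair h h1 g
  by_cases h2 : F.D.ker ≤ H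
  · exact F.separates_of_ker_le h h2
  obtain ⟨u, ⟨hu, huH⟩, huK⟩ := SetLike.not_le_iff_exists.mp h1
  have hX := F.X_notMem_of_isShodaPair h hlam hu huH huK h2
  obtain ⟨a0, b, c, h3, hbc⟩ := F.exists_noncentral h hlam hX
  obtain ⟨a, hK⟩ := F.exists_E_mem_kernel hlam hXH hX h3
  have hH := hlam.le hK
  -- elements of the Heisenberg group commuting with `E a b c` lie in `H`
  have hcomm : ∀ b1 c1 : ZMod p, b1 * c - b * c1 = 0 → ∃ s, b1 = s * b ∧ c1 = s * c := by
    intro b1 c1 h4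
    rcases hbc with hb | hc
    · refine ⟨b1 / b, by field_simp, ?_⟩
      field_simp
      linear_combination -h4
    · refine ⟨c1 / c, ?_, by field_simp⟩
      field_simp
      linear_combination h4
  -- If `H ≤ P`, then `H` consists of central multiples of powers of `u`. An element over `half`
  -- inverting `u` has all its commutators with `H` in `⟨u⟩ ≤ K`, so it would have to lie in `H`.
  have hnP : ¬ H ≤ F.D.ker := by
    intro hP
    obtain ⟨g, hgD, hg⟩ := F.exists_inverting a b c hbc
    have hgH : g ∈ H := by
      refine h.mem_of_forall K g ?_ inf_le_left
      intro e he
      obtain ⟨a1, b1, c1, rfl⟩ := F.exists_E_of_D (hP he)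
      have h5 := hlam.commutator_mem he hH
      rw [comm_E] at h5
      obtain ⟨s, rfl, rfl⟩ := hcomm b1 c1 (F.X_eq_zero_of_mem hX h5)
      obtain ⟨a2, h6⟩ := F.E_pow s.val a b c
      rw [ZMod.natCast_val, ZMod.cast_id] at h6
      have h7 : F.E a1 (s * b) (s * c) = F.X (a1 - a2) * F.E a b c ^ s.val := by
        rw [h6, X_mul_E]; congr 1; ring
      obtain ⟨e, -, he1, he2⟩ := F.conj_X_eq g
      rw [he2.mpr (Or.inr hgD)] at he1
      have h8 : g⁻¹ * F.E a1 (s * b) (s * c) * g = F.X (a1 - a2) * (F.E a b c ^ s.val)⁻¹ := by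
        have h9 : g⁻¹ * F.E a b c ^ s.val * g = (F.E a b c ^ s.val)⁻¹ := by
          have := conj_pow (i := s.val) (a := g⁻¹) (b := F.E a b c)
          rw [inv_inv, hg, inv_pow] at this
          exact this.symm
        have h10 : g⁻¹ * F.E a1 (s * b) (s * c) * g =
            (g⁻¹ * F.X (a1 - a2) * g) * (g⁻¹ * F.E a b c ^ s.val * g) := by rw [h7]; group
        rw [h10, h9, he1, one_mul]
      have h11 : g⁻¹ * (F.E a1 (s * b) (s * c))⁻¹ * g * F.E a1 (s * b) (s * c) =
          F.E a b c ^ s.val * F.E a b c ^ s.val := by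
        have h12 : g⁻¹ * (F.E a1 (s * b) (s * c))⁻¹ * g =
            (g⁻¹ * F.E a1 (s * b) (s * c) * g)⁻¹ := by group
        rw [h12, h8, h7]; group
      rw [h11]
      exact K.mul_mem (K.pow_mem hK _) (K.pow_mem hK _)
    exact F.half_ne_one (hgD.symm.trans (hP hgH))
  obtain ⟨v, hv, hvP⟩ := SetLike.not_le_iff_exists.mp hnP
  have hvD := (F.D_of_mem hlam hXH hX hv).resolve_left hvP
  intro g hg
  obtain ⟨s, -, hs, hs1⟩ := F.conj_X_eq g
  have hgD : F.D g = 1 ∨ F.D g = F.half := by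
    refine F.D_of_centralizes ?_
    have h4 := hg (F.X 1) hXH (by rw [hs]; exact F.X_mem_of_ne_zero hXH one_ne_zero _)
    rw [X_inv, hs, ← F.X_add] at h4 ⊢
    rw [F.X_eq_zero_of_mem hX h4, X_zero]
  -- reduce to an element of the Heisenberg group
  obtain ⟨e, he, heD⟩ : ∃ e ∈ H, F.D (g * e⁻¹) = 1 := by
    rcases hgD with h4 | h4
    · exact ⟨1, H.one_mem, by simpa using h4⟩
    · exact ⟨v, hv, by rw [map_mul, map_inv, h4, hvD, mul_inv_cancel]⟩
  obtain ⟨a1, b1, c1, h5⟩ := F.exists_E_of_D heD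
  have hge : g = F.E a1 b1 c1 * e := by rw [← h5, inv_mul_cancel_right]
  have h6 : g⁻¹ * F.E a b c * g = e⁻¹ * F.E a b c * e * F.X (b * c1 - b1 * c) := by
    obtain ⟨s', -, hs', hs1'⟩ := F.conj_X_eq e
    rw [hs1'.mpr (F.D_of_mem hlam hXH hX he)] at hs'
    have h7 : g⁻¹ * F.E a b c * g =
        e⁻¹ * ((F.E a1 b1 c1)⁻¹ * F.E a b c * F.E a1 b1 c1) * e := by rw [hge]; group
    have h8 : e⁻¹ * (F.E a b c * F.X (b * c1 - b1 * c)) * e =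
        (e⁻¹ * F.E a b c * e) * (e⁻¹ * F.X (b * c1 - b1 * c) * e) := by group
    rw [h7, E_conj, ← E_mul_X, h8, hs', one_mul]
  have h9 : e⁻¹ * F.E a b c * e ∈ K := hlam.conj_mem he hK
  have h10 : g⁻¹ * F.E a b c * g ∈ H := by
    rw [h6]
    exact H.mul_mem (hlam.le h9) (F.X_mem_of_ne_zero hXH one_ne_zero _)
  have h11 := hg _ hH h10
  -- The conjugates of `u` by `g` and by `e` both lie in `K` and differ by this central factor.
  have h12 : F.X (b * c1 - b1 * c) ∈ K := by
    have h13 : g⁻¹ * F.E a b c * g ∈ K := by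
      have h14 : g⁻¹ * (F.E a b c)⁻¹ * g * F.E a b c =
          (g⁻¹ * F.E a b c * g)⁻¹ * F.E a b c := by group
      rw [h14, K.mul_mem_cancel_right hK, K.inv_mem_iff] at h11
      exact h11
    rw [h6] at h13
    exact (K.mul_mem_cancel_left h9).mp h13
  have h13 := F.X_eq_zero_of_mem hX h12
  obtain ⟨s, rfl, rfl⟩ := hcomm b1 c1 (by linear_combination -h13)
  rw [hge]
  exact H.mul_mem (F.E_mem_of_mul hXH hH s a1) he

end HeisenbergFrame

/-! ### The listed pairs are Shoda pairs -/

namespace HeisenbergFrame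

variable {G : Type} [Group G] {p n : ℕ} {α k q : ZMod p} [Fact p.Prime]
  (F : HeisenbergFrame G p n α k q)

/-- The subgroup generated by the Heisenberg group and `w ^ 2 ^ i`. -/
def level (i : ℕ) : Subgroup G := (Subgroup.zpowers (F.D (F.w ^ 2 ^ i))).comap F.D

/-- The subgroup of the Heisenberg group lying over the line of slope `j`. -/
def line (j : ZMod p) : Subgroup G where
  carrier := {g | ∃ a b, g = F.E a b (j * b)}
  one_mem' := ⟨0, 0, by rw [mul_zero, E_zero]⟩
  mul_mem' := by
    rintro _ _ ⟨a, b, rfl⟩ ⟨a', b', rfl⟩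
    exact ⟨_, b + b', by rw [E_mul, mul_add]⟩
  inv_mem' := by
    rintro _ ⟨a, b, rfl⟩
    exact ⟨_, -b, by rw [E_inv, mul_neg]⟩

lemma v_mul_E (a b c : ZMod p) : F.v * F.E a b c = F.E a (-b) (-c) * F.v := by
  rw [← conj_v_E, v_inv, mul_assoc, v_sq, mul_one]

/-- The subgroup generated by `x`, `y` and the involution `v`. -/
def big : Subgroup G where
  carrier := {g | ∃ a b, g = F.E a b 0 ∨ g = F.E a b 0 * F.v}
  one_mem' := ⟨0, 0, Or.inl F.E_zero.symm⟩
  mul_mem' := by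
    rintro _ _ ⟨a, b, rfl | rfl⟩ ⟨a', b', rfl | rfl⟩
    · exact ⟨a + a', b + b', Or.inl (by rw [E_mul]; congr 1 <;> ring)⟩
    · exact ⟨a + a', b + b', Or.inr (by rw [← mul_assoc, E_mul]; congr 2 <;> ring)⟩
    · exact ⟨a + a', b + -b', Or.inr (by
        rw [mul_assoc, v_mul_E, ← mul_assoc, E_mul]; congr 2 <;> ring)⟩
    · exact ⟨a + a', b + -b', Or.inl (by
        rw [mul_assoc, ← mul_assoc F.v, v_mul_E, mul_assoc (F.E a' _ _), v_sq, mul_one, E_mul]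
        congr 1 <;> ring)⟩
  inv_mem' := by
    rintro _ ⟨a, b, rfl | rfl⟩
    · exact ⟨-a, -b, Or.inl (by rw [E_inv]; congr 1 <;> ring)⟩
    · exact ⟨-a, b, Or.inr (by rw [mul_inv_rev, v_inv, E_inv, v_mul_E]; congr 2 <;> ring)⟩

/-- The subgroup generated by `y`. -/
def small : Subgroup G where
  carrier := {g | ∃ b, g = F.E 0 b 0}
  one_mem' := ⟨0, F.E_zero.symm⟩
  mul_mem' := by
    rintro _ _ ⟨b, rfl⟩ ⟨b', rfl⟩
    exact ⟨b + b', by rw [E_mul]; congr 1 <;> ring⟩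
  inv_mem' := by
    rintro _ ⟨b, rfl⟩
    exact ⟨-b, by rw [E_inv]; congr 1 <;> ring⟩

/-- The subgroup generated by `y` and the involution `v`. -/
def smallV : Subgroup G where
  carrier := {g | ∃ b, g = F.E 0 b 0 ∨ g = F.E 0 b 0 * F.v}
  one_mem' := ⟨0, Or.inl F.E_zero.symm⟩
  mul_mem' := by
    rintro _ _ ⟨b, rfl | rfl⟩ ⟨b', rfl | rfl⟩
    · exact ⟨b + b', Or.inl (by rw [E_mul]; congr 1 <;> ring)⟩
    · exact ⟨b + b', Or.inr (by rw [← mul_assoc, E_mul]; congr 2 <;> ring)⟩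
    · exact ⟨b + -b', Or.inr (by
        rw [mul_assoc, v_mul_E, ← mul_assoc, E_mul]; congr 2 <;> ring)⟩
    · exact ⟨b + -b', Or.inl (by
        rw [mul_assoc, ← mul_assoc F.v, v_mul_E, mul_assoc (F.E 0 _ _), v_sq, mul_one, E_mul]
        congr 1 <;> ring)⟩
  inv_mem' := by
    rintro _ ⟨b, rfl | rfl⟩
    · exact ⟨-b, Or.inl (by rw [E_inv]; congr 1 <;> ring)⟩
    · exact ⟨b, Or.inr (by rw [mul_inv_rev, v_inv, E_inv, v_mul_E]; congr 2 <;> ring)⟩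

lemma E_mul_v_ne (a b c a' b' c' : ZMod p) : F.E a b c * F.v ≠ F.E a' b' c' := by
  intro h
  have := congrArg F.D h
  rw [map_mul, D_E, D_E, one_mul, D_v] at this
  exact F.half_ne_one this

lemma E_mem_line {j a b c : ZMod p} : F.E a b c ∈ F.line j ↔ c = j * b := by
  constructor
  · rintro ⟨a', b', h⟩
    obtain ⟨-, rfl, h⟩ := F.E_inj.mp h
    exact h
  · rintro rfl
    exact ⟨a, b, rfl⟩

lemma E_mem_big {a b c : ZMod p} : F.E a b c ∈ F.big ↔ c = 0 := by
  constructor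
  · rintro ⟨a', b', h | h⟩
    · exact (F.E_inj.mp h).2.2
    · exact (F.E_mul_v_ne _ _ _ _ _ _ h.symm).elim
  · rintro rfl
    exact ⟨a, b, Or.inl rfl⟩

lemma E_mul_v_mem_big {a b c : ZMod p} : F.E a b c * F.v ∈ F.big ↔ c = 0 := by
  constructor
  · rintro ⟨a', b', h | h⟩
    · exact (F.E_mul_v_ne _ _ _ _ _ _ h).elim
    · exact (F.E_inj.mp (mul_right_cancel h)).2.2
  · rintro rfl
    exact ⟨a, b, Or.inr rfl⟩

lemma E_mem_small {a b c : ZMod p} : F.E a b c ∈ F.small ↔ a = 0 ∧ c = 0 := by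
  constructor
  · rintro ⟨b', h⟩
    exact ⟨(F.E_inj.mp h).1, (F.E_inj.mp h).2.2⟩
  · rintro ⟨rfl, rfl⟩
    exact ⟨b, rfl⟩

lemma E_mem_smallV {a b c : ZMod p} : F.E a b c ∈ F.smallV ↔ a = 0 ∧ c = 0 := by
  constructor
  · rintro ⟨b', h | h⟩
    · exact ⟨(F.E_inj.mp h).1, (F.E_inj.mp h).2.2⟩
    · exact (F.E_mul_v_ne _ _ _ _ _ _ h.symm).elim
  · rintro ⟨rfl, rfl⟩
    exact ⟨b, Or.inl rfl⟩

lemma E_mul_v_mem_smallV {a b c : ZMod p} : F.E a b c * F.v ∈ F.smallV ↔ a = 0 ∧ c = 0 := by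
  constructor
  · rintro ⟨b', h | h⟩
    · exact (F.E_mul_v_ne _ _ _ _ _ _ h).elim
    · have := F.E_inj.mp (mul_right_cancel h)
      exact ⟨this.1, this.2.2⟩
  · rintro ⟨rfl, rfl⟩
    exact ⟨b, Or.inr rfl⟩

lemma E_mul_v_notMem_small {a b c : ZMod p} : F.E a b c * F.v ∉ F.small := by
  rintro ⟨b', h⟩
  exact F.E_mul_v_ne _ _ _ _ _ _ h

lemma line_le_ker (j : ZMod p) : F.line j ≤ F.D.ker := by
  rintro _ ⟨a, b, rfl⟩
  exact F.D_E ..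

lemma small_le_smallV : F.small ≤ F.smallV := by
  rintro _ ⟨b, rfl⟩
  exact ⟨b, Or.inl rfl⟩

lemma smallV_le_big : F.smallV ≤ F.big := by
  rintro _ ⟨b, h⟩
  exact ⟨0, b, h⟩

lemma ker_le_level (i : ℕ) : F.D.ker ≤ F.level i := by
  intro g hg
  rw [level, Subgroup.mem_comap, MonoidHom.mem_ker.mp hg]
  exact Subgroup.one_mem _

/-- The exponent `d` matters only modulo `2 ^ n`, and divisibility by `2 ^ i` is well defined there
because `i ≤ n`. -/
lemma mem_level {i : ℕ} (hi : i ≤ n) (a b c : ZMod p) (d : ℕ) :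
    F.E a b c * F.w ^ d ∈ F.level i ↔ 2 ^ i ∣ d := by
  rw [level, Subgroup.mem_comap, map_mul, D_E, one_mul]
  constructor
  · rw [Subgroup.mem_zpowers_iff]
    rintro ⟨z, hz⟩
    rw [D_w_pow, D_w_pow, ← ofAdd_zsmul] at hz
    have h1 : z • ((2 ^ i : ℕ) : ZMod (2 ^ n)) = (d : ZMod (2 ^ n)) := hz
    have h2 : ((z * (2 ^ i : ℕ) : ℤ) : ZMod (2 ^ n)) = ((d : ℤ) : ZMod (2 ^ n)) := by
      rw [zsmul_eq_mul] at h1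
      exact_mod_cast h1
    rw [ZMod.intCast_eq_intCast_iff] at h2
    have h3 : ((2 ^ i : ℕ) : ℤ) ∣ (2 ^ n : ℕ) := by exact_mod_cast pow_dvd_pow 2 hi
    have h4 := h2.of_dvd h3
    have h5 : ((2 ^ i : ℕ) : ℤ) ∣ d := by
      rw [← Int.modEq_zero_iff_dvd]
      exact h4.symm.trans (Int.modEq_zero_iff_dvd.mpr (Dvd.intro_left z rfl))
    exact_mod_cast h5
  · rintro ⟨e, rfl⟩
    rw [pow_mul, map_pow _ (F.w ^ 2 ^ i)]
    exact Subgroup.npow_mem_zpowers (F.D (F.w ^ 2 ^ i)) e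

/-- The coordinates of an element. -/
noncomputable def coord (g : G) : ZMod p × ZMod p × ZMod p :=
  ((F.exists_eq g).choose, (F.exists_eq g).choose_spec.choose,
    (F.exists_eq g).choose_spec.choose_spec.choose)

lemma coord_eq (a b c : ZMod p) (d : ℕ) : F.coord (F.E a b c * F.w ^ d) = (a, b, c) := by
  obtain ⟨d', h⟩ := (F.exists_eq (F.E a b c * F.w ^ d)).choose_spec.choose_spec.choose_spec
  set u := F.coord (F.E a b c * F.w ^ d) with hu
  change F.E a b c * F.w ^ d = F.E u.1 u.2.1 u.2.2 * F.w ^ d' at h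
  have h1 := congrArg F.D h
  rw [map_mul, map_mul, D_E, D_E, one_mul, one_mul] at h1
  have h2 : F.w ^ d = F.w ^ d' := by
    rw [D_w_pow, D_w_pow] at h1
    have h3 : ((d : ℕ) : ZMod (2 ^ n)) = d' := h1
    rw [ZMod.natCast_eq_natCast_iff] at h3
    exact pow_eq_pow_iff_modEq.mpr (h3.of_dvd (orderOf_dvd_of_pow_eq_one F.w_pow))
  rw [h2] at h
  obtain ⟨h3, h4, h5⟩ := F.E_inj.mp (mul_right_cancel h)
  rw [Prod.ext_iff, Prod.ext_iff]
  exact ⟨h3.symm, h4.symm, h5.symm⟩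

lemma coord_E (a b c : ZMod p) : F.coord (F.E a b c) = (a, b, c) := by
  have := F.coord_eq a b c 0
  rwa [pow_zero, mul_one] at this

lemma coord_E_mul_v (a b c : ZMod p) : F.coord (F.E a b c * F.v) = (a, b, c) :=
  F.coord_eq a b c _

/-- The homomorphism on the Heisenberg group whose kernel lies over the line of slope `j`. -/
noncomputable def lineHom (j : ZMod p) : F.D.ker →* Multiplicative (ZMod p) :=
  MonoidHom.mk' (fun g => Multiplicative.ofAdd ((F.coord g).2.2 - j * (F.coord g).2.1)) (by
    rintro ⟨g, hg⟩ ⟨h, hh⟩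
    obtain ⟨a, b, c, rfl⟩ := F.exists_E_of_D hg
    obtain ⟨a', b', c', rfl⟩ := F.exists_E_of_D hh
    rw [← ofAdd_add]
    congr 1
    simp only [Subgroup.coe_mul, E_mul, coord_E]
    ring)

/-- The homomorphism on `⟨x, y, v⟩` that reads off the exponent of `x`. -/
noncomputable def bigHom : F.big →* Multiplicative (ZMod p) :=
  MonoidHom.mk' (fun g => Multiplicative.ofAdd (F.coord g).1) (by
    rintro ⟨g, a, b, rfl | rfl⟩ ⟨h, a', b', rfl | rfl⟩
    · simp only [Subgroup.coe_mul, E_mul, coord_E, ← ofAdd_add]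
      congr 1; ring
    · simp only [Subgroup.coe_mul, ← mul_assoc, E_mul, coord_E, coord_E_mul_v, ← ofAdd_add]
      congr 1; ring
    · simp only [Subgroup.coe_mul]
      rw [mul_assoc, v_mul_E, ← mul_assoc, E_mul, coord_E_mul_v, coord_E_mul_v, coord_E, ← ofAdd_add]
      congr 1; ring
    · simp only [Subgroup.coe_mul]
      rw [mul_assoc, ← mul_assoc F.v, v_mul_E, mul_assoc (F.E a' _ _), v_sq, mul_one, E_mul, coord_E_mul_v, coord_E_mul_v,
        coord_E, ← ofAdd_add]
      congr 1; ring)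

/-- If `g` acts trivially on `P` modulo the line, so do its powers. For `g ∉ P` one of them lies
over `half` and acts as `-1`, which is nontrivial since `p` is odd. -/
lemma separates_line (j : ZMod p) : Separates F.D.ker (F.line j) := by
  intro g hg
  have h1 : ∀ h ∈ F.D.ker, g⁻¹ * h⁻¹ * g * h ∈ F.line j := fun h hh =>
    hg h hh (by rw [MonoidHom.mem_ker, D_conj]; exact hh)
  have h2 : ∀ (m : ℕ), ∀ h ∈ F.D.ker, (g ^ m)⁻¹ * h⁻¹ * g ^ m * h ∈ F.line j := by
    intro m
    induction m with
    | zero => intro h _; simp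
    | succ m ih =>
      intro h hh
      have h3 : g⁻¹ * h * g ∈ F.D.ker := by rw [MonoidHom.mem_ker, D_conj]; exact hh
      have h4 := (F.line j).mul_mem (ih _ h3) (h1 h hh)
      have h5 : (g ^ m)⁻¹ * (g⁻¹ * h * g)⁻¹ * g ^ m * (g⁻¹ * h * g) * (g⁻¹ * h⁻¹ * g * h) =
          (g ^ (m + 1))⁻¹ * h⁻¹ * g ^ (m + 1) * h := by
        rw [pow_succ']
        have : Commute (g ^ m) g := (Commute.refl g).pow_left m
        rw [← this.eq]; group
      rwa [h5] at h4
  by_contra hgP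
  obtain ⟨m, hm⟩ := F.exists_pow_D hgP
  have h3 := h2 m (F.E 0 0 1) (F.D_E ..)
  obtain ⟨a', h4⟩ := F.conj_of_D_half hm (-0 - 0 * 1) (-0) (-1)
  rw [E_inv, h4, E_mul, E_mem_line] at h3
  apply F.two_ne_zero'
  linear_combination h3

variable [Finite G]

/-- Testing on `x` forces `g` to lie over `1` or `half`; testing on `y` then puts `X (-c)` into `K`,
so `c = 0`. Only the two properties assumed of `K` matter, so both kernels are covered. -/
lemma separates_big {K : Subgroup G} (hY : ∀ b, F.Y b ∈ K) (hX : ∀ a, F.X a ∈ K → a = 0) :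
    Separates F.big K := by
  intro g hg
  obtain ⟨s, -, hs, hs1⟩ := F.conj_X_eq g
  have hXb : ∀ a, F.X a ∈ F.big := fun a => by rw [X_eq, E_mem_big]
  have hgD : F.D g = 1 ∨ F.D g = F.half := by
    refine F.D_of_centralizes ?_
    have h4 := hg (F.X 1) (hXb 1) (by rw [hs]; exact hXb _)
    rw [X_inv, hs, ← F.X_add] at h4 ⊢
    rw [hX _ h4, X_zero]
  rcases hgD with h | h
  · obtain ⟨a, b, c, rfl⟩ := F.exists_E_of_D h
    have h4 := hg (F.E 0 1 0) (F.E_mem_big.mpr rfl) (by rw [E_conj, E_mem_big])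
    rw [comm_E] at h4
    rw [E_mem_big]
    linear_combination -hX _ h4
  · obtain ⟨a, b, c, rfl⟩ := F.exists_E_mul_v h
    have h4 := hg (F.E 0 1 0) (F.E_mem_big.mpr rfl) (by
      rw [E_mul_v_conj, E_mem_big, neg_zero])
    have h5 : (F.E a b c * F.v)⁻¹ * (F.E 0 1 0)⁻¹ * (F.E a b c * F.v) * F.E 0 1 0 =
        F.X (-c) * F.Y 2 := by
      rw [E_inv, E_mul_v_conj, E_mul, Y_eq, X_mul_E]
      congr 1 <;> ring
    rw [h5, K.mul_mem_cancel_right (hY 2)] at h4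
    rw [E_mul_v_mem_big]
    linear_combination -hX _ h4

lemma separates_small : Separates F.big F.small :=
  F.separates_big (fun b => by rw [Y_eq, E_mem_small]; exact ⟨rfl, rfl⟩)
    (fun a h => by rw [X_eq, E_mem_small] at h; exact h.1)

lemma separates_smallV : Separates F.big F.smallV :=
  F.separates_big (fun b => by rw [Y_eq, E_mem_smallV]; exact ⟨rfl, rfl⟩)
    (fun a h => by rw [X_eq, E_mem_smallV] at h; exact h.1)

lemma isShodaPair_level (i : ℕ) : IsShodaPair ⊤ (F.level i) := by
  have : IsCyclic (Multiplicative (ZMod (2 ^ n)) ⧸ Subgroup.zpowers (F.D (F.w ^ 2 ^ i))) :=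
    isCyclic_of_surjective _ (QuotientGroup.mk'_surjective _)
  refine isShodaPair_of_hom le_top
    (((QuotientGroup.mk' (Subgroup.zpowers (F.D (F.w ^ 2 ^ i)))).comp F.D).comp
      (⊤ : Subgroup G).subtype) ?_ (fun g _ => Subgroup.mem_top g)
  intro h
  simp [level]

lemma isShodaPair_line (j : ZMod p) : IsShodaPair F.D.ker (F.line j) := by
  refine isShodaPair_of_hom (F.line_le_ker j) (F.lineHom j) ?_ (F.separates_line j)
  rintro ⟨g, hg⟩
  obtain ⟨a, b, c, rfl⟩ := F.exists_E_of_D hg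
  change Multiplicative.ofAdd _ = 1 ↔ _
  rw [ofAdd_eq_one, coord_E, E_mem_line, sub_eq_zero]

lemma isShodaPair_smallV : IsShodaPair F.big F.smallV := by
  refine isShodaPair_of_hom F.smallV_le_big F.bigHom ?_ F.separates_smallV
  rintro ⟨g, a, b, rfl | rfl⟩
  · change Multiplicative.ofAdd _ = 1 ↔ _
    rw [ofAdd_eq_one, coord_E, E_mem_smallV]
    simp
  · change Multiplicative.ofAdd _ = 1 ↔ _
    rw [ofAdd_eq_one, coord_E_mul_v, E_mul_v_mem_smallV]
    simp

lemma isCyclic_prod_zmod (F : HeisenbergFrame G p n α k q) :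
    IsCyclic (Multiplicative (ZMod p) × Multiplicative (ZMod (2 ^ n))) := by
  refine Group.isCyclic_prod_iff.mpr ⟨inferInstance, inferInstance, ?_⟩
  rw [Nat.card_eq_fintype_card, Nat.card_eq_fintype_card]
  have : NeZero (2 ^ n) := ⟨by positivity⟩
  rw [Fintype.card_multiplicative, Fintype.card_multiplicative, ZMod.card, ZMod.card]
  exact Nat.Coprime.pow_right n ((Nat.coprime_primes Fact.out Nat.prime_two).mpr F.ne_two)

/-- The exponents of `x` and `w` embed the quotient in a product of cyclic groups of coprime orders
`p` and `2 ^ n`. -/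
lemma isShodaPair_small : IsShodaPair F.big F.small := by
  have := F.isCyclic_prod_zmod
  refine isShodaPair_of_hom (F.small_le_smallV.trans F.smallV_le_big)
    (F.bigHom.prod (F.D.comp F.big.subtype)) ?_ F.separates_small
  rintro ⟨g, a, b, rfl | rfl⟩
  · change (Multiplicative.ofAdd (F.coord (F.E a b 0)).1, F.D (F.E a b 0)) = 1 ↔
      F.E a b 0 ∈ F.small
    rw [Prod.mk_eq_one, ofAdd_eq_one, coord_E, E_mem_small, D_E]
    simp
  · change (Multiplicative.ofAdd (F.coord (F.E a b 0 * F.v)).1, F.D (F.E a b 0 * F.v)) = 1 ↔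
      F.E a b 0 * F.v ∈ F.small
    rw [Prod.mk_eq_one, map_mul, D_E, one_mul, D_v]
    exact iff_of_false (fun h => F.half_ne_one h.2) F.E_mul_v_notMem_small

end HeisenbergFrame

/-! ### Eigenvectors and additive characters -/

section Eigenvectors

variable {G V : Type*} [Group G] [AddCommGroup V] [Module ℂ V] {ρ : Representation ℂ G V}

lemma exists_isEigenvector {H : Subgroup G} {v : V} (hv : v ≠ 0)
    (h : ∀ g ∈ H, ∃ c : ℂ, ρ g v = c • v) : ∃ lam : H →* ℂˣ, IsEigenvector ρ H lam v := by
  choose! c hc using h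
  have huniq : ∀ a b : ℂ, a • v = b • v → a = b := fun a b hab => smul_left_injective ℂ hv hab
  have hmul : ∀ g ∈ H, ∀ g' ∈ H, c (g * g') = c g * c g' := by
    intro g hg g' hg'
    apply huniq
    rw [← hc _ (H.mul_mem hg hg'), map_mul, Module.End.mul_apply, hc g' hg', map_smul, hc g hg,
      smul_smul, mul_comm]
  have hone : c 1 = 1 := by
    apply huniq
    rw [← hc 1 H.one_mem, map_one, Module.End.one_apply, one_smul]
  let f : H →* ℂ := ⟨⟨fun h => c h, hone⟩, fun a b => hmul a a.2 b b.2⟩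
  refine ⟨f.toHomUnits, hv, fun h => ?_⟩
  rw [MonoidHom.coe_toHomUnits]
  exact hc h h.2

lemma IsEigenvector.extendZero_eq_one_iff {H : Subgroup G} {lam : H →* ℂˣ} {v : V}
    (hv : IsEigenvector ρ H lam v) {a : G} : extendZero H lam a = 1 ↔ a ∈ H ∧ ρ a v = v := by
  by_cases ha : a ∈ H
  · rw [extendZero_of_mem lam ha]
    have h1 := hv.2 ⟨a, ha⟩
    constructor
    · intro h
      refine ⟨ha, ?_⟩
      rw [h1, h, one_smul]
    · rintro ⟨-, h⟩
      apply smul_left_injective ℂ hv.1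
      change _ • v = _ • v
      rw [← h1, one_smul, h]
  · rw [extendZero_of_notMem lam ha]
    exact iff_of_false zero_ne_one fun h => ha h.1

lemma IsEigenvector.hasKernel_iff {H K : Subgroup G} {lam : H →* ℂˣ} {v : V}
    (hv : IsEigenvector ρ H lam v) : HasKernel H K lam ↔ ∀ a, a ∈ K ↔ a ∈ H ∧ ρ a v = v := by
  rw [_root_.hasKernel_iff]
  simp_rw [hv.extendZero_eq_one_iff]

lemma exists_eigenvector_mem [FiniteDimensional ℂ V] (f : V →ₗ[ℂ] V) (W : Submodule ℂ V)
    (hW : ∀ v ∈ W, f v ∈ W) {u : V} (hu : u ∈ W) (hu0 : u ≠ 0) :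
    ∃ v ∈ W, v ≠ 0 ∧ ∃ μ : ℂ, f v = μ • v := by
  have : Nontrivial W := ⟨⟨u, hu⟩, 0, fun h => hu0 (congrArg Subtype.val h)⟩
  obtain ⟨μ, hμ⟩ := Module.End.exists_eigenvalue (f.restrict hW)
  obtain ⟨v, hv⟩ := hμ.exists_hasEigenvector
  refine ⟨v, v.2, fun h => hv.2 (Subtype.ext h), μ, ?_⟩
  exact congrArg Subtype.val hv.apply_eq_smul

lemma Representation.IsIrreducible.eq_top (hρ : ρ.IsIrreducible) (W : Submodule ℂ V)
    (hW : ∀ g, ∀ v ∈ W, ρ g v ∈ W) {u : V} (hu : u ∈ W) (hu0 : u ≠ 0) (v : V) : v ∈ W := by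
  let S : Subrepresentation ρ := ⟨W, fun g v hv => hW g v hv⟩
  rcases hρ.eq_bot_or_eq_top S with h | h
  · have : u ∈ S := hu
    rw [h] at this
    exact (hu0 this).elim
  · have : v ∈ S := by rw [h]; trivial
    exact this

lemma Representation.IsIrreducible.exists_ne_zero (hρ : ρ.IsIrreducible) : ∃ v : V, v ≠ 0 := by
  by_contra! h
  have := hρ.toNontrivial
  obtain ⟨S, T, hST⟩ := this
  apply hST
  ext v
  rw [h v]
  exact iff_of_true S.toSubmodule.zero_mem T.toSubmodule.zero_mem

lemma pow_val_of_map_add {p : ℕ} [NeZero p] {U : ZMod p → G} (hU : ∀ a b, U (a + b) = U a * U b)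
    (a : ZMod p) : U a = U 1 ^ a.val := by
  have h0 : U 0 = 1 := by
    have := hU 0 0
    rwa [add_zero, left_eq_mul] at this
  have h : ∀ m : ℕ, U m = U 1 ^ m := by
    intro m
    induction m with
    | zero => simpa using h0
    | succ m ih => rw [Nat.cast_succ, hU, ih, pow_succ]
  rw [← h, ZMod.natCast_val, ZMod.cast_id]

lemma exists_addChar {p : ℕ} [NeZero p] {U : ZMod p → G} (hU : ∀ a b, U (a + b) = U a * U b)
    {v : V} (hv : v ≠ 0) {ζ : ℂ} (h : ρ (U 1) v = ζ • v) :
    ∃ ψ : AddChar (ZMod p) ℂ, ∀ a, ρ (U a) v = ψ a • v := by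
  have h1 : ∀ m : ℕ, ρ (U 1 ^ m) v = ζ ^ m • v := by
    intro m
    induction m with
    | zero => simp
    | succ m ih =>
      rw [pow_succ', map_mul, Module.End.mul_apply, ih, map_smul, h, smul_smul, pow_succ]
  have h2 : ζ ^ p = 1 := by
    -- The representative of `-1` is `p - 1`, so `U (-1) * U 1 = 1` reads `U 1 ^ p = 1`.
    have h3 : U 1 ^ p = 1 := by
      have h4 := hU 0 0
      rw [add_zero, left_eq_mul] at h4
      have h5 := pow_val_of_map_add hU (-1)
      have h6 := hU (-1) 1
      rw [neg_add_cancel, h4, h5, ← pow_succ] at h6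
      have h7 : ((-1 : ZMod p).val + 1) = p := by
        obtain ⟨m, rfl⟩ := Nat.exists_eq_succ_of_ne_zero (NeZero.ne p)
        rw [ZMod.val_neg_one]
      rw [h7] at h6
      exact h6.symm
    apply smul_left_injective ℂ hv
    change _ • v = _ • v
    rw [← h1, h3, map_one, Module.End.one_apply, one_smul]
  refine ⟨AddChar.zmodChar p h2, fun a => ?_⟩
  rw [pow_val_of_map_add hU, h1, AddChar.zmodChar_apply]

end Eigenvectors

lemma addChar_eq_zero_of_eq_one {p : ℕ} [Fact p.Prime] {φ : AddChar (ZMod p) ℂ} (hφ : φ ≠ 1)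
    {c : ZMod p} (h : φ c = 1) : c = 0 := by
  by_contra hc
  apply hφ
  ext x
  have h1 : x = (x / c).val • c := by
    rw [nsmul_eq_mul, ZMod.natCast_val, ZMod.cast_id]; field_simp
  rw [h1, AddChar.map_nsmul_eq_pow, h, one_pow, AddChar.one_apply]

lemma exists_addChar_eq_mul {p : ℕ} [Fact p.Prime] {φ : AddChar (ZMod p) ℂ} (hφ : φ ≠ 1)
    (ψ : AddChar (ZMod p) ℂ) : ∃ m, ∀ b, ψ b = φ (m * b) := by
  have hp : ∀ χ : AddChar (ZMod p) ℂ, χ 1 ^ p = 1 := fun χ => by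
    rw [← AddChar.map_nsmul_eq_pow, nsmul_one, CharP.cast_eq_zero, AddChar.map_zero_eq_one]
  have hprim : IsPrimitiveRoot (φ 1) p := by
    refine IsPrimitiveRoot.mk_of_lt _ (Nat.Prime.pos Fact.out) (hp φ) fun l hl0 hl h => ?_
    rw [← AddChar.map_nsmul_eq_pow, nsmul_one] at h
    have := addChar_eq_zero_of_eq_one hφ h
    rw [ZMod.natCast_eq_zero_iff] at this
    exact absurd (Nat.le_of_dvd hl0 this) (not_le.mpr hl)
  obtain ⟨i, -, hi⟩ := hprim.eq_pow_of_pow_eq_one (hp ψ)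
  refine ⟨i, fun b => ?_⟩
  have h1 : b = b.val • 1 := by rw [nsmul_one, ZMod.natCast_val, ZMod.cast_id]
  have h2 : (i : ZMod p) * b = b.val • i • 1 := by
    rw [nsmul_one, nsmul_eq_mul, ZMod.natCast_val, ZMod.cast_id, mul_comm]
  rw [h2, AddChar.map_nsmul_eq_pow, AddChar.map_nsmul_eq_pow, hi, ← AddChar.map_nsmul_eq_pow, ← h1]

/-! ### Every irreducible representation contains a listed eigenvector -/

namespace HeisenbergFrame

variable {G : Type} [Group G] {p n : ℕ} {α k q : ZMod p} [Fact p.Prime]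
  (F : HeisenbergFrame G p n α k q)
  {V : Type*} [AddCommGroup V] [Module ℂ V] [FiniteDimensional ℂ V] {ρ : Representation ℂ G V}

lemma exists_eigenvector_level {u : V} (hu : u ≠ 0) (hP : ∀ g ∈ F.D.ker, ∀ x, ρ g x = x) :
    ∃ i ≤ n, ∃ (lam : (⊤ : Subgroup G) →* ℂˣ) (v : V),
      HasKernel ⊤ (F.level i) lam ∧ IsEigenvector ρ ⊤ lam v := by
  obtain ⟨v, -, hv, μ, hμ⟩ := exists_eigenvector_mem (ρ F.w) ⊤ (fun _ _ => trivial)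
    (Submodule.mem_top (x := u)) hu
  have h1 : ∀ d : ℕ, ρ (F.w ^ d) v = μ ^ d • v := by
    intro m
    induction m with
    | zero => simp
    | succ m ih =>
      rw [pow_succ', map_mul, Module.End.mul_apply, ih, map_smul, hμ, smul_smul, pow_succ]
  have h2 : ∀ a b c d, ρ (F.E a b c * F.w ^ d) v = μ ^ d • v := by
    intro a b c d
    rw [map_mul, Module.End.mul_apply, h1, hP _ (F.D_E a b c)]
  have huniq : ∀ a b : ℂ, a • v = b • v → a = b := fun a b hab => smul_left_injective ℂ hv hab
  have h3 : μ ^ 2 ^ n = 1 := by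
    apply huniq
    rw [← h1, F.w_pow, map_one, Module.End.one_apply, one_smul]
  obtain ⟨i, hi, h4⟩ := (Nat.dvd_prime_pow Nat.prime_two).mp (orderOf_dvd_of_pow_eq_one h3)
  obtain ⟨lam, hlam⟩ := exists_isEigenvector (ρ := ρ) (H := ⊤) hv (fun g _ => by
    obtain ⟨a, b, c, d, rfl⟩ := F.exists_eq g
    exact ⟨_, h2 a b c d⟩)
  refine ⟨i, hi, lam, v, hlam.hasKernel_iff.mpr fun g => ?_, hlam⟩
  obtain ⟨a, b, c, d, rfl⟩ := F.exists_eq g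
  change F.E a b c * F.w ^ d ∈ _ ↔ _ ∧ ρ (F.E a b c * F.w ^ d) v = v
  rw [F.mem_level hi, h2, ← h4, orderOf_dvd_iff_pow_eq_one]
  refine ⟨fun h => ⟨trivial, by rw [h, one_smul]⟩, fun h => huniq _ _ (by rw [h.2, one_smul])⟩

/-- Writing `ψ b = φ (m * b)`, the element `E a b c` acts by `φ (m * b + c)`, so the slope is `-m`.
Nontriviality of `φ` excludes the line in the direction of `z`. -/
lemma exists_eigenvector_line {v : V} (hv : v ≠ 0) (hX : ∀ a, ρ (F.X a) v = v)
    {ψ φ : AddChar (ZMod p) ℂ} (hY : ∀ b, ρ (F.Y b) v = ψ b • v)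
    (hZ : ∀ c, ρ (F.Z c) v = φ c • v) (hφ : φ ≠ 1) :
    ∃ (j : ZMod p) (lam : F.D.ker →* ℂˣ),
      HasKernel F.D.ker (F.line j) lam ∧ IsEigenvector ρ F.D.ker lam v := by
  have huniq : ∀ a b : ℂ, a • v = b • v → a = b := fun a b hab => smul_left_injective ℂ hv hab
  obtain ⟨m, hm⟩ := exists_addChar_eq_mul hφ ψ
  have h2 : ∀ a b c, ρ (F.E a b c) v = φ (m * b + c) • v := by
    intro a b c
    rw [E, map_mul, map_mul, Module.End.mul_apply, Module.End.mul_apply, hZ, map_smul, hY, map_smul,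
      map_smul, hX, smul_smul, hm, AddChar.map_add_eq_mul, mul_comm]
  obtain ⟨lam, hlam⟩ := exists_isEigenvector (ρ := ρ) (H := F.D.ker) hv (fun g hg => by
    obtain ⟨a, b, c, rfl⟩ := F.exists_E_of_D hg
    exact ⟨_, h2 a b c⟩)
  refine ⟨-m, lam, hlam.hasKernel_iff.mpr fun g => ?_, hlam⟩
  constructor
  · intro hg
    refine ⟨F.line_le_ker _ hg, ?_⟩
    obtain ⟨a, b, rfl⟩ := hg
    rw [h2, show m * b + -m * b = 0 by ring, AddChar.map_zero_eq_one, one_smul]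
  · rintro ⟨hg, h⟩
    obtain ⟨a, b, c, rfl⟩ := F.exists_E_of_D hg
    rw [h2] at h
    have := addChar_eq_zero_of_eq_one hφ (huniq _ 1 (by rw [h, one_smul]))
    rw [E_mem_line]
    linear_combination this

/-- The involution commutes with `x` and inverts `y`, so it preserves the joint eigenspace.
Eigenvalue `1` leads to `smallV`, eigenvalue `-1` to `small`. -/
lemma exists_eigenvector_big {v : V} (hv : v ≠ 0) {χ : AddChar (ZMod p) ℂ} (hχ : χ ≠ 1)
    (hX : ∀ a, ρ (F.X a) v = χ a • v) (hY : ∀ b, ρ (F.Y b) v = v) :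
    ∃ (K : Subgroup G) (lam : F.big →* ℂˣ) (v : V), (K = F.small ∨ K = F.smallV) ∧
      HasKernel F.big K lam ∧ IsEigenvector ρ F.big lam v := by
  let W : Submodule ℂ V :=
    { carrier := {u | (∀ a, ρ (F.X a) u = χ a • u) ∧ ∀ b, ρ (F.Y b) u = u}
      add_mem' := by
        rintro u u' ⟨h1, h2⟩ ⟨h1', h2'⟩
        exact ⟨fun a => by rw [map_add, h1, h1', smul_add], fun b => by rw [map_add, h2, h2']⟩
      zero_mem' := ⟨fun a => by simp, fun b => by simp⟩
      smul_mem' := by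
        rintro c u ⟨h1, h2⟩
        exact ⟨fun a => by rw [map_smul, h1, smul_comm], fun b => by rw [map_smul, h2]⟩ }
  obtain ⟨u, ⟨hX', hY'⟩, hu, μ, hμ⟩ := exists_eigenvector_mem (ρ F.v) W (by
    rintro u ⟨h1, h2⟩
    refine ⟨fun a => ?_, fun b => ?_⟩
    · rw [← Module.End.mul_apply, ← map_mul, X_eq,
        show F.E a 0 0 * F.v = F.v * F.E a 0 0 by rw [v_mul_E, neg_zero], ← X_eq, map_mul,
        Module.End.mul_apply, h1, map_smul]
    · rw [← Module.End.mul_apply, ← map_mul, Y_eq,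
        show F.E 0 b 0 * F.v = F.v * F.E 0 (-b) 0 by rw [v_mul_E, neg_zero, neg_neg], ← Y_eq,
        map_mul, Module.End.mul_apply, h2]) (show v ∈ W from ⟨hX, hY⟩) hv
  have huniq : ∀ a b : ℂ, a • u = b • u → a = b := fun a b hab => smul_left_injective ℂ hu hab
  have h1 : ∀ a b, ρ (F.E a b 0) u = χ a • u := by
    intro a b
    rw [E, Z_zero, mul_one, map_mul, Module.End.mul_apply, hY', hX']
  have h2 : ∀ a b, ρ (F.E a b 0 * F.v) u = (χ a * μ) • u := by
    intro a b
    rw [map_mul, Module.End.mul_apply, hμ, map_smul, h1, smul_smul, mul_comm]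
  obtain ⟨lam, hlam⟩ := exists_isEigenvector (ρ := ρ) (H := F.big) hu (by
    rintro g ⟨a, b, rfl | rfl⟩
    · exact ⟨_, h1 a b⟩
    · exact ⟨_, h2 a b⟩)
  have h3 : ∀ a b, ρ (F.E a b 0) u = u ↔ a = 0 := by
    intro a b
    rw [h1]
    refine ⟨fun h => addChar_eq_zero_of_eq_one hχ (huniq _ 1 (by rw [h, one_smul])), ?_⟩
    rintro rfl
    rw [AddChar.map_zero_eq_one, one_smul]
  have hμ2 : μ * μ = 1 := by
    apply huniq
    rw [← smul_smul, ← hμ, ← map_smul, ← hμ, ← Module.End.mul_apply, ← map_mul, v_sq, map_one,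
      Module.End.one_apply, one_smul]
  rcases mul_self_eq_one_iff.mp hμ2 with rfl | rfl
  · refine ⟨F.smallV, lam, u, Or.inr rfl, hlam.hasKernel_iff.mpr fun g => ?_, hlam⟩
    have h4 : ∀ a b, ρ (F.E a b 0 * F.v) u = u ↔ a = 0 := by
      intro a b
      rw [h2, mul_one, ← h1 a b, h3]
    constructor
    · intro hg
      refine ⟨F.smallV_le_big hg, ?_⟩
      obtain ⟨b, rfl | rfl⟩ := hg
      · exact (h3 0 b).mpr rfl
      · exact (h4 0 b).mpr rfl
    · rintro ⟨⟨a, b, rfl | rfl⟩, h⟩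
      · exact F.E_mem_smallV.mpr ⟨(h3 a b).mp h, rfl⟩
      · exact F.E_mul_v_mem_smallV.mpr ⟨(h4 a b).mp h, rfl⟩
  · refine ⟨F.small, lam, u, Or.inl rfl, hlam.hasKernel_iff.mpr fun g => ?_, hlam⟩
    constructor
    · intro hg
      refine ⟨F.smallV_le_big (F.small_le_smallV hg), ?_⟩
      obtain ⟨b, rfl⟩ := hg
      exact (h3 0 b).mpr rfl
    · rintro ⟨⟨a, b, rfl | rfl⟩, h⟩
      · exact F.E_mem_small.mpr ⟨(h3 a b).mp h, rfl⟩
      · exfalso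
        rw [h2] at h
        -- A `p`-th root of unity equal to `-1` is impossible for odd `p`.
        have h5 : χ a * -1 = 1 := huniq _ 1 (by rw [h, one_smul])
        have h6 : χ (a + a) = 1 := by
          rw [AddChar.map_add_eq_mul]
          linear_combination (1 - χ a) * h5
        have h7 := addChar_eq_zero_of_eq_one hχ h6
        rw [← two_mul] at h7
        rw [(mul_eq_zero.mp h7).resolve_left F.two_ne_zero', AddChar.map_zero_eq_one] at h5
        norm_num at h5

/-- The pairs that give the irreducible characters, with the slopes of the lines in `J`. -/
def listed (J : Set (ZMod p)) : Set (Subgroup G × Subgroup G) :=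
  {s | ∃ i ≤ n, s = (⊤, F.level i)} ∪ {s | ∃ j ∈ J, s = (F.D.ker, F.line j)} ∪
    {(F.big, F.small), (F.big, F.smallV)}

theorem exists_listed_eigenvector (hρ : ρ.IsIrreducible) :
    ∃ (H K : Subgroup G) (lam : H →* ℂˣ) (v : V),
      (H, K) ∈ F.listed Set.univ ∧ HasKernel H K lam ∧ IsEigenvector ρ H lam v := by
  have hcomm : ∀ {g h g' h' : G} (x : V), g * h = g' * h' → ρ g (ρ h x) = ρ g' (ρ h' x) := by
    intro g h g' h' x hgh
    rw [← Module.End.mul_apply, ← map_mul, hgh, map_mul, Module.End.mul_apply]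
  obtain ⟨u, hu⟩ := hρ.exists_ne_zero
  obtain ⟨v, -, hv, ζ, hζ⟩ := exists_eigenvector_mem (ρ (F.X 1)) ⊤ (fun _ _ => trivial)
    (Submodule.mem_top (x := u)) hu
  obtain ⟨χ, hχX⟩ := exists_addChar F.X_add hv hζ
  let W : Submodule ℂ V :=
    { carrier := {u | ∀ a, ρ (F.X a) u = χ a • u}
      add_mem' := fun {u u'} h1 h1' a => by rw [map_add, h1, h1', smul_add]
      zero_mem' := fun a => by simp
      smul_mem' := fun c u h1 a => by rw [map_smul, h1, smul_comm] }
  have hWE : ∀ a b c, ∀ u ∈ W, ρ (F.E a b c) u ∈ W := by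
    intro a b c u hu e
    rw [hcomm u (F.X_comm_E e a b c), hu, map_smul]
  obtain ⟨u, huW, hu, ζ', hζ'⟩ := exists_eigenvector_mem (ρ (F.Y 1)) W
    (fun u hu => by rw [Y_eq]; exact hWE _ _ _ _ hu) (show v ∈ W from hχX) hv
  obtain ⟨ψ, hψY⟩ := exists_addChar F.Y_add hu hζ'
  by_cases hχ : χ = 1
  · subst hχ
    -- The fixed space of the normal subgroup `⟨x⟩` is invariant and nonzero, hence everything.
    have hX1 : ∀ x, x ∈ W := by
      refine hρ.eq_top W (fun g x hx a => ?_) huW hu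
      obtain ⟨s, -, hs, -⟩ := F.conj_X_eq g
      rw [hcomm x (show F.X a * g = g * F.X (s * a) by rw [← hs]; group), hx]
      simp
    have hX : ∀ a x, ρ (F.X a) x = x := fun a x => by rw [hX1 x a]; simp
    let W' : Submodule ℂ V :=
      { carrier := {u | ∀ b, ρ (F.Y b) u = ψ b • u}
        add_mem' := fun {u u'} h1 h1' a => by rw [map_add, h1, h1', smul_add]
        zero_mem' := fun a => by simp
        smul_mem' := fun c u h1 a => by rw [map_smul, h1, smul_comm] }
    obtain ⟨v, hvW, hv, ζ'', hζ''⟩ := exists_eigenvector_mem (ρ (F.Z 1)) W' (by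
      intro u hu b
      rw [hcomm u ((F.Y_mul_Z b 1).trans (mul_assoc _ _ _)), map_mul, Module.End.mul_apply, hX, hu,
        map_smul]) (show u ∈ W' from hψY) hu
    obtain ⟨φ, hφZ⟩ := exists_addChar F.Z_add hv hζ''
    by_cases hφ : φ = 1
    · subst hφ
      by_cases hψ : ψ = 1
      · subst hψ
        let T : Submodule ℂ V :=
          { carrier := {u | ∀ g ∈ F.D.ker, ρ g u = u}
            add_mem' := fun {u u'} h1 h1' a ha => by rw [map_add, h1 a ha, h1' a ha]
            zero_mem' := fun a _ => by simp
            smul_mem' := fun c u h1 a ha => by rw [map_smul, h1 a ha] }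
        have hT : ∀ x, x ∈ T := by
          refine hρ.eq_top T (fun g x hx a ha => ?_) (u := v) (fun g hg => ?_) hv
          · rw [hcomm x (show a * g = g * (g⁻¹ * a * g) by group), hx]
            rw [MonoidHom.mem_ker, D_conj]; exact ha
          · obtain ⟨a, b, c, rfl⟩ := F.exists_E_of_D hg
            rw [E, map_mul, map_mul, Module.End.mul_apply, Module.End.mul_apply, hφZ,
              AddChar.one_apply, one_smul, hvW, AddChar.one_apply, one_smul, hX]
        obtain ⟨i, hi, lam, v', h1, h2⟩ := F.exists_eigenvector_level hv (fun g hg x => hT x g hg)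
        exact ⟨_, _, lam, v', Or.inl (Or.inl ⟨i, hi, rfl⟩), h1, h2⟩
      · have hinj := (ρ.apply_bijective F.w).injective
        -- The kernel is the line through `z`, which has no slope. Applying `w` exchanges the roles
        -- of `y` and `z`.
        obtain ⟨j, lam, h1, h2⟩ := F.exists_eigenvector_line (v := ρ F.w v)
          (ψ := 1) (φ := AddChar.mulShift ψ q) (fun h => hv (hinj (by rw [h, map_zero])))
          (fun a => hX a _)
          (fun b => by
            rw [hcomm v (show F.Y b * F.w = F.w * F.Z (k * b) by rw [← F.conj_Y]; group), hφZ]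
            simp)
          (fun c => by
            rw [hcomm v (show F.Z c * F.w = F.w * F.Y (q * c) by rw [← F.conj_Z]; group), hvW,
              map_smul, AddChar.mulShift_apply])
          (fun h => hψ (by
            ext x
            have := DFunLike.congr_fun h (x / q)
            rwa [AddChar.mulShift_apply, mul_div_cancel₀ _ F.q_ne_zero] at this))
        exact ⟨_, _, lam, _, Or.inl (Or.inr ⟨j, trivial, rfl⟩), h1, h2⟩
    · obtain ⟨j, lam, h1, h2⟩ := F.exists_eigenvector_line hv (fun a => hX a v) hvW hφZ hφ
      exact ⟨_, _, lam, v, Or.inl (Or.inr ⟨j, trivial, rfl⟩), h1, h2⟩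
  · obtain ⟨m, hm⟩ := exists_addChar_eq_mul hχ ψ
    have hinj := (ρ.apply_bijective (F.Z (-m))).injective
    -- Moving `y^b` past `z^(-m)` costs the scalar `χ (-m * b)`, which cancels `ψ b = χ (m * b)`.
    obtain ⟨K, lam, v', h0, h1, h2⟩ := F.exists_eigenvector_big (v := ρ (F.Z (-m)) u)
      (fun h => hu (hinj (by rw [h, map_zero]))) hχ (by
        rw [Z_eq]; exact hWE _ _ _ _ huW) (by
        intro b
        rw [hcomm u ((F.Y_mul_Z b (-m)).trans (mul_assoc _ _ _)), ← F.X_mul_Y, map_mul,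
          Module.End.mul_apply, hψY, map_smul, huW, smul_smul, hm, ← AddChar.map_add_eq_mul,
          show m * b + b * -m = 0 by ring, AddChar.map_zero_eq_one, one_smul])
    exact ⟨_, _, lam, v', Or.inr (by rcases h0 with rfl | rfl <;> simp), h1, h2⟩

/-- Applying `g` to the eigenvector conjugates the kernel; this moves a line to the chosen
representative of its class. -/
lemma exists_conj_eigenvector {H K : Subgroup G} (hH : H.Normal) {lam : H →* ℂˣ} {v : V}
    (hK : HasKernel H K lam) (hv : IsEigenvector ρ H lam v) (g : G) :
    ∃ (lam' : H →* ℂˣ) (v' : V), HasKernel H (K.map (MulAut.conj g).toMonoidHom) lam' ∧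
      IsEigenvector ρ H lam' v' := by
  have hinj := (ρ.apply_bijective g).injective
  have hcomm : ∀ a, ρ a (ρ g v) = ρ g (ρ (g⁻¹ * a * g) v) := by
    intro a
    rw [← Module.End.mul_apply, ← map_mul, ← Module.End.mul_apply, ← map_mul]
    congr 2; group
  have hconj : ∀ a ∈ H, g⁻¹ * a * g ∈ H := fun a ha => by
    simpa using hH.conj_mem a ha g⁻¹
  obtain ⟨lam', hlam'⟩ := exists_isEigenvector (ρ := ρ) (H := H) (v := ρ g v)
    (fun h => hv.1 (hinj (by rw [h, map_zero]))) (fun a ha => by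
      rw [hcomm]
      exact ⟨_, by rw [← map_smul]; exact congrArg _ (hv.2 ⟨_, hconj a ha⟩)⟩)
  refine ⟨lam', _, hlam'.hasKernel_iff.mpr fun a => ?_, hlam'⟩
  have hK' := hv.hasKernel_iff.mp hK
  rw [hcomm, hinj.eq_iff, Subgroup.mem_map_equiv, hK', MulAut.conj_symm_apply]
  refine and_congr_left fun _ => ⟨fun h => ?_, hconj a⟩
  have := hH.conj_mem _ h g
  convert this using 1; group

end HeisenbergFrame

lemma shodaEquivalent_of_isEigenvector {G V : Type*} [Group G] [Finite G] [AddCommGroup V]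
    [Module ℂ V] [FiniteDimensional ℂ V] {ρ : Representation ℂ G V} (hρ : ρ.IsIrreducible)
    {H K H' K' : Subgroup G} {lam : H →* ℂˣ} {lam' : H' →* ℂˣ} {v v' : V}
    (hK : HasKernel H K lam) (hS : Separates H K) (hv : IsEigenvector ρ H lam v)
    (hK' : HasKernel H' K' lam') (hS' : Separates H' K') (hv' : IsEigenvector ρ H' lam' v') :
    ShodaEquivalent (H, K) (H', K') := by
  refine ⟨_, ⟨lam, hK, rfl⟩, lam', hK', ?_⟩
  have h1 := character_eq_indChar ρ hρ hK hS hv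
  rw [character_eq_indChar ρ hρ hK' hS' hv'] at h1
  congr 1
  ext m
  exact (congrFun h1 m).symm

/-! ### Conjugacy of slopes and separation of the listed pairs -/

namespace HeisenbergFrame

variable {G : Type} [Group G] {p n : ℕ} {α k q : ZMod p} [Fact p.Prime]
  (F : HeisenbergFrame G p n α k q)

lemma neg_alpha_eq (F : HeisenbergFrame G p n α k q) : k * q = -α := by
  linear_combination F.alpha_eq

/-- Elements of the Heisenberg group conjugated by an even power of `w`, up to the centre. -/
lemma conj_even (g : G) (a b c : ZMod p) (m : ℕ) (e f h : ZMod p)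
    (hg : g = F.E e f h * F.w ^ (2 * m)) :
    ∃ a', g⁻¹ * F.E a b c * g = F.E a' ((-α) ^ m * b) ((-α) ^ m * c) := by
  refine ⟨α ^ (2 * m) * (a + (b * h - f * c)), ?_⟩
  rw [hg, ← conj_sq_pow_E, ← E_conj F a b c e f h]
  group

/-- Elements of the Heisenberg group conjugated by an odd power of `w`, up to the centre. -/
lemma conj_odd (g : G) (a b c : ZMod p) (m : ℕ) (e f h : ZMod p)
    (hg : g = F.E e f h * F.w ^ (2 * m + 1)) :
    ∃ a', g⁻¹ * F.E a b c * g = F.E a' (q * ((-α) ^ m * c)) (k * ((-α) ^ m * b)) := by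
  obtain ⟨a', h1⟩ := F.conj_even (F.E e f h * F.w ^ (2 * m)) a b c m e f h rfl
  refine ⟨α * (a' + (-α) ^ m * b * ((-α) ^ m * c)), ?_⟩
  rw [← conj_E, ← h1, hg, pow_succ]
  simp only [mul_inv_rev, mul_assoc]

lemma neg_alpha_pow_ne_zero (F : HeisenbergFrame G p n α k q) (m : ℕ) : (-α) ^ m ≠ 0 :=
  pow_ne_zero m (neg_ne_zero.mpr F.alpha_ne_zero)

/-- Modulo the centre, even powers of `w` are scalars and keep every slope, while odd powers send
the direction `(1, i)` to a multiple of `(q * i, k)`. -/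
lemma line_le_line_of_conj {g : G} {i j : ZMod p} (h : ∀ a ∈ F.line i, g⁻¹ * a * g ∈ F.line j) :
    i = j ∨ q * i * j = k := by
  obtain ⟨e, f, c, d, hg⟩ := F.exists_eq g
  have h1 := h (F.E 0 1 (i * 1)) (F.E_mem_line.mpr rfl)
  rcases Nat.even_or_odd' d with ⟨m, rfl | rfl⟩
  · obtain ⟨a', h2⟩ := F.conj_even g 0 1 (i * 1) m e f c hg
    rw [h2, E_mem_line] at h1
    left
    apply mul_left_cancel₀ (F.neg_alpha_pow_ne_zero m)
    linear_combination h1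
  · obtain ⟨a', h2⟩ := F.conj_odd g 0 1 (i * 1) m e f c hg
    rw [h2, E_mem_line] at h1
    right
    apply mul_left_cancel₀ (F.neg_alpha_pow_ne_zero m)
    linear_combination -h1

lemma map_conj_line_w {i j : ZMod p} (h : q * i * j = k) :
    (F.line i).map (MulAut.conj F.w).toMonoidHom = F.line j := by
  have hi : i ≠ 0 := by
    rintro rfl
    apply F.k_ne_zero
    rw [← h]; ring
  have hconj : ∀ a b, F.w⁻¹ * F.E a b (j * b) * F.w =
      F.E (α * (a + b * (j * b))) (q * j * b) (i * (q * j * b)) := by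
    intro a b
    rw [conj_E]
    congr 1
    · ring
    · rw [← h]; ring
  ext g
  rw [Subgroup.mem_map_equiv, MulAut.conj_symm_apply]
  constructor
  · rintro ⟨a, b, hg⟩
    have h1 : g = F.w * F.E a b (i * b) * F.w⁻¹ := by rw [← hg]; group
    have h2 : F.D g = 1 := by
      rw [h1, map_mul, map_mul, D_E, map_inv, mul_one, mul_inv_cancel]
    obtain ⟨a', b', c', rfl⟩ := F.exists_E_of_D h2
    rw [conj_E, E_inj] at hg
    rw [E_mem_line]
    apply mul_left_cancel₀ (mul_ne_zero F.q_ne_zero hi)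
    rw [← hg.2.1] at hg
    linear_combination b' * (-h) - hg.2.2
  · rintro ⟨a, b, rfl⟩
    exact ⟨_, _, hconj a b⟩

lemma map_conj_line_iff {i j : ZMod p} :
    (∃ g, (F.line i).map (MulAut.conj g).toMonoidHom = F.line j) ↔ i = j ∨ q * i * j = k := by
  constructor
  · rintro ⟨g, hg⟩
    refine F.line_le_line_of_conj (g := g⁻¹) fun a ha => ?_
    rw [← hg]
    refine Subgroup.mem_map.mpr ⟨a, ha, ?_⟩
    simp
  · rintro (rfl | h)
    · exact ⟨1, by ext g; simp⟩
    · exact ⟨F.w, F.map_conj_line_w h⟩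

lemma ker_not_le_line (j : ZMod p) : ∃ h ∈ F.D.ker, h ∉ F.line j :=
  ⟨F.E 0 0 1, F.D_E .., fun h => one_ne_zero (by rw [E_mem_line, mul_zero] at h; exact h)⟩

lemma hasFixed_ker_level (i : ℕ) : HasFixed F.D.ker ⊤ (F.level i) := by
  refine ⟨1, fun h _ hh => F.ker_le_level i ?_⟩
  simpa using hh

lemma not_hasFixed_ker_line (j : ZMod p) : ¬ HasFixed F.D.ker F.D.ker (F.line j) := by
  rintro ⟨t, ht⟩
  obtain ⟨h, h1, h2⟩ := F.ker_not_le_line j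
  refine h2 (ht h h1 ?_)
  have := F.D_conj t⁻¹ h
  rw [inv_inv] at this
  rw [MonoidHom.mem_ker, this]; exact h1

/-- All conjugates of `x` are powers of `x`, so `x` obstructs every choice of conjugate. -/
lemma not_hasFixed_big {A K : Subgroup G} (hA : ∀ a, F.X a ∈ A) (hK : F.X 1 ∉ K) :
    ¬ HasFixed A F.big K := by
  rintro ⟨t, ht⟩
  refine hK (ht (F.X 1) (by rw [X_eq, E_mem_big]) ?_)
  obtain ⟨s, -, hs, -⟩ := F.conj_X_eq t⁻¹
  rw [inv_inv] at hs
  rw [hs]; exact hA _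

lemma X_notMem_small : F.X 1 ∉ F.small := by
  rw [X_eq, E_mem_small]; exact fun h => one_ne_zero h.1

lemma X_notMem_smallV : F.X 1 ∉ F.smallV := by
  rw [X_eq, E_mem_smallV]; exact fun h => one_ne_zero h.1

lemma X_mem_ker (a : ZMod p) : F.X a ∈ F.D.ker := F.D_X a

lemma X_mem_line (a j : ZMod p) : F.X a ∈ F.line j := by
  rw [X_eq, E_mem_line, mul_zero]

lemma hasFixed_level_iff {i i' : ℕ} (hi' : i' ≤ n) :
    HasFixed (F.level i) ⊤ (F.level i') ↔ i' ≤ i := by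
  constructor
  · rintro ⟨t, ht⟩
    have h1 := ht (F.w ^ 2 ^ i) trivial (by
      have := F.D_conj t⁻¹ (F.w ^ 2 ^ i)
      rw [inv_inv] at this
      rw [level, Subgroup.mem_comap, this]
      exact Subgroup.mem_zpowers _)
    have h2 := (F.mem_level hi' 0 0 0 (2 ^ i)).mp (by rwa [E_zero, one_mul])
    exact (Nat.pow_dvd_pow_iff_le_right (by norm_num)).mp h2
  · intro h
    refine ⟨1, fun g _ hg => ?_⟩
    rw [one_mul, inv_one, mul_one, level, Subgroup.mem_comap] at hg
    rw [level, Subgroup.mem_comap]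
    refine Subgroup.zpowers_le.mpr ?_ hg
    obtain ⟨c, hc⟩ := pow_dvd_pow 2 h
    rw [hc, pow_mul, map_pow _ (F.w ^ 2 ^ i')]
    exact Subgroup.npow_mem_zpowers (F.D (F.w ^ 2 ^ i')) c

lemma hasFixed_line {i j : ZMod p} (h : HasFixed (F.line i) F.D.ker (F.line j)) :
    i = j ∨ q * i * j = k := by
  obtain ⟨t, ht⟩ := h
  refine F.line_le_line_of_conj (g := t) fun a ha => ht _ ?_ ?_
  · rw [MonoidHom.mem_ker, D_conj]; exact F.line_le_ker i ha
  · convert ha using 1; group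

lemma hasFixed_of_le {H K : Subgroup G} : HasFixed K H K :=
  ⟨1, fun h _ hh => by simpa using hh⟩

/-- Whatever the conjugating element, some element of `smallV` is carried into `big` but outside
`small`. -/
lemma not_hasFixed_small : ¬ HasFixed F.smallV F.big F.small := by
  rintro ⟨t, ht⟩
  have key : ∀ a ∈ F.smallV, t⁻¹ * a * t ∈ F.big → t⁻¹ * a * t ∈ F.small := fun a ha h =>
    ht _ h (by convert ha using 1; group)
  obtain ⟨a, b, c, d, ht'⟩ := F.exists_eq t
  change t = F.E a b c * F.w ^ d at ht'
  have hcomm : ∀ m, (F.w ^ m)⁻¹ * F.v * F.w ^ m = F.v := by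
    intro m
    rw [v]
    group
  have hv : ∀ s, (F.E a b c)⁻¹ * (F.E 0 s 0 * F.v) * F.E a b c =
      F.E (s * c - 2 * b * c) (s - 2 * b) (-(2 * c)) * F.v := by
    intro s
    rw [mul_assoc, mul_assoc, v_mul_E, E_inv, ← mul_assoc, ← mul_assoc, E_mul, E_mul]
    congr 2 <;> ring
  have hconj : ∀ s, t⁻¹ * (F.E 0 s 0 * F.v) * t =
      ((F.w ^ d)⁻¹ * F.E (s * c - 2 * b * c) (s - 2 * b) (-(2 * c)) * F.w ^ d) * F.v := by
    intro s
    have h1 : t⁻¹ * (F.E 0 s 0 * F.v) * t =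
        (F.w ^ d)⁻¹ * ((F.E a b c)⁻¹ * (F.E 0 s 0 * F.v) * F.E a b c) * F.w ^ d := by
      rw [ht']; simp only [mul_inv_rev, mul_assoc]
    rw [h1, hv]
    conv_rhs => rw [← hcomm d]
    group
  have hmem : ∀ s, F.E 0 s 0 * F.v ∈ F.smallV := fun s => F.E_mul_v_mem_smallV.mpr ⟨rfl, rfl⟩
  rcases Nat.even_or_odd' d with ⟨m, rfl | rfl⟩
  -- For an even power of `w`, testing on `y` forces `c = 0`, and then `v` itself is the witness.
  · have hc : c = 0 := by
      have h1 := key (F.E 0 1 0) (F.E_mem_smallV.mpr ⟨rfl, rfl⟩)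
      have h2 : t⁻¹ * F.E 0 1 0 * t = F.E (α ^ (2 * m) * c) ((-α) ^ m) 0 := by
        have h3 : t⁻¹ * F.E 0 1 0 * t = (F.w ^ (2 * m))⁻¹ *
            ((F.E a b c)⁻¹ * F.E 0 1 0 * F.E a b c) * F.w ^ (2 * m) := by
          rw [ht']; simp only [mul_inv_rev, mul_assoc]
        rw [h3, E_conj, conj_sq_pow_E]
        congr 1 <;> ring
      rw [h2, E_mem_big, E_mem_small] at h1
      exact (mul_eq_zero.mp (h1 rfl).1).resolve_left (pow_ne_zero _ F.alpha_ne_zero)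
    subst hc
    have h1 := key _ (hmem 0)
    rw [hconj, conj_sq_pow_E, E_mul_v_mem_big] at h1
    exact F.E_mul_v_notMem_small (h1 (by ring))
  -- For an odd power of `w` the `y` and `z` coordinates are exchanged; `s = 2 * b` kills the one
  -- that ends up in the `z` place.
  · have h1 := key _ (hmem (2 * b))
    obtain ⟨a', h2⟩ := F.conj_odd (F.w ^ (2 * m + 1)) (2 * b * c - 2 * b * c) (2 * b - 2 * b)
      (-(2 * c)) m 0 0 0 (by rw [E_zero, one_mul])
    rw [hconj, h2, E_mul_v_mem_big] at h1
    exact F.E_mul_v_notMem_small (h1 (by ring))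

/-- The listed pairs, indexed. -/
def listedPair (J : Set (ZMod p)) : Fin (n + 1) ⊕ J ⊕ Bool → Subgroup G × Subgroup G
  | .inl i => (⊤, F.level i)
  | .inr (.inl j) => (F.D.ker, F.line j)
  | .inr (.inr b) => (F.big, if b then F.smallV else F.small)

lemma range_listedPair (J : Set (ZMod p)) : Set.range (F.listedPair J) = F.listed J := by
  ext s
  constructor
  · rintro ⟨i | j | b, rfl⟩
    · exact Or.inl (Or.inl ⟨i, Nat.lt_succ_iff.mp i.2, rfl⟩)
    · exact Or.inl (Or.inr ⟨j, j.2, rfl⟩)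
    · cases b
      · exact Or.inr (Or.inl rfl)
      · exact Or.inr (Or.inr rfl)
  · rintro ((⟨i, hi, rfl⟩ | ⟨j, hj, rfl⟩) | (rfl | rfl))
    · exact ⟨.inl ⟨i, Nat.lt_succ_iff.mpr hi⟩, rfl⟩
    · exact ⟨.inr (.inl ⟨j, hj⟩), rfl⟩
    · exact ⟨.inr (.inr false), rfl⟩
    · exact ⟨.inr (.inr true), rfl⟩

/-- Each kernel has a fixed vector for its own pair. Testing on `P` detects the levels, any subgroup
containing `x` rules out `big`, the levels and lines distinguish themselves, and `smallV` tells the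
last two pairs apart. -/
lemma eq_of_hasFixed_iff {J : Set (ZMod p)} (hJ : ∀ i ∈ J, ∀ j ∈ J, q * i * j = k → i = j)
    {x y : Fin (n + 1) ⊕ J ⊕ Bool} (h : ∀ A, HasFixed A (F.listedPair J x).1 (F.listedPair J x).2 ↔
      HasFixed A (F.listedPair J y).1 (F.listedPair J y).2) : x = y := by
  have hbig : ∀ (A : Subgroup G) (b : Bool), (∀ a, F.X a ∈ A) →
      ¬ HasFixed A F.big (if b then F.smallV else F.small) := by
    intro A b hA
    cases b
    · exact F.not_hasFixed_big hA F.X_notMem_small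
    · exact F.not_hasFixed_big hA F.X_notMem_smallV
  rcases x with i | i | i <;> rcases y with j | j | j
  · have h1 := (F.hasFixed_level_iff (Nat.lt_succ_iff.mp j.2)).mp ((h (F.level i)).mp hasFixed_of_le)
    have h2 := (F.hasFixed_level_iff (Nat.lt_succ_iff.mp i.2)).mp ((h (F.level j)).mpr hasFixed_of_le)
    rw [Fin.ext (le_antisymm h2 h1)]
  · exact (F.not_hasFixed_ker_line j ((h F.D.ker).mp (F.hasFixed_ker_level i))).elim
  · exact (hbig _ j F.X_mem_ker ((h F.D.ker).mp (F.hasFixed_ker_level i))).elim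
  · exact (F.not_hasFixed_ker_line i ((h F.D.ker).mpr (F.hasFixed_ker_level j))).elim
  · have h1 := F.hasFixed_line ((h (F.line i)).mp hasFixed_of_le)
    rw [Subtype.ext (h1.elim id (hJ i i.2 j j.2))]
  · exact (hbig _ j (fun a => F.X_mem_line a i) ((h (F.line i)).mp hasFixed_of_le)).elim
  · exact (hbig _ i F.X_mem_ker ((h F.D.ker).mpr (F.hasFixed_ker_level j))).elim
  · exact (hbig _ i (fun a => F.X_mem_line a j) ((h (F.line j)).mpr hasFixed_of_le)).elim
  · cases i <;> cases j
    · rfl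
    · exact (F.not_hasFixed_small ((h F.smallV).mpr hasFixed_of_le)).elim
    · exact (F.not_hasFixed_small ((h F.smallV).mp hasFixed_of_le)).elim
    · rfl

theorem ncard_listed {J : Finset (ZMod p)} (hJ : ∀ i ∈ J, ∀ j ∈ J, q * i * j = k → i = j) :
    (F.listed J).ncard = (n + 1) + J.card + 2 := by
  rw [← range_listedPair, ← Set.image_univ, Set.ncard_image_of_injective, Set.ncard_univ]
  · simp [add_assoc]
  · intro x y hxy
    exact F.eq_of_hasFixed_iff hJ fun A => by rw [hxy]

variable [Finite G]

theorem isShodaPair_of_mem_listed {J : Set (ZMod p)} {s : Subgroup G × Subgroup G}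
    (hs : s ∈ F.listed J) : IsShodaPair s.1 s.2 := by
  rcases hs with (⟨i, -, rfl⟩ | ⟨j, -, rfl⟩) | (rfl | rfl)
  · exact F.isShodaPair_level i
  · exact F.isShodaPair_line j
  · exact F.isShodaPair_small
  · exact F.isShodaPair_smallV

theorem pairwise_listed {J : Set (ZMod p)} (hJ : ∀ i ∈ J, ∀ j ∈ J, q * i * j = k → i = j) :
    (F.listed J).Pairwise fun s s' => ¬ ShodaEquivalent s s' := by
  rw [← range_listedPair]
  rintro _ ⟨x, rfl⟩ _ ⟨y, rfl⟩ hxy h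
  exact hxy (congrArg _ (F.eq_of_hasFixed_iff hJ fun A => h.hasFixed_iff A))

theorem exists_eigenvector_listed {J : Set (ZMod p)} (hJ : ∀ j, ∃ i ∈ J, j = i ∨ q * j * i = k)
    {V : Type*} [AddCommGroup V] [Module ℂ V] [FiniteDimensional ℂ V] {ρ : Representation ℂ G V}
    (hρ : ρ.IsIrreducible) :
    ∃ s ∈ F.listed J, ∃ (lam : s.1 →* ℂˣ) (v : V),
      HasKernel s.1 s.2 lam ∧ IsEigenvector ρ s.1 lam v := by
  obtain ⟨H, K, lam, v, hs, hK, hv⟩ := F.exists_listed_eigenvector hρ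
  rcases hs with (⟨i, hi, hs⟩ | ⟨j, -, hs⟩) | hs
  · exact ⟨_, Or.inl (Or.inl ⟨i, hi, hs⟩), lam, v, hK, hv⟩
  · obtain ⟨rfl, rfl⟩ := Prod.ext_iff.mp hs
    obtain ⟨i, hi, hij⟩ := hJ j
    obtain ⟨g, hg⟩ := F.map_conj_line_iff.mpr hij
    obtain ⟨lam', v', h1, h2⟩ := exists_conj_eigenvector (MonoidHom.normal_ker F.D) hK hv g
    rw [hg] at h1
    exact ⟨_, Or.inl (Or.inr ⟨i, hi, rfl⟩), lam', v', h1, h2⟩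
  · exact ⟨_, Or.inr hs, lam, v, hK, hv⟩

/-- An irreducible representation containing `lam` also contains a listed eigenvector. Both pairs
satisfy Mackey's criterion, so both induce its character. -/
theorem exists_shodaEquivalent_listed {J : Set (ZMod p)}
    (hJ : ∀ j, ∃ i ∈ J, j = i ∨ q * j * i = k) {H K : Subgroup G} (h : IsShodaPair H K) :
    ∃ s ∈ F.listed J, ShodaEquivalent (H, K) s := by
  obtain ⟨lam, hlam⟩ := h.exists_hasKernel
  obtain ⟨V, _, _, _, ρ, hρ, v, hv⟩ := exists_irreducible_eigenvector H lam
  obtain ⟨s, hs, lam', v', hlam', hv'⟩ := F.exists_eigenvector_listed hJ hρ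
  exact ⟨s, hs, shodaEquivalent_of_isEigenvector hρ hlam (F.separates_of_isShodaPair h) hv hlam'
    (F.separates_of_isShodaPair (F.isShodaPair_of_mem_listed hs)) hv'⟩

end HeisenbergFrame

/-! ### Conjugates of idempotents and strong inductive chains -/

section Chains

variable {G : Type*} [Group G]

lemma conjElt_mul_distrib (e f : MonoidAlgebra ℚ G) (g : G) :
    conjElt (e * f) g = conjElt e g * conjElt f g := by
  have h : MonoidAlgebra.of ℚ G g * MonoidAlgebra.of ℚ G g⁻¹ = 1 := by
    rw [← map_mul, mul_inv_cancel, map_one]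
  calc conjElt (e * f) g
      = MonoidAlgebra.of ℚ G g⁻¹ * e * 1 * f * MonoidAlgebra.of ℚ G g := by
        rw [conjElt, mul_one]; simp only [mul_assoc]
    _ = _ := by rw [← h, conjElt, conjElt]; simp only [mul_assoc]

lemma conjElt_zero (g : G) : conjElt (0 : MonoidAlgebra ℚ G) g = 0 := by
  rw [conjElt, mul_zero, zero_mul]

lemma coeff_mul_of (e : MonoidAlgebra ℚ G) (u x : G) :
    (e * MonoidAlgebra.of ℚ G u).coeff x = e.coeff (x * u⁻¹) := by
  rw [MonoidAlgebra.of_apply, MonoidAlgebra.coeff_mul_single_apply, mul_one]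

lemma coeff_of_mul (e : MonoidAlgebra ℚ G) (u x : G) :
    (MonoidAlgebra.of ℚ G u * e).coeff x = e.coeff (u⁻¹ * x) := by
  rw [MonoidAlgebra.of_apply, MonoidAlgebra.coeff_single_mul_apply, one_mul]

lemma coeff_conjElt (e : MonoidAlgebra ℚ G) (g x : G) :
    (conjElt e g).coeff x = e.coeff (g * x * g⁻¹) := by
  rw [conjElt, coeff_mul_of, coeff_of_mul, inv_inv, mul_assoc]

/-- The conjugate absorbs `u` on the right, while the sum of the powers of `u` annihilates `e` from
the left; inserting that sum between them gives `m` times the product. -/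
lemma conjElt_mul_eq_zero {e : MonoidAlgebra ℚ G} {g u : G} {m : ℕ} (hm : m ≠ 0)
    (h1 : e * MonoidAlgebra.of ℚ G (g * u * g⁻¹) = e)
    (h2 : (∑ i ∈ Finset.range m, MonoidAlgebra.of ℚ G (u ^ i)) * e = 0) : conjElt e g * e = 0 := by
  have h3 : conjElt e g * MonoidAlgebra.of ℚ G u = conjElt e g := by
    conv_rhs => rw [← h1]
    rw [conjElt, conjElt]
    simp only [mul_assoc, ← map_mul]
    congr 3
    group
  have h4 : ∀ i, conjElt e g * MonoidAlgebra.of ℚ G (u ^ i) = conjElt e g := by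
    intro i
    induction i with
    | zero => rw [pow_zero, map_one, mul_one]
    | succ i ih => rw [pow_succ, map_mul, ← mul_assoc, ih, h3]
  have h5 : (m : ℚ) • (conjElt e g * e) = 0 := by
    calc (m : ℚ) • (conjElt e g * e)
        = ∑ i ∈ Finset.range m, conjElt e g * MonoidAlgebra.of ℚ G (u ^ i) * e := by
          simp_rw [h4]
          rw [Finset.sum_const, Finset.card_range, Nat.cast_smul_eq_nsmul]
      _ = conjElt e g * ((∑ i ∈ Finset.range m, MonoidAlgebra.of ℚ G (u ^ i)) * e) := by
          rw [Finset.sum_mul, Finset.mul_sum]; simp only [mul_assoc]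
      _ = 0 := by rw [h2, mul_zero]
  exact (smul_eq_zero.mp h5).resolve_left (Nat.cast_ne_zero.mpr hm)

/-- The condition on two consecutive terms of a strong inductive chain. -/
structure IsStrongStep (M M' : Subgroup G) (e : MonoidAlgebra ℚ G) : Prop where
  le : M ≤ M'
  le_cen : M ≤ cenIn M' e
  normal_in_cen : (M.subgroupOf (cenIn M' e)).Normal
  orthogonal : ∀ g ∈ M', ∀ g' ∈ M', conjElt e g ≠ conjElt e g' → conjElt e g * conjElt e g' = 0

/-- Conjugating by `g'` reduces orthogonality of two arbitrary conjugates to that of a conjugate and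
`e` itself. -/
lemma IsStrongStep.of_dichotomy {M M' : Subgroup G} {e : MonoidAlgebra ℚ G} (hM : M ≤ M')
    (h1 : ∀ m ∈ M, conjElt e m = e)
    (h2 : ∀ g ∈ M', conjElt e g = e → ∀ m ∈ M, g * m * g⁻¹ ∈ M)
    (h3 : ∀ g ∈ M', conjElt e g = e ∨ conjElt e g * e = 0) : IsStrongStep M M' e where
  le := hM
  le_cen := fun m hm => ⟨hM hm, h1 m hm⟩
  normal_in_cen := ⟨fun m hm g => h2 g g.2.1 g.2.2 m hm⟩
  orthogonal := by
    intro g hg g' hg' hne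
    have h4 : conjElt e g = conjElt (conjElt e (g * g'⁻¹)) g' := by
      rw [← conjElt_mul, inv_mul_cancel_right]
    rcases h3 (g * g'⁻¹) (M'.mul_mem hg (M'.inv_mem hg')) with h | h
    · rw [h] at h4
      exact (hne h4).elim
    · rw [h4, ← conjElt_mul_distrib, h, conjElt_zero]

lemma traceCoeff_congr {M : Subgroup G} {χ : M → ℂ} {a b : M} (h : χ a = χ b) :
    traceCoeff M χ a = traceCoeff M χ b := by
  rw [traceCoeff, traceCoeff, dif_pos a.2, dif_pos b.2]
  congr 2
  exact Subtype.ext h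

lemma traceCoeff_of_notMem {M : Subgroup G} {χ : M → ℂ} {a : G} (h : a ∉ M) :
    traceCoeff M χ a = 0 := dif_neg h

variable [Finite G]

lemma conjElt_rationalIdempotent_eq {M : Subgroup G} {χ : M → ℂ} {g : G}
    (h : ∀ x, traceCoeff M χ (g * x * g⁻¹) = traceCoeff M χ x) :
    conjElt (rationalIdempotent M χ) g = rationalIdempotent M χ := by
  refine MonoidAlgebra.ext (Finsupp.ext fun x => ?_)
  rw [coeff_conjElt, coeff_rationalIdempotent, coeff_rationalIdempotent, ← h x⁻¹]
  congr 2; group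

lemma IsStrongInductiveChain.of_steps {H : Subgroup G} {lam : H →* ℂˣ} {m : ℕ}
    {C : ℕ → Subgroup G} (h0 : C 0 = H) (hm : C m = ⊤)
    (h : ∀ i < m, IsStrongStep (C i) (C (i + 1))
      (rationalIdempotent (C i) (inducedChar H (C i) lam))) : IsStrongInductiveChain H lam m C where
  bot_eq := h0
  top_eq := hm
  le_succ := fun i hi => (h i hi).le
  le_cen := fun i hi => (h i hi).le_cen
  normal_in_cen := fun i hi => (h i hi).normal_in_cen
  orthogonal := fun i hi => (h i hi).orthogonal

lemma inducedChar_self (H : Subgroup G) (lam : H →* ℂˣ) (h : H) : inducedChar H H lam h = lam h := by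
  have := Fintype.ofFinite G
  classical
  rw [inducedChar_eq_sum, finsum_eq_sum_of_fintype,
    Finset.sum_congr rfl fun (t : H) _ => extendZero_conj_of_mem lam t.2, Finset.sum_const,
    Finset.card_univ, ← Nat.card_eq_fintype_card, nsmul_eq_mul, extendZero_of_mem lam h.2,
    inv_mul_cancel_left₀ (Nat.cast_ne_zero.mpr Nat.card_pos.ne')]

lemma inducedChar_conj (H M : Subgroup G) (lam : H →* ℂˣ) (m s : M) :
    inducedChar H M lam (s * m * s⁻¹) = inducedChar H M lam m := by
  have := Fintype.ofFinite G
  classical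
  rw [inducedChar_eq_sum, inducedChar_eq_sum, finsum_eq_sum_of_fintype, finsum_eq_sum_of_fintype]
  congr 1
  refine Fintype.sum_equiv (Equiv.mulLeft s⁻¹) _ _ fun t => ?_
  congr 1
  simp [mul_assoc]

lemma traceCoeff_inducedChar_conj (H M : Subgroup G) (lam : H →* ℂˣ) {s : G} (hs : s ∈ M) (x : G) :
    traceCoeff M (inducedChar H M lam) (s * x * s⁻¹) = traceCoeff M (inducedChar H M lam) x := by
  by_cases hx : x ∈ M
  · exact traceCoeff_congr (inducedChar_conj H M lam ⟨x, hx⟩ ⟨s, hs⟩)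
  · rw [traceCoeff_of_notMem hx, traceCoeff_of_notMem]
    rwa [Subgroup.mul_mem_cancel_right _ (M.inv_mem hs), Subgroup.mul_mem_cancel_left _ hs]

lemma conjElt_inducedChar_of_mem (H M : Subgroup G) (lam : H →* ℂˣ) {s : G} (hs : s ∈ M) :
    conjElt (rationalIdempotent M (inducedChar H M lam)) s =
      rationalIdempotent M (inducedChar H M lam) :=
  conjElt_rationalIdempotent_eq (traceCoeff_inducedChar_conj H M lam hs)

lemma rationalIdempotent_mul_of {H K : Subgroup G} {lam : H →* ℂˣ} (hK : HasKernel H K lam) {u : G}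
    (hu : u ∈ K) : rationalIdempotent H (inducedChar H H lam) * MonoidAlgebra.of ℚ G u =
      rationalIdempotent H (inducedChar H H lam) := by
  refine MonoidAlgebra.ext (Finsupp.ext fun x => ?_)
  rw [coeff_mul_of, coeff_rationalIdempotent, coeff_rationalIdempotent]
  congr 1
  have huH := hK.le hu
  by_cases hx : x ∈ H
  · have h1 : (x * u⁻¹)⁻¹ ∈ H := H.inv_mem (H.mul_mem hx (H.inv_mem huH))
    refine traceCoeff_congr (a := ⟨_, h1⟩) (b := ⟨_, H.inv_mem hx⟩) ?_
    rw [inducedChar_self, inducedChar_self, ← extendZero_of_mem, ← extendZero_of_mem, mul_inv_rev,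
      inv_inv, extendZero_mul lam (H.inv_mem hx), (hasKernel_iff.mp hK u).mp hu, one_mul]
  · rw [traceCoeff_of_notMem, traceCoeff_of_notMem]
    · rwa [H.inv_mem_iff]
    · rwa [H.inv_mem_iff, H.mul_mem_cancel_right (H.inv_mem huH)]

/-- The value of `lam` at `u` is a root of unity other than `1`, so its geometric sum vanishes, and
the relation passes to traces. -/
lemma sum_of_mul_rationalIdempotent {H K : Subgroup G} {lam : H →* ℂˣ} (hK : HasKernel H K lam)
    {u : G} (hu : u ∈ H) (huK : u ∉ K) {m : ℕ} (hm : u ^ m = 1) :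
    (∑ i ∈ Finset.range m, MonoidAlgebra.of ℚ G (u ^ i)) *
      rationalIdempotent H (inducedChar H H lam) = 0 := by
  refine MonoidAlgebra.ext (Finsupp.ext fun x => ?_)
  rw [Finset.sum_mul, MonoidAlgebra.coeff_sum, Finsupp.finsetSum_apply]
  simp_rw [coeff_of_mul, coeff_rationalIdempotent]
  rw [← Finset.mul_sum]
  by_cases hx : x ∈ H
  · have h2 := sum_traceCoeff H (inducedChar H H lam) (Finset.range m) (fun _ => 1)
      (fun i => ⟨x, hx⟩⁻¹ * ⟨u, hu⟩ ^ i) (d := 1) (r := 0)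
      (by rw [inducedChar_self, map_one, Units.val_one, Rat.cast_one]) (by
        simp_rw [inducedChar_self, map_mul, map_pow, Units.val_mul, Units.val_pow_eq_pow_val,
          Rat.cast_one, one_mul]
        rw [← Finset.mul_sum, Rat.cast_zero]
        have h3 : (lam ⟨u, hu⟩ : ℂ) ≠ 1 := by
          rw [← extendZero_of_mem]
          exact fun h => huK ((hasKernel_iff.mp hK u).mpr h)
        have h4 : (lam ⟨u, hu⟩ : ℂ) ^ m = 1 := by
          rw [← Units.val_pow_eq_pow_val, ← map_pow,
            show (⟨u, hu⟩ : H) ^ m = 1 from Subtype.ext hm, map_one, Units.val_one]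
        rw [geom_sum_eq h3, h4, sub_self, zero_div, mul_zero])
    simp only [one_mul, mul_zero] at h2
    have h5 : ∑ i ∈ Finset.range m,
        traceCoeff H (inducedChar H H lam) ((u ^ i)⁻¹ * x)⁻¹ = 0 := by
      rw [← h2]
      refine Finset.sum_congr rfl fun i _ => ?_
      simp
    rw [h5, mul_zero]
    simp
  · rw [Finset.sum_eq_zero, mul_zero]
    · simp
    · intro i _
      refine traceCoeff_of_notMem ?_
      rwa [H.inv_mem_iff, H.mul_mem_cancel_left (H.inv_mem (H.pow_mem hu i))]

lemma conjElt_mul_rationalIdempotent {H K : Subgroup G} {lam : H →* ℂˣ} (hK : HasKernel H K lam)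
    {g u : G} (hu : u ∈ H) (huK : u ∉ K) (hgu : g * u * g⁻¹ ∈ K) :
    conjElt (rationalIdempotent H (inducedChar H H lam)) g *
      rationalIdempotent H (inducedChar H H lam) = 0 :=
  conjElt_mul_eq_zero (orderOf_pos u).ne' (rationalIdempotent_mul_of hK hgu)
    (sum_of_mul_rationalIdempotent hK hu huK (pow_orderOf_eq_one u))

lemma traceCoeff_inducedChar_self_one_pos (H : Subgroup G) (lam : H →* ℂˣ) :
    0 < traceCoeff H (inducedChar H H lam) 1 := by
  have h := traceCoeff_of_eq_rat H (inducedChar H H lam) (m := 1) (d := 1) (r := 1)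
    (by rw [inducedChar_self, map_one, Units.val_one, Rat.cast_one])
    (by rw [inducedChar_self, map_one, Units.val_one, Rat.cast_one])
  rw [OneMemClass.coe_one] at h
  rw [h, mul_one, mul_one]
  exact finrank_charField_pos _ _

/-- If `g` fixed `e`, then `e` would absorb `u` as well as be annihilated by the sum of its powers,
contradicting the nonzero coefficient at `1`. -/
lemma conjElt_ne_of_conj {H K : Subgroup G} {lam : H →* ℂˣ} (hK : HasKernel H K lam)
    {g u : G} (hu : u ∈ H) (huK : u ∉ K) (hgu : g * u * g⁻¹ ∈ K) :
    conjElt (rationalIdempotent H (inducedChar H H lam)) g ≠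
      rationalIdempotent H (inducedChar H H lam) := by
  intro h
  set e := rationalIdempotent H (inducedChar H H lam) with he
  have h1 : e * MonoidAlgebra.of ℚ G u = e := by
    have h3 : conjElt e g * MonoidAlgebra.of ℚ G u = conjElt e g := by
      conv_rhs => rw [he, ← rationalIdempotent_mul_of hK hgu, ← he]
      rw [conjElt, conjElt]
      simp only [mul_assoc, ← map_mul]
      congr 3
      group
    rwa [h] at h3
  have h2 : ∀ i x, e.coeff (x * (u ^ i)⁻¹) = e.coeff x := by
    intro i
    induction i with
    | zero => intro x; simp
    | succ i ih =>
      intro x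
      rw [pow_succ', mul_inv_rev, ← mul_assoc, ← coeff_mul_of, h1, ih]
  have h3 := congrArg (fun f : MonoidAlgebra ℚ G => f.coeff 1)
    (sum_of_mul_rationalIdempotent hK hu huK (pow_orderOf_eq_one u))
  simp only [Finset.sum_mul, MonoidAlgebra.coeff_sum, Finsupp.finsetSum_apply, coeff_of_mul,
    ← he, mul_one] at h3
  have h4 : ∀ i, e.coeff (u ^ i)⁻¹ = e.coeff 1 := fun i => by
    have := h2 i 1
    rwa [one_mul] at this
  simp only [h4, Finset.sum_const, Finset.card_range, nsmul_eq_mul] at h3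
  have h5 : e.coeff 1 ≠ 0 := by
    rw [he, coeff_rationalIdempotent, inv_one]
    exact mul_ne_zero (inv_ne_zero (Nat.cast_ne_zero.mpr Nat.card_pos.ne'))
      (traceCoeff_inducedChar_self_one_pos H lam).ne'
  exact mul_ne_zero (Nat.cast_ne_zero.mpr (orderOf_pos u).ne') h5 h3

/-- If all values of a linear character are `p`-th roots of unity, then its traces depend only on
its kernel. -/
lemma traceCoeff_inducedChar_self_eq {H K : Subgroup G} {lam : H →* ℂˣ} (hK : HasKernel H K lam)
    {p : ℕ} (hp : p.Prime) (hH : ∀ h ∈ H, h ^ p = 1) {a b : G} (ha : a ∈ H) (hb : b ∈ H)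
    (hab : a ∈ K ↔ b ∈ K) :
    traceCoeff H (inducedChar H H lam) a = traceCoeff H (inducedChar H H lam) b := by
  have hprim : ∀ {a : G} (ha : a ∈ H), a ∉ K → IsPrimitiveRoot (lam ⟨a, ha⟩ : ℂ) p := by
    intro a ha haK
    rw [hasKernel_iff.mp hK, extendZero_of_mem lam ha] at haK
    have h1 : orderOf (lam ⟨a, ha⟩ : ℂ) = p := by
      have := Fact.mk hp
      refine orderOf_eq_prime ?_ haK
      rw [← Units.val_pow_eq_pow_val, ← map_pow,
        show (⟨a, ha⟩ : H) ^ p = 1 from Subtype.ext (hH a ha), map_one, Units.val_one]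
    exact h1 ▸ IsPrimitiveRoot.orderOf _
  by_cases haK : a ∈ K
  · refine traceCoeff_congr (a := ⟨a, ha⟩) (b := ⟨b, hb⟩) ?_
    rw [inducedChar_self, inducedChar_self, ← extendZero_of_mem, ← extendZero_of_mem,
      (hasKernel_iff.mp hK a).mp haK, (hasKernel_iff.mp hK b).mp (hab.mp haK)]
  · refine traceCoeff_eq_of_isPrimitiveRoot (m := ⟨a, ha⟩) (m' := ⟨b, hb⟩) (c := 1) (d := 1) H _
      hp.pos (by rw [inducedChar_self, map_one, Units.val_one, Rat.cast_one]) (hprim ha haK)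
      (hprim hb (mt hab.mpr haK)) ?_ ?_
    · rw [inducedChar_self, Rat.cast_one, one_mul]
    · rw [inducedChar_self, Rat.cast_one, one_mul]

/-- If conjugation by `g` carries nothing from outside `K` into `K`, then by finiteness it preserves
`K`. In exponent `p` the traces see only `K`, so the idempotent is fixed. -/
lemma isStrongStep_of_normal {H K : Subgroup G} [H.Normal] {lam : H →* ℂˣ} (hK : HasKernel H K lam)
    {p : ℕ} (hp : p.Prime) (hH : ∀ h ∈ H, h ^ p = 1) :
    IsStrongStep H ⊤ (rationalIdempotent H (inducedChar H H lam)) := by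
  refine .of_dichotomy le_top (fun m hm => conjElt_inducedChar_of_mem H H lam hm)
    (fun g _ _ m hm => Subgroup.Normal.conj_mem inferInstance m hm g) fun g _ => ?_
  by_cases h : ∃ u ∈ H, u ∉ K ∧ g * u * g⁻¹ ∈ K
  · obtain ⟨u, h1, h2, h3⟩ := h
    exact Or.inr (conjElt_mul_rationalIdempotent hK h1 h2 h3)
  · left
    push Not at h
    have hle : K.map (MulAut.conj g⁻¹).toMonoidHom ≤ K := by
      rintro _ ⟨a, ha, rfl⟩
      have h1 : (MulAut.conj g⁻¹).toMonoidHom a = g⁻¹ * a * g := by simp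
      rw [h1]
      by_contra hc
      refine h _ ?_ hc (by
        rw [show g * (g⁻¹ * a * g) * g⁻¹ = a by group]; exact ha)
      simpa using Subgroup.Normal.conj_mem inferInstance a (hK.le ha) g⁻¹
    have heq : K.map (MulAut.conj g⁻¹).toMonoidHom = K :=
      Subgroup.eq_of_le_of_card_ge hle
        (Subgroup.card_map_of_injective (MulAut.conj g⁻¹).injective).ge
    refine conjElt_rationalIdempotent_eq fun x => ?_
    by_cases hx : x ∈ H
    · refine traceCoeff_inducedChar_self_eq hK hp hH
        (Subgroup.Normal.conj_mem inferInstance x hx g) hx ?_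
      conv_rhs => rw [← heq, Subgroup.mem_map_equiv, MulAut.conj_symm_apply]
      rw [inv_inv]
    · rw [traceCoeff_of_notMem hx, traceCoeff_of_notMem]
      rwa [← Subgroup.Normal.mem_comm_iff inferInstance, inv_mul_cancel_left]

end Chains

/-! ### The chain through the Heisenberg group extended by `v` -/

/-- The induced character `lam ^ M`, as a function on the whole group. -/
noncomputable def indOn {G : Type*} [Group G] (H M : Subgroup G) (lam : H →* ℂˣ) (g : G) : ℂ :=
  (Nat.card H : ℂ)⁻¹ * ∑ᶠ t : M, extendZero H lam ((t : G)⁻¹ * g * t)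

lemma inducedChar_eq_indOn {G : Type*} [Group G] [Finite G] (H M : Subgroup G) (lam : H →* ℂˣ)
    (m : M) : inducedChar H M lam m = indOn H M lam m := rfl

lemma indOn_conj {G : Type*} [Group G] [Finite G] {H M : Subgroup G} (lam : H →* ℂˣ) {m s : G}
    (hm : m ∈ M) (hs : s ∈ M) : indOn H M lam (s⁻¹ * m * s) = indOn H M lam m := by
  have := inducedChar_conj H M lam ⟨m, hm⟩ ⟨s⁻¹, M.inv_mem hs⟩
  rw [inducedChar_eq_indOn, inducedChar_eq_indOn] at this
  simpa using this

lemma indOn_one {G : Type*} [Group G] [Finite G] (H M : Subgroup G) (lam : H →* ℂˣ) :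
    indOn H M lam 1 = (((Nat.card H : ℚ)⁻¹ * Nat.card M : ℚ) : ℂ) := by
  have := Fintype.ofFinite G
  classical
  rw [indOn, finsum_eq_sum_of_fintype]
  simp [extendZero_one, Nat.card_eq_fintype_card]

lemma indOn_mul_of_central {G : Type*} [Group G] [Finite G] {H M : Subgroup G} (lam : H →* ℂˣ)
    {z : G} (hz : z ∈ H) (hc : ∀ t ∈ M, t⁻¹ * z * t = z) (g : G) :
    indOn H M lam (g * z) = extendZero H lam z * indOn H M lam g := by
  have := Fintype.ofFinite G
  classical
  rw [indOn, indOn, finsum_eq_sum_of_fintype, finsum_eq_sum_of_fintype, mul_left_comm,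
    Finset.mul_sum _ _ (extendZero H lam z)]
  congr 1
  refine Finset.sum_congr rfl fun t _ => ?_
  rw [show (t : G)⁻¹ * (g * z) * t = (t : G)⁻¹ * g * t * ((t : G)⁻¹ * z * t) by group, hc t t.2,
    extendZero_mul lam hz, mul_comm]

lemma exists_rat_indOn_of_mul_self {G : Type*} [Group G] [Finite G] (H M : Subgroup G)
    (lam : H →* ℂˣ) {g : G} (hg : g * g = 1) : ∃ r : ℚ, indOn H M lam g = r := by
  have := Fintype.ofFinite G
  classical
  have h : ∀ t : M, ∃ r : ℚ, extendZero H lam ((t : G)⁻¹ * g * t) = r := by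
    intro t
    by_cases ht : (t : G)⁻¹ * g * t ∈ H
    · have h1 : extendZero H lam ((t : G)⁻¹ * g * t) * extendZero H lam ((t : G)⁻¹ * g * t) = 1 := by
        rw [← extendZero_mul lam ht,
          show (t : G)⁻¹ * g * t * ((t : G)⁻¹ * g * t) = (t : G)⁻¹ * (g * g) * t by group, hg,
          mul_one, inv_mul_cancel, extendZero_one]
      rcases mul_self_eq_one_iff.mp h1 with h | h
      · exact ⟨1, by rw [h, Rat.cast_one]⟩
      · exact ⟨-1, by rw [h, Rat.cast_neg, Rat.cast_one]⟩
    · exact ⟨0, by rw [extendZero_of_notMem lam ht, Rat.cast_zero]⟩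
  choose r hr using h
  refine ⟨(Nat.card H : ℚ)⁻¹ * ∑ t, r t, ?_⟩
  rw [indOn, finsum_eq_sum_of_fintype, Finset.sum_congr rfl fun t _ => hr t]
  push_cast
  rfl

namespace HeisenbergFrame

variable {G : Type} [Group G] {p n : ℕ} {α k q : ZMod p} [Fact p.Prime]
  (F : HeisenbergFrame G p n α k q)

/-- The subgroup generated by the Heisenberg group and the involution `v`. -/
def mid : Subgroup G := (Subgroup.zpowers F.half).comap F.D

instance normal_mid : F.mid.Normal := inferInstanceAs ((Subgroup.zpowers F.half).comap F.D).Normal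

lemma mem_mid {g : G} : g ∈ F.mid ↔ F.D g = 1 ∨ F.D g = F.half := by
  rw [mid, Subgroup.mem_comap]
  constructor
  · rintro ⟨z, hz⟩
    rw [← hz]
    rcases Int.even_or_odd' z with ⟨m, rfl | rfl⟩
    · left
      change F.half ^ (2 * m) = 1
      rw [zpow_mul, zpow_two, half_mul_half, one_zpow]
    · right
      change F.half ^ (2 * m + 1) = F.half
      rw [zpow_add, zpow_mul, zpow_two, half_mul_half, one_zpow, one_mul, zpow_one]
  · rintro (h | h)
    · rw [h]; exact Subgroup.one_mem _
    · rw [h]; exact Subgroup.mem_zpowers _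

lemma big_le_mid : F.big ≤ F.mid := by
  rintro _ ⟨a, b, rfl | rfl⟩
  · exact F.mem_mid.mpr (Or.inl (F.D_E ..))
  · exact F.mem_mid.mpr (Or.inr (by rw [map_mul, D_E, one_mul, D_v]))

lemma ker_le_mid : F.D.ker ≤ F.mid := fun _ h => F.mem_mid.mpr (Or.inl h)

lemma conj_X_of_mem_mid {t : G} (ht : t ∈ F.mid) (a : ZMod p) : t⁻¹ * F.X a * t = F.X a := by
  obtain ⟨s, -, hs, hs1⟩ := F.conj_X_eq t
  rw [hs, hs1.mpr (F.mem_mid.mp ht), one_mul]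

/-- Take `u = g⁻¹ y g`: an element of `mid` outside `big` has nonzero `z` coordinate, so `u`
acquires a nonzero power of `x`. -/
lemma exists_conj_mem_of_notMem_big {K : Subgroup G} (hY : ∀ b, F.Y b ∈ K)
    (hX : ∀ a, F.X a ∈ K → a = 0) {g : G} (hg : g ∈ F.mid) (hgb : g ∉ F.big) :
    ∃ u ∈ F.big, u ∉ K ∧ g * u * g⁻¹ ∈ K := by
  have key : ∃ s c : ZMod p, c ≠ 0 ∧ g⁻¹ * F.Y 1 * g = F.E c s 0 := by
    rcases F.mem_mid.mp hg with h | h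
    · obtain ⟨a, b, c, rfl⟩ := F.exists_E_of_D h
      refine ⟨1, c, fun hc => hgb (F.E_mem_big.mpr hc), ?_⟩
      rw [Y_eq, E_conj]; congr 1; ring
    · obtain ⟨a, b, c, rfl⟩ := F.exists_E_mul_v h
      refine ⟨-1, c, fun hc => hgb (F.E_mul_v_mem_big.mpr hc), ?_⟩
      rw [Y_eq, E_mul_v_conj]; congr 1 <;> ring
  obtain ⟨s, c, hc, h⟩ := key
  refine ⟨F.E c s 0, F.E_mem_big.mpr rfl, fun hK => hc (hX c ?_), ?_⟩
  · have h1 : F.E c s 0 = F.X c * F.Y s := by rw [Y_eq, X_mul_E, add_zero]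
    rwa [h1, K.mul_mem_cancel_right (hY s)] at hK
  · rw [← h, show g * (g⁻¹ * F.Y 1 * g) * g⁻¹ = F.Y 1 by group]
    exact hY 1

/-- As `v` inverts `P` modulo the centre, conjugating by `E 0 b' c'` shifts the last two coordinates
by `2 * b'` and `2 * c'`, and `2` is invertible. -/
lemma exists_conj_E_mul_v (a b c : ZMod p) :
    ∃ t ∈ F.D.ker, ∃ a', F.E a b c * F.v = t * (F.X a' * F.v) * t⁻¹ := by
  have h2 := F.two_ne_zero'
  obtain ⟨b', rfl⟩ : ∃ b', b = 2 * b' := ⟨b / 2, by field_simp⟩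
  obtain ⟨c', rfl⟩ : ∃ c', c = 2 * c' := ⟨c / 2, by field_simp⟩
  refine ⟨F.E 0 b' c', F.D_E .., a + 2 * b' * c', ?_⟩
  rw [mul_assoc, mul_assoc, E_inv, v_mul_E, ← mul_assoc, ← mul_assoc, E_mul_X, E_mul]
  congr 2 <;> ring

variable [Finite G]

section Induced

variable {K : Subgroup G} {lam : F.big →* ℂˣ} (hK : HasKernel F.big K lam)
  (hX : ∀ a, F.X a ∈ K → a = 0)

include hK hX in
lemma isPrimitiveRoot_X {a : ZMod p} (ha : a ≠ 0) :
    IsPrimitiveRoot (extendZero F.big lam (F.X a)) p := by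
  have hmem : ∀ a, F.X a ∈ F.big := fun a => by rw [X_eq, E_mem_big]
  have h1 : ∀ m : ℕ, extendZero F.big lam (F.X a ^ m) = extendZero F.big lam (F.X a) ^ m := by
    intro m
    induction m with
    | zero => rw [pow_zero, pow_zero, extendZero_one]
    | succ m ih => rw [pow_succ, extendZero_mul lam (hmem a), ih, pow_succ]
  have h2 : orderOf (extendZero F.big lam (F.X a)) = p := by
    refine orderOf_eq_prime ?_ fun h => ha (hX a ((hasKernel_iff.mp hK _).mpr h))
    rw [← h1, X_eq, E_pow_prime, extendZero_one]
  have h3 := IsPrimitiveRoot.orderOf (extendZero F.big lam (F.X a))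
  rwa [h2] at h3

lemma indOn_X_mul (lam : F.big →* ℂˣ) (a : ZMod p) (g : G) :
    indOn F.big F.mid lam (g * F.X a) =
      extendZero F.big lam (F.X a) * indOn F.big F.mid lam g :=
  indOn_mul_of_central lam (by rw [X_eq, E_mem_big]) (fun _ ht => F.conj_X_of_mem_mid ht a) g

/-- A noncentral element of `P` is conjugate to its product with a nontrivial central element, and
that element multiplies the character by a scalar other than `1`. -/
lemma indOn_E_eq_zero {K : Subgroup G} {lam : F.big →* ℂˣ} (hK : HasKernel F.big K lam)
    (hX : ∀ a, F.X a ∈ K → a = 0) {a b c : ZMod p} (h : b ≠ 0 ∨ c ≠ 0) :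
    indOn F.big F.mid lam (F.E a b c) = 0 := by
  have h1 : ∃ b' c' : ZMod p, b * c' - b' * c ≠ 0 := by
    rcases h with h | h
    · exact ⟨0, 1, by simpa using h⟩
    · exact ⟨1, 0, by simpa using h⟩
  obtain ⟨b', c', h1⟩ := h1
  have h2 := indOn_conj (H := F.big) lam (F.ker_le_mid (F.D_E a b c)) (F.ker_le_mid (F.D_E 0 b' c'))
  rw [E_conj, ← E_mul_X, indOn_X_mul] at h2
  by_contra h3
  have h4 := mul_right_cancel₀ h3 (h2.trans (one_mul _).symm)
  exact h1 (hX _ ((hasKernel_iff.mp hK _).mpr h4))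

/-- As `g² = 1`, the value at `g` is rational. For `a ≠ 0`, multiplying `g` by `X a` contributes a
primitive `p`-th root of unity; scaling `a` only changes which one. -/
lemma traceCoeff_X_mul {K : Subgroup G} {lam : F.big →* ℂˣ} (hK : HasKernel F.big K lam)
    (hX : ∀ a, F.X a ∈ K → a = 0) {g : G} (hg : g ∈ F.mid) (hg2 : g * g = 1) {s : ZMod p}
    (hs : s ≠ 0) (a : ZMod p) :
    traceCoeff F.mid (inducedChar F.big F.mid lam) (g * F.X (s * a)) =
      traceCoeff F.mid (inducedChar F.big F.mid lam) (g * F.X a) := by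
  by_cases ha : a = 0
  · rw [ha, mul_zero]
  have hmem : ∀ a, g * F.X a ∈ F.mid := fun a => F.mid.mul_mem hg (F.ker_le_mid (F.D_X a))
  obtain ⟨r, hr⟩ := exists_rat_indOn_of_mul_self F.big F.mid lam hg2
  refine traceCoeff_eq_of_isPrimitiveRoot (m := ⟨_, hmem (s * a)⟩) (m' := ⟨_, hmem a⟩) (c := r)
    F.mid _ (Nat.Prime.pos Fact.out) (indOn_one F.big F.mid lam)
    (F.isPrimitiveRoot_X hK hX (mul_ne_zero hs ha)) (F.isPrimitiveRoot_X hK hX ha) ?_ ?_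
  · rw [inducedChar_eq_indOn, indOn_X_mul, hr, mul_comm]
  · rw [inducedChar_eq_indOn, indOn_X_mul, hr, mul_comm]

/-- Noncentral elements of `P` have trace zero. On the centre, `g` scales the exponent of `x`.
Elements over `half` are conjugate to some `X a' * v`, where again only the exponent is scaled, up
to conjugation in `mid`. -/
lemma traceCoeff_mid_conj {K : Subgroup G} {lam : F.big →* ℂˣ} (hK : HasKernel F.big K lam)
    (hX : ∀ a, F.X a ∈ K → a = 0) (g x : G) :
    traceCoeff F.mid (inducedChar F.big F.mid lam) (g * x * g⁻¹) =
      traceCoeff F.mid (inducedChar F.big F.mid lam) x := by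
  have hnormal : ∀ g, ∀ m ∈ F.mid, g * m * g⁻¹ ∈ F.mid := fun g m hm =>
    Subgroup.Normal.conj_mem inferInstance m hm g
  obtain ⟨s, hs0, hs, -⟩ := F.conj_X_eq g⁻¹
  simp_rw [inv_inv] at hs
  have hD := F.D_conj g⁻¹ x
  rw [inv_inv] at hD
  by_cases hx : x ∈ F.mid
  · rcases F.mem_mid.mp hx with h | h
    · obtain ⟨a, b, c, rfl⟩ := F.exists_E_of_D h
      by_cases hbc : b ≠ 0 ∨ c ≠ 0
      · obtain ⟨a', b', c', h1⟩ := F.exists_E_of_D (hD.trans h)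
        have hbc' : b' ≠ 0 ∨ c' ≠ 0 := by
          by_contra hcon
          push Not at hcon
          rw [hcon.1, hcon.2, ← X_eq] at h1
          obtain ⟨s', -, hs', -⟩ := F.conj_X_eq g
          have h2 : F.E a b c = F.X (s' * a') := by rw [← hs', ← h1]; group
          rw [X_eq, E_inj] at h2
          exact hbc.elim (fun h => h h2.2.1) (fun h => h h2.2.2)
        have hz : ∀ a b c, b ≠ 0 ∨ c ≠ 0 →
            traceCoeff F.mid (inducedChar F.big F.mid lam) (F.E a b c) = 0 := by
          intro a b c h
          have := traceCoeff_of_eq_rat F.mid (inducedChar F.big F.mid lam)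
            (m := ⟨F.E a b c, F.ker_le_mid (F.D_E ..)⟩) (r := 0) (indOn_one F.big F.mid lam)
            (by rw [inducedChar_eq_indOn, F.indOn_E_eq_zero hK hX h, Rat.cast_zero])
          rw [mul_zero, mul_zero] at this
          exact this
        rw [h1, hz _ _ _ hbc, hz _ _ _ hbc']
      · push Not at hbc
        rw [hbc.1, hbc.2, ← X_eq, hs]
        have := F.traceCoeff_X_mul hK hX F.mid.one_mem (one_mul 1) hs0 a
        rwa [one_mul, one_mul] at this
    · obtain ⟨a, b, c, rfl⟩ := F.exists_E_mul_v h
      obtain ⟨t, ht, a', h1⟩ := F.exists_conj_E_mul_v a b c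
      have hv : F.v ∈ F.mid := F.mem_mid.mpr (Or.inr F.D_v)
      have hXv : ∀ a, F.X a * F.v = F.v * F.X a := fun a => by
        conv_lhs => rw [← F.conj_X_of_mem_mid hv a]
        rw [v_inv, mul_assoc, mul_assoc, v_sq, mul_one]
      obtain ⟨e, f, l, d, hg⟩ := F.exists_eq g
      change g = F.E e f l * F.w ^ d at hg
      -- As a power of `w`, `v` is moved only by the Heisenberg part of `g`.
      have hgv : g * F.v * g⁻¹ = F.E e f l * F.v * (F.E e f l)⁻¹ := by
        rw [hg, v]; group
      have hE := F.ker_le_mid (F.D_E e f l)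
      have h2 : g * (t * (F.X a' * F.v) * t⁻¹) * g⁻¹ =
          (g * t * g⁻¹) * (F.E e f l * (F.v * F.X (s * a')) * (F.E e f l)⁻¹) * (g * t * g⁻¹)⁻¹ := by
        have h3 : F.E e f l * (F.v * F.X (s * a')) * (F.E e f l)⁻¹ =
            (g * F.X a' * g⁻¹) * (g * F.v * g⁻¹) := by
          rw [hgv, hs, ← hXv, ← mul_assoc, ← mul_assoc, ← mul_assoc, F.X_comm_E]
        rw [h3]; group
      rw [h1, h2, traceCoeff_inducedChar_conj _ _ _ (hnormal g t (F.ker_le_mid ht)),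
        traceCoeff_inducedChar_conj _ _ _ hE, traceCoeff_inducedChar_conj _ _ _ (F.ker_le_mid ht),
        hXv, F.traceCoeff_X_mul hK hX hv F.v_sq hs0]
  · rw [traceCoeff_of_notMem hx, traceCoeff_of_notMem]
    rwa [mem_mid, hD, ← mem_mid]

end Induced

lemma isGeneralizedStrongShodaPair_big {K : Subgroup G} (hs : IsShodaPair F.big K)
    (hY : ∀ b, F.Y b ∈ K) (hX : ∀ a, F.X a ∈ K → a = 0) :
    IsGeneralizedStrongShodaPair F.big K := by
  -- Within `mid`, elements outside `big` give orthogonal conjugates; from `mid` to the whole group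
  -- the idempotent is invariant.
  refine ⟨hs, 2, fun i => if i = 0 then F.big else if i = 1 then F.mid else ⊤, fun lam hK => ?_⟩
  refine .of_steps rfl rfl fun i hi => ?_
  have hi' : i = 0 ∨ i = 1 := by omega
  rcases hi' with rfl | rfl
  · refine IsStrongStep.of_dichotomy F.big_le_mid
      (fun m hm => conjElt_inducedChar_of_mem _ _ _ hm) (fun g hg he m hm => ?_) fun g hg => ?_
    · by_cases hgb : g ∈ F.big
      · exact F.big.mul_mem (F.big.mul_mem hgb hm) (F.big.inv_mem hgb)
      · obtain ⟨u, h1, h2, h3⟩ := F.exists_conj_mem_of_notMem_big hY hX hg hgb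
        exact (conjElt_ne_of_conj hK h1 h2 h3 he).elim
    · by_cases hgb : g ∈ F.big
      · exact Or.inl (conjElt_inducedChar_of_mem _ _ _ hgb)
      · obtain ⟨u, h1, h2, h3⟩ := F.exists_conj_mem_of_notMem_big hY hX hg hgb
        exact Or.inr (conjElt_mul_rationalIdempotent hK h1 h2 h3)
  · refine IsStrongStep.of_dichotomy (M := F.mid) (M' := ⊤) le_top
      (fun m hm => conjElt_inducedChar_of_mem _ _ _ hm)
      (fun g _ _ m hm => Subgroup.Normal.conj_mem inferInstance m hm g)
      fun g _ => Or.inl (conjElt_rationalIdempotent_eq (F.traceCoeff_mid_conj hK hX g))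

theorem isGeneralizedStrongShodaPair_of_mem_listed {J : Set (ZMod p)}
    {s : Subgroup G × Subgroup G} (hs : s ∈ F.listed J) : IsGeneralizedStrongShodaPair s.1 s.2 := by
  have hsp := F.isShodaPair_of_mem_listed hs
  rcases hs with (⟨i, -, rfl⟩ | ⟨j, -, rfl⟩) | (rfl | rfl)
  · exact ⟨hsp, 0, fun _ => ⊤, fun lam hK =>
      .of_steps rfl rfl fun i hi => absurd hi (Nat.not_lt_zero i)⟩
  · refine ⟨hsp, 1, fun i => if i = 0 then F.D.ker else ⊤, fun lam hK => ?_⟩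
    refine .of_steps rfl rfl fun i hi => ?_
    obtain rfl : i = 0 := by omega
    refine isStrongStep_of_normal (H := F.D.ker) (K := F.line j) hK (p := p) Fact.out ?_
    intro h hh
    obtain ⟨a, b, c, rfl⟩ := F.exists_E_of_D hh
    exact F.E_pow_prime a b c
  · exact F.isGeneralizedStrongShodaPair_big hsp
      (fun b => by rw [Y_eq, E_mem_small]; exact ⟨rfl, rfl⟩)
      (fun a h => by rw [X_eq, E_mem_small] at h; exact h.1)
  · exact F.isGeneralizedStrongShodaPair_big hsp
      (fun b => by rw [Y_eq, E_mem_smallV]; exact ⟨rfl, rfl⟩)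
      (fun a h => by rw [X_eq, E_mem_smallV] at h; exact h.1)

theorem isGeneralizedStronglyMonomialGroup (F : HeisenbergFrame G p n α k q) :
    IsGeneralizedStronglyMonomialGroup G := by
  intro V _ _ _ ρ hρ
  obtain ⟨s, hs, lam, v, hK, hv⟩ := F.exists_eigenvector_listed (J := Set.univ)
    (fun j => ⟨j, trivial, Or.inl rfl⟩) hρ
  have hsp := F.isShodaPair_of_mem_listed hs
  exact ⟨s.1, s.2, F.isGeneralizedStrongShodaPair_of_mem_listed hs, lam, hK, fun g =>
    congrFun (character_eq_indChar ρ hρ hK (F.separates_of_isShodaPair hsp) hv) g⟩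

end HeisenbergFrame

/-! ### The permutation model -/

lemma zpow_of_map_add {G : Type*} [Group G] {p : ℕ} {U : ZMod p → G}
    (hU : ∀ a b, U (a + b) = U a * U b) (z : ℤ) : U 1 ^ z = U z := by
  let f : Multiplicative (ZMod p) →* G := MonoidHom.mk' (fun a => U a.toAdd) fun a b => hU _ _
  have h := map_zpow f (Multiplicative.ofAdd 1) z
  rw [← ofAdd_zsmul, zsmul_one] at h
  exact h.symm

lemma pow_card_of_map_add {G : Type*} [Group G] {p : ℕ} {U : ZMod p → G}
    (hU : ∀ a b, U (a + b) = U a * U b) : U 1 ^ p = 1 := by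
  have h := zpow_of_map_add hU p
  have h0 := zpow_of_map_add hU 0
  rw [Int.cast_natCast, ZMod.natCast_self, zpow_natCast] at h
  rw [Int.cast_zero, zpow_zero] at h0
  rw [h, ← h0]

lemma zpow_eq_pow_val {G : Type*} [Group G] {p : ℕ} [NeZero p] {g : G} (h : g ^ p = 1) (z : ℤ) :
    g ^ z = g ^ (z : ZMod p).val := by
  rw [zpow_eq_zpow_emod' z h, ← ZMod.val_intCast, zpow_natCast]

lemma map_add_pow_val {G : Type*} [Group G] {p : ℕ} [NeZero p] {g : G} (h : g ^ p = 1)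
    (a b : ZMod p) : g ^ (a + b).val = g ^ a.val * g ^ b.val := by
  obtain ⟨a, rfl⟩ := ZMod.intCast_surjective a
  obtain ⟨b, rfl⟩ := ZMod.intCast_surjective b
  rw [← Int.cast_add, ← zpow_eq_pow_val h, ← zpow_eq_pow_val h, ← zpow_eq_pow_val h, zpow_add]

section Model

variable {p : ℕ}

/-- Left translation by `x ^ s` on the coordinates of the Heisenberg group. -/
def modelX (s : ZMod p) : Equiv.Perm (ZMod p × ZMod p × ZMod p) where
  toFun u := (u.1 + s, u.2.1, u.2.2)
  invFun u := (u.1 - s, u.2.1, u.2.2)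
  left_inv u := by simp
  right_inv u := by simp

/-- Left translation by `y ^ s` on the coordinates of the Heisenberg group. -/
def modelY (s : ZMod p) : Equiv.Perm (ZMod p × ZMod p × ZMod p) where
  toFun u := (u.1, u.2.1 + s, u.2.2)
  invFun u := (u.1, u.2.1 - s, u.2.2)
  left_inv u := by simp
  right_inv u := by simp

/-- Left translation by `z ^ s` on the coordinates of the Heisenberg group. -/
def modelZ (s : ZMod p) : Equiv.Perm (ZMod p × ZMod p × ZMod p) where
  toFun u := (u.1 - s * u.2.1, u.2.1, u.2.2 + s)
  invFun u := (u.1 + s * u.2.1, u.2.1, u.2.2 - s)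
  left_inv u := by simp
  right_inv u := by simp

/-- Conjugation by `w⁻¹` on the coordinates of the Heisenberg group. -/
def modelW [Fact p.Prime] {α k q : ZMod p} (hα : α ≠ 0) (h : α = -(k * q)) :
    Equiv.Perm (ZMod p × ZMod p × ZMod p) where
  toFun u := (α * (u.1 + u.2.1 * u.2.2), q * u.2.2, k * u.2.1)
  invFun u := (α⁻¹ * u.1 - (k⁻¹ * u.2.2) * (q⁻¹ * u.2.1), k⁻¹ * u.2.2, q⁻¹ * u.2.1)
  left_inv u := by
    have hk : k ≠ 0 := by rintro rfl; exact hα (by rw [h]; ring)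
    have hq : q ≠ 0 := by rintro rfl; exact hα (by rw [h]; ring)
    ext <;> simp [hα, hk, hq]
  right_inv u := by
    have hk : k ≠ 0 := by rintro rfl; exact hα (by rw [h]; ring)
    have hq : q ≠ 0 := by rintro rfl; exact hα (by rw [h]; ring)
    ext <;> simp [hα, hk, hq]

lemma modelX_add (a b : ZMod p) : modelX (a + b) = modelX a * modelX b := by
  ext u <;> simp [modelX]; ring

lemma modelY_add (a b : ZMod p) : modelY (a + b) = modelY a * modelY b := by
  ext u <;> simp [modelY]; ring

lemma modelZ_add (a b : ZMod p) : modelZ (a + b) = modelZ a * modelZ b := by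
  ext u <;> simp [modelZ] <;> ring

lemma modelW_pow_two_mul [Fact p.Prime] {α k q : ZMod p} (hα : α ≠ 0) (h : α = -(k * q)) (m : ℕ)
    (u : ZMod p × ZMod p × ZMod p) : (modelW hα h ^ (2 * m)) u =
      (α ^ (2 * m) * u.1, (-α) ^ m * u.2.1, (-α) ^ m * u.2.2) := by
  have hkq : k * q = -α := by rw [h]; ring
  induction m with
  | zero => simp
  | succ m ih =>
    rw [show 2 * (m + 1) = 2 * m + 1 + 1 by ring, pow_succ' _ (2 * m + 1), pow_succ' _ (2 * m),
      Equiv.Perm.mul_apply, Equiv.Perm.mul_apply, ih]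
    simp only [modelW, Equiv.coe_fn_mk, Prod.mk.injEq]
    refine ⟨?_, ?_, ?_⟩
    · linear_combination α * (-α) ^ m * (-α) ^ m * u.2.1 * u.2.2 * hkq
    · linear_combination (-α) ^ m * u.2.1 * hkq
    · linear_combination (-α) ^ m * u.2.2 * hkq

end Model

/-! ### Normal form in the presented group and homomorphisms out of it -/

namespace Gp

variable {p n t : ℕ} {r k q : ℤ}

/-- A homomorphism out of `Gp` from elements satisfying the relations. -/
def lift {A : Type*} [Group A] (x y z w : A) (hx : x ^ p = 1) (hy : y ^ p = 1) (hz : z ^ p = 1)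
    (hw : w ^ 2 ^ n = 1) (hxy : x * y = y * x) (hyz : y * z = z * y * x) (hxz : x * z = z * x)
    (hxw : w⁻¹ * x * w = x ^ r ^ t) (hyw : w⁻¹ * y * w = z ^ k) (hzw : w⁻¹ * z * w = y ^ q) :
    Gp p n t r k q →* A :=
  PresentedGroup.toGroup (f := fun g => match g with
    | .x => x
    | .y => y
    | .z => z
    | .w => w) (by
    intro a ha
    simp only [gpRels, Set.mem_insert_iff, Set.mem_singleton_iff] at ha
    rcases ha with rfl | rfl | rfl | rfl | rfl | rfl | rfl | rfl | rfl | rfl <;>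
      simp only [map_mul, map_inv, map_pow, map_zpow, FreeGroup.lift_apply_of]
    · exact hx
    · exact hy
    · exact hz
    · exact hw
    · rw [hxy, mul_inv_cancel]
    · rw [hyz, mul_inv_cancel]
    · rw [hxz, mul_inv_cancel]
    · rw [hxw, mul_inv_cancel]
    · rw [hyw, mul_inv_cancel]
    · rw [hzw, mul_inv_cancel])

section Relations

variable (p n t r k q)

lemma eq_of_rel {a b : FreeGroup GenName} (h : a * b⁻¹ ∈ gpRels p n t r k q) :
    PresentedGroup.mk (gpRels p n t r k q) a = PresentedGroup.mk (gpRels p n t r k q) b :=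
  PresentedGroup.mk_eq_mk_of_mul_inv_mem h

lemma one_of_rel {a : FreeGroup GenName} (h : a ∈ gpRels p n t r k q) :
    PresentedGroup.mk (gpRels p n t r k q) a = 1 := PresentedGroup.one_of_mem h

lemma x_pow : x p n t r k q ^ p = 1 := one_of_rel p n t r k q (by simp [gpRels])

lemma y_pow : y p n t r k q ^ p = 1 := one_of_rel p n t r k q (by simp [gpRels])

lemma z_pow : z p n t r k q ^ p = 1 := one_of_rel p n t r k q (by simp [gpRels])

lemma w_pow : w p n t r k q ^ 2 ^ n = 1 := one_of_rel p n t r k q (by simp [gpRels])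

lemma commute_x_y : Commute (x p n t r k q) (y p n t r k q) :=
  eq_of_rel p n t r k q (by simp [gpRels])

lemma commute_x_z : Commute (x p n t r k q) (z p n t r k q) :=
  eq_of_rel p n t r k q (by simp [gpRels])

lemma y_mul_z : y p n t r k q * z p n t r k q = z p n t r k q * y p n t r k q * x p n t r k q :=
  eq_of_rel p n t r k q (by simp [gpRels])

lemma conj_x : (w p n t r k q)⁻¹ * x p n t r k q * w p n t r k q = x p n t r k q ^ r ^ t :=
  eq_of_rel p n t r k q (by simp [gpRels])

lemma conj_y : (w p n t r k q)⁻¹ * y p n t r k q * w p n t r k q = z p n t r k q ^ k :=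
  eq_of_rel p n t r k q (by simp [gpRels])

lemma conj_z : (w p n t r k q)⁻¹ * z p n t r k q * w p n t r k q = y p n t r k q ^ q :=
  eq_of_rel p n t r k q (by simp [gpRels])

lemma conj_zpow' (g a : Gp p n t r k q) (m : ℤ) : g⁻¹ * a ^ m * g = (g⁻¹ * a * g) ^ m := by
  have := conj_zpow (a := g⁻¹) (b := a) (i := m)
  rw [inv_inv] at this
  exact this.symm

lemma y_zpow_mul_z_zpow (l m : ℤ) : y p n t r k q ^ l * z p n t r k q ^ m =
    z p n t r k q ^ m * y p n t r k q ^ l * x p n t r k q ^ (l * m) := by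
  set x := x p n t r k q with hx
  set y := y p n t r k q with hy
  set z := z p n t r k q with hz
  have cxy : Commute x y := commute_x_y ..
  have cxz : Commute x z := commute_x_z ..
  have hyz : y * z = z * y * x := y_mul_z ..
  have h1 : z⁻¹ * y ^ l * z = y ^ l * x ^ l := by
    rw [conj_zpow', show z⁻¹ * y * z = y * x by rw [mul_assoc, hyz]; group,
      cxy.symm.mul_zpow]
  have h2 : (y ^ l)⁻¹ * z * y ^ l = z * x ^ (-l) := by
    have h3 : y ^ l * z = z * (y ^ l * x ^ l) := by rw [← h1]; group
    have h4 : z * y ^ l = y ^ l * z * x ^ (-l) := by rw [h3]; group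
    rw [mul_assoc, h4]; group
  have h := conj_zpow' p n t r k q (y ^ l) z m
  rw [h2, (cxz.symm.zpow_right (-l)).mul_zpow, ← zpow_mul] at h
  have h6 : z ^ m * y ^ l = y ^ l * (z ^ m * x ^ (-l * m)) := by rw [← h]; group
  rw [h6]; group

lemma z_zpow_mul_y_zpow (l m : ℤ) : z p n t r k q ^ m * y p n t r k q ^ l =
    x p n t r k q ^ (-(l * m)) * y p n t r k q ^ l * z p n t r k q ^ m := by
  have hc : Commute (x p n t r k q ^ (l * m)) (z p n t r k q ^ m * y p n t r k q ^ l) :=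
    ((commute_x_z p n t r k q).zpow_zpow _ _).mul_right ((commute_x_y p n t r k q).zpow_zpow _ _)
  rw [mul_assoc, y_zpow_mul_z_zpow, ← hc.eq, ← mul_assoc, ← zpow_add, neg_add_cancel, zpow_zero,
    one_mul]

/-- The set of normal forms is stable under left multiplication by generators; finiteness supplies
the inverses. -/
lemma exists_eq_zpow [NeZero p] (g : Gp p n t r k q) : ∃ a b c d : ℤ,
    g = x p n t r k q ^ a * y p n t r k q ^ b * z p n t r k q ^ c * w p n t r k q ^ d := by
  have hx := z_zpow_mul_y_zpow p n t r k q
  have hxw := conj_x p n t r k q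
  have hyw := conj_y p n t r k q
  have hzw := conj_z p n t r k q
  have cxy := commute_x_y p n t r k q
  have cxz := commute_x_z p n t r k q
  have hgen := PresentedGroup.closure_range_of (gpRels p n t r k q)
  have ex : PresentedGroup.of GenName.x = x p n t r k q := rfl
  have ey : PresentedGroup.of GenName.y = y p n t r k q := rfl
  have ez : PresentedGroup.of GenName.z = z p n t r k q := rfl
  have ew : PresentedGroup.of GenName.w = w p n t r k q := rfl
  have hconj := conj_zpow' p n t r k q
  generalize x p n t r k q = x at *
  generalize y p n t r k q = y at *
  generalize z p n t r k q = z at *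
  generalize w p n t r k q = w at *
  let S : Set (Gp p n t r k q) := {g | ∃ a b c d : ℤ, g = x ^ a * y ^ b * z ^ c * w ^ d}
  let T : Submonoid (Gp p n t r k q) :=
    { carrier := {h | ∀ g ∈ S, h * g ∈ S}
      one_mem' := fun g hg => by rwa [one_mul]
      mul_mem' := fun {a b} ha hb g hg => by rw [mul_assoc]; exact ha _ (hb g hg) }
  have hinv : ∀ g ∈ T, g⁻¹ ∈ T := fun g hg => by
    obtain ⟨m, hm⟩ := (isOfFinOrder_of_finite g).mem_powers_iff_mem_zpowers.mpr
      (Subgroup.inv_mem _ (Subgroup.mem_zpowers g))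
    rw [← hm]
    exact T.pow_mem hg m
  have mx : x ∈ T := by
    rintro _ ⟨a, b, c, d, rfl⟩
    exact ⟨a + 1, b, c, d, by rw [add_comm, zpow_one_add]; simp only [mul_assoc]⟩
  have my : y ∈ T := by
    rintro _ ⟨a, b, c, d, rfl⟩
    refine ⟨a, b + 1, c, d, ?_⟩
    rw [add_comm, zpow_one_add, ← mul_assoc (x ^ a), (cxy.zpow_left a).eq]
    simp only [mul_assoc]
  have mz : z ∈ T := by
    rintro _ ⟨a, b, c, d, rfl⟩
    refine ⟨a + -(b * 1), b, 1 + c, d, ?_⟩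
    have h := hx b 1
    rw [zpow_one] at h
    have h1 : x ^ (a + -(b * 1)) * y ^ b * z ^ (1 + c) * w ^ d =
        x ^ a * (x ^ (-(b * 1)) * y ^ b * z) * z ^ c * w ^ d := by
      rw [zpow_add, zpow_one_add]; simp only [mul_assoc]
    rw [h1, ← h, ← mul_assoc (x ^ a), (cxz.zpow_left a).eq]
    simp only [mul_assoc]
  -- The relations describe `w⁻¹ · w`, so it is `w⁻¹` that moves easily past the other factors.
  have mw : w⁻¹ ∈ T := by
    rintro _ ⟨a, b, c, d, rfl⟩
    refine ⟨r ^ t * a + -(q * c * (k * b)), q * c, k * b, -1 + d, ?_⟩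
    have h1 : w⁻¹ * (x ^ a * y ^ b * z ^ c * w ^ d) =
        (w⁻¹ * x ^ a * w) * (w⁻¹ * y ^ b * w) * (w⁻¹ * z ^ c * w) * w ^ (-1 + d) := by
      rw [zpow_add]; group
    rw [h1, hconj, hconj, hconj, hxw, hyw, hzw, ← zpow_mul, ← zpow_mul, ← zpow_mul,
      mul_assoc (x ^ _), hx, zpow_add x]
    simp only [mul_assoc]
  have hT : ∀ g, g ∈ T := by
    intro g
    have hg : g ∈ Subgroup.closure
        (Set.range (PresentedGroup.of : GenName → Gp p n t r k q)) := by
      rw [hgen]; exact Subgroup.mem_top g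
    induction hg using Subgroup.closure_induction with
    | mem a ha =>
      obtain ⟨i, rfl⟩ := ha
      cases i
      · rwa [ex]
      · rwa [ey]
      · rwa [ez]
      · rw [ew, ← inv_inv w]; exact hinv _ mw
    | one => exact T.one_mem
    | mul a b _ _ ha hb => exact T.mul_mem ha hb
    | inv a _ ha => exact hinv a ha
  have := hT g 1 ⟨0, 0, 0, 0, by simp⟩
  rwa [mul_one] at this

end Relations

/-- The exponent of `w`, as a homomorphism. -/
def degree : Gp p n t r k q →* Multiplicative (ZMod (2 ^ n)) :=
  lift 1 1 1 (Multiplicative.ofAdd 1) (one_pow _) (one_pow _) (one_pow _)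
    (by rw [← ofAdd_nsmul, ofAdd_eq_one, nsmul_one, ZMod.natCast_self]) rfl (by simp) rfl
    (by simp) (by simp) (by simp)

/-- The action on the coordinates of the Heisenberg group. -/
def model [Fact p.Prime] (hn : 3 ≤ n) (hα : orderOf ((r : ZMod p) ^ t) = 2 ^ (n - 1))
    (hα0 : (r : ZMod p) ^ t ≠ 0) (h : (r : ZMod p) ^ t = -(k * q)) :
    Gp p n t r k q →* Equiv.Perm (ZMod p × ZMod p × ZMod p) :=
  -- `modelW` realises `g ↦ w⁻¹ g w`, so `w` itself acts by the inverse permutation.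
  lift (modelX 1) (modelY 1) (modelZ 1) (modelW hα0 h)⁻¹
    (pow_card_of_map_add modelX_add) (pow_card_of_map_add modelY_add)
    (pow_card_of_map_add modelZ_add)
    (by
      have h1 : ((r : ZMod p) ^ t) ^ 2 ^ n = 1 := by
        rw [← Nat.sub_add_cancel (show 1 ≤ n by omega), pow_succ, pow_mul, ← hα, pow_orderOf_eq_one, one_pow]
      have h2 : (modelW hα0 h) ^ 2 ^ n = 1 := by
        refine Equiv.ext fun u => ?_
        have h3 : (-((r : ZMod p) ^ t)) ^ 2 ^ (n - 1) = 1 := by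
          rw [Even.neg_pow ((Nat.even_pow' (by omega)).mpr even_two), ← hα, pow_orderOf_eq_one]
        have h4 : 2 ^ n = 2 * 2 ^ (n - 1) := by rw [← pow_succ', Nat.sub_add_cancel (by omega)]
        rw [h4] at h1 ⊢
        rw [modelW_pow_two_mul, h1, h3]
        simp
      rw [inv_pow, h2, inv_one])
    (by ext u <;> simp [modelX, modelY]) (by ext u <;> simp [modelX, modelY, modelZ])
    (by ext u <;> simp [modelX, modelZ]; ring)
    (by
      rw [inv_inv, zpow_of_map_add modelX_add, mul_inv_eq_iff_eq_mul]
      refine Equiv.ext fun u => ?_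
      simp only [modelX, modelW, Equiv.Perm.mul_apply, Equiv.coe_fn_mk, Prod.mk.injEq, and_true]
      push_cast
      ring)
    (by
      rw [inv_inv, zpow_of_map_add modelZ_add, mul_inv_eq_iff_eq_mul]
      ext u <;> simp [modelY, modelZ, modelW]
      · linear_combination u.2.2 * h
      · ring)
    (by
      rw [inv_inv, zpow_of_map_add modelY_add, mul_inv_eq_iff_eq_mul]
      refine Equiv.ext fun u => ?_
      simp only [modelY, modelZ, modelW, Equiv.Perm.mul_apply, Equiv.coe_fn_mk, Prod.mk.injEq,
        and_true]
      exact ⟨by ring, by ring⟩)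

lemma degree_x : degree (x p n t r k q) = 1 := by
  rw [degree, lift, x, PresentedGroup.toGroup.of]

lemma degree_y : degree (y p n t r k q) = 1 := by
  rw [degree, lift, y, PresentedGroup.toGroup.of]

lemma degree_z : degree (z p n t r k q) = 1 := by
  rw [degree, lift, z, PresentedGroup.toGroup.of]

lemma degree_w : degree (w p n t r k q) = Multiplicative.ofAdd 1 := by
  rw [degree, lift, w, PresentedGroup.toGroup.of]

section Values

variable [Fact p.Prime] (hn : 3 ≤ n) (hα : orderOf ((r : ZMod p) ^ t) = 2 ^ (n - 1))
    (hα0 : (r : ZMod p) ^ t ≠ 0) (h : (r : ZMod p) ^ t = -(k * q))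

lemma model_x : model hn hα hα0 h (x p n t r k q) = modelX 1 := by
  rw [model, lift, x, PresentedGroup.toGroup.of]

lemma model_y : model hn hα hα0 h (y p n t r k q) = modelY 1 := by
  rw [model, lift, y, PresentedGroup.toGroup.of]

lemma model_z : model hn hα hα0 h (z p n t r k q) = modelZ 1 := by
  rw [model, lift, z, PresentedGroup.toGroup.of]

end Values

end Gp

/-! ### The frame on the presented group -/

namespace Gp

variable {p n t : ℕ} {r k q : ℤ}

/-- The coordinates on `Gp`. -/
noncomputable def frame [Fact p.Prime] (hp : p ≠ 2) (hn : 3 ≤ n)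
    (hα : orderOf ((r : ZMod p) ^ t) = 2 ^ (n - 1)) (h : (r : ZMod p) ^ t = -(k * q)) :
    HeisenbergFrame (Gp p n t r k q) p n ((r : ZMod p) ^ t) k q where
  X a := x p n t r k q ^ a.val
  Y b := y p n t r k q ^ b.val
  Z c := z p n t r k q ^ c.val
  w := w p n t r k q
  D := degree
  X_add := map_add_pow_val (x_pow ..)
  Y_add := map_add_pow_val (y_pow ..)
  Z_add := map_add_pow_val (z_pow ..)
  X_mul_Y _ _ := ((commute_x_y ..).pow_pow _ _).eq
  X_mul_Z _ _ := ((commute_x_z ..).pow_pow _ _).eq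
  Y_mul_Z b c := by
    obtain ⟨b, rfl⟩ := ZMod.intCast_surjective b
    obtain ⟨c, rfl⟩ := ZMod.intCast_surjective c
    rw [← Int.cast_mul, ← zpow_eq_pow_val (x_pow ..), ← zpow_eq_pow_val (y_pow ..),
      ← zpow_eq_pow_val (z_pow ..), y_zpow_mul_z_zpow]
  conj_X a := by
    obtain ⟨a, rfl⟩ := ZMod.intCast_surjective a
    rw [← Int.cast_pow, ← Int.cast_mul, ← zpow_eq_pow_val (x_pow ..), ← zpow_eq_pow_val (x_pow ..),
      conj_zpow', conj_x, zpow_mul]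
  conj_Y b := by
    obtain ⟨b, rfl⟩ := ZMod.intCast_surjective b
    rw [← Int.cast_mul, ← zpow_eq_pow_val (y_pow ..), ← zpow_eq_pow_val (z_pow ..),
      conj_zpow', conj_y, zpow_mul]
  conj_Z c := by
    obtain ⟨c, rfl⟩ := ZMod.intCast_surjective c
    rw [← Int.cast_mul, ← zpow_eq_pow_val (y_pow ..), ← zpow_eq_pow_val (z_pow ..),
      conj_zpow', conj_z, zpow_mul]
  w_pow := w_pow ..
  D_X a := by rw [map_pow, degree_x, one_pow]
  D_Y a := by rw [map_pow, degree_y, one_pow]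
  D_Z a := by rw [map_pow, degree_z, one_pow]
  D_w := degree_w
  exists_eq g := by
    obtain ⟨a, b, c, d, rfl⟩ := exists_eq_zpow p n t r k q g
    have : NeZero (2 ^ n) := ⟨by positivity⟩
    exact ⟨a, b, c, (d : ZMod (2 ^ n)).val, by
      rw [← zpow_eq_pow_val (x_pow ..), ← zpow_eq_pow_val (y_pow ..), ← zpow_eq_pow_val (z_pow ..),
        ← zpow_eq_pow_val (w_pow ..)]⟩
  eq_zero a b c habc := by
    have hα0 : (r : ZMod p) ^ t ≠ 0 := by
      intro h0
      rw [h0, orderOf_zero] at hα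
      exact absurd hα (by positivity)
    -- The element with coordinates `(a, b, c)` moves the origin to `(a, b, c)`.
    have h1 := congrArg (fun g => model hn hα hα0 h g (0, 0, 0)) habc
    simp only [map_mul, map_pow, model_x, model_y, model_z, ← pow_val_of_map_add modelX_add,
      ← pow_val_of_map_add modelY_add, ← pow_val_of_map_add modelZ_add, map_one] at h1
    simpa [modelX, modelY, modelZ] using h1
  ne_two := hp
  three_le := hn
  alpha_eq := h
  orderOf_alpha := hα

section Identify

variable [Fact p.Prime] (hp : p ≠ 2) (hn : 3 ≤ n)
    (hα : orderOf ((r : ZMod p) ^ t) = 2 ^ (n - 1)) (h : (r : ZMod p) ^ t = -(k * q))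

lemma frame_X_one : (frame hp hn hα h).X 1 = x p n t r k q := by
  change _ ^ (1 : ZMod p).val = _
  rw [ZMod.val_one, pow_one]

lemma frame_Y_one : (frame hp hn hα h).Y 1 = y p n t r k q := by
  change _ ^ (1 : ZMod p).val = _
  rw [ZMod.val_one, pow_one]

lemma frame_v : (frame hp hn hα h).v = w p n t r k q ^ 2 ^ (n - 1) := rfl

lemma P_eq_ker : P p n t r k q = (frame hp hn hα h).D.ker := by
  refine le_antisymm ((Subgroup.closure_le _).mpr ?_) fun g hg => ?_
  · rintro _ (rfl | rfl | rfl)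
    · exact degree_x
    · exact degree_y
    · exact degree_z
  · obtain ⟨a, b, c, rfl⟩ := HeisenbergFrame.exists_E_of_D _ hg
    refine Subgroup.mul_mem _ (Subgroup.mul_mem _ (Subgroup.pow_mem _ ?_ _)
      (Subgroup.pow_mem _ ?_ _)) (Subgroup.pow_mem _ ?_ _) <;>
    exact Subgroup.subset_closure (by simp)

lemma PW_eq_level (i : ℕ) : PW p n t r k q i = (frame hp hn hα h).level i := by
  rw [PW, P_eq_ker hp hn hα h]
  set F := frame hp hn hα h with hF
  have hw : w p n t r k q = F.w := rfl
  rw [hw]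
  refine le_antisymm (sup_le (F.ker_le_level i) ?_) fun g hg => ?_
  · rw [Subgroup.zpowers_le, HeisenbergFrame.level, Subgroup.mem_comap]
    exact Subgroup.mem_zpowers _
  · obtain ⟨z, hz⟩ := Subgroup.mem_zpowers_iff.mp hg
    rw [← map_zpow] at hz
    have h1 : g * ((F.w ^ 2 ^ i) ^ z)⁻¹ ∈ F.D.ker := by
      rw [MonoidHom.mem_ker, map_mul, map_inv, hz, mul_inv_cancel]
    have h2 := Subgroup.mul_mem_sup h1
      (Subgroup.zpow_mem_zpowers (F.w ^ 2 ^ i) z)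
    rwa [inv_mul_cancel_right] at h2

lemma XZY_eq_line (j : ℕ) : XZY p n t r k q j = (frame hp hn hα h).line j := by
  have hX := frame_X_one hp hn hα h
  have hY := frame_Y_one hp hn hα h
  have hZ : (frame hp hn hα h).Z j = z p n t r k q ^ j := by
    change _ ^ (j : ZMod p).val = _
    rw [← Int.cast_natCast, ← zpow_eq_pow_val (z_pow ..), zpow_natCast]
  set F := frame hp hn hα h with hF
  have hzy : z p n t r k q ^ j * y p n t r k q = F.E (-(j : ZMod p)) 1 j := by
    rw [← hZ, ← hY, F.Z_eq, F.Y_eq, F.E_mul]; congr 1 <;> ring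
  rw [XZY, hzy, ← hX]
  refine le_antisymm ((Subgroup.closure_le _).mpr ?_) ?_
  · rintro _ (rfl | rfl)
    · exact F.X_mem_line 1 j
    · exact F.E_mem_line.mpr (mul_one _).symm
  · rintro _ ⟨a, b, rfl⟩
    have h1 := F.E_mem_of_mul (H := Subgroup.closure {F.X 1, F.E (-(j : ZMod p)) 1 j})
      (Subgroup.subset_closure (by simp)) (a := -(j : ZMod p)) (b := 1) (c := j)
      (Subgroup.subset_closure (by simp)) b a
    rwa [mul_one, mul_comm b] at h1

lemma Q_eq_big : Q p n t r k q = (frame hp hn hα h).big := by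
  have hX := frame_X_one hp hn hα h
  have hY := frame_Y_one hp hn hα h
  rw [Q, ← frame_v hp hn hα h]
  set F := frame hp hn hα h with hF
  refine le_antisymm ((Subgroup.closure_le _).mpr ?_) ?_
  · rintro _ (rfl | rfl | rfl)
    · rw [← hX, F.X_eq]; exact F.E_mem_big.mpr rfl
    · rw [← hY, F.Y_eq]; exact F.E_mem_big.mpr rfl
    · have h1 := (F.E_mul_v_mem_big (a := 0) (b := 0) (c := 0)).mpr rfl
      rwa [F.E_zero, one_mul] at h1
  · have h1 : ∀ a b, F.E a b 0 ∈
        Subgroup.closure {x p n t r k q, y p n t r k q, F.v} := by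
      intro a b
      rw [HeisenbergFrame.E, F.Z_zero, mul_one]
      refine Subgroup.mul_mem _ (Subgroup.pow_mem _ ?_ _) (Subgroup.pow_mem _ ?_ _) <;>
      exact Subgroup.subset_closure (by simp)
    rintro _ ⟨a, b, rfl | rfl⟩
    · exact h1 a b
    · exact Subgroup.mul_mem _ (h1 a b) (Subgroup.subset_closure (by simp))

lemma closure_y_eq_small : Subgroup.closure {y p n t r k q} = (frame hp hn hα h).small := by
  have hY := frame_Y_one hp hn hα h
  set F := frame hp hn hα h with hF
  refine le_antisymm ((Subgroup.closure_le _).mpr ?_) ?_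
  · rintro _ rfl
    rw [← hY, F.Y_eq]; exact F.E_mem_small.mpr ⟨rfl, rfl⟩
  · rintro _ ⟨b, rfl⟩
    rw [← F.Y_eq]
    exact Subgroup.pow_mem _ (Subgroup.subset_closure (by simp)) _

lemma closure_y_w_eq_smallV : Subgroup.closure {y p n t r k q, w p n t r k q ^ 2 ^ (n - 1)} =
    (frame hp hn hα h).smallV := by
  have hY := frame_Y_one hp hn hα h
  rw [← frame_v hp hn hα h]
  set F := frame hp hn hα h with hF
  refine le_antisymm ((Subgroup.closure_le _).mpr ?_) ?_
  · rintro _ (rfl | rfl)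
    · rw [← hY, F.Y_eq]; exact F.E_mem_smallV.mpr ⟨rfl, rfl⟩
    · have h1 := (F.E_mul_v_mem_smallV (a := 0) (b := 0) (c := 0)).mpr ⟨rfl, rfl⟩
      rwa [F.E_zero, one_mul] at h1
  · have h1 : ∀ b, F.E 0 b 0 ∈ Subgroup.closure {y p n t r k q, F.v} := by
      intro b
      rw [← F.Y_eq]
      exact Subgroup.pow_mem _ (Subgroup.subset_closure (by simp)) _
    rintro _ ⟨b, rfl | rfl⟩
    · exact h1 b
    · exact Subgroup.mul_mem _ (h1 b) (Subgroup.subset_closure (by simp))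

lemma pairs_eq_listed (J : Finset ℕ) : pairs p n t r k q J =
    (frame hp hn hα h).listed (J.image (Nat.cast : ℕ → ZMod p)) := by
  ext s
  simp only [pairs, HeisenbergFrame.listed, PW_eq_level hp hn hα h, XZY_eq_line hp hn hα h,
    P_eq_ker hp hn hα h, Q_eq_big hp hn hα h, closure_y_eq_small hp hn hα h,
    closure_y_w_eq_smallV hp hn hα h, Finset.coe_image, Set.mem_image, Finset.mem_coe,
    exists_exists_and_eq_and]

end Identify

end Gp

/-! ### Counting slopes, and conclusion -/

/-- The map `s ↦ k / (q * s)` is an involution of the nonzero residues without fixed points, and `S`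
takes one element from each of its orbits. -/
lemma two_mul_card_of_transversal {p : ℕ} [Fact p.Prime] {k q : ZMod p} (hk : k ≠ 0) (hq : q ≠ 0)
    {S : Finset (ZMod p)} (h0 : (0 : ZMod p) ∉ S)
    (hcov : ∀ s, s ≠ 0 → ∃ i ∈ S, s = i ∨ q * s * i = k)
    (huniq : ∀ i ∈ S, ∀ j ∈ S, q * i * j = k → i = j) (hns : ∀ s : ZMod p, q * s * s ≠ k) :
    2 * S.card = p - 1 := by
  classical
  have hS : ∀ s ∈ S, s ≠ 0 := fun s hs h => h0 (h ▸ hs)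
  have hτ : ∀ s ∈ S, q * (k / (q * s)) * s = k := fun s hs => by
    have := hS s hs
    field_simp
  have hinj : Set.InjOn (fun s => k / (q * s)) (S : Set (ZMod p)) := by
    intro s hs s' hs' h
    have h1 := hτ s hs
    have h2 := hτ s' hs'
    have h3 : k / (q * s) ≠ 0 := div_ne_zero hk (mul_ne_zero hq (hS s hs))
    simp only at h
    rw [← h] at h2
    exact mul_left_cancel₀ (mul_ne_zero hq h3) (h1.trans h2.symm)
  have hdisj : Disjoint S (S.image fun s => k / (q * s)) := by
    rw [Finset.disjoint_left]
    intro a ha ha'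
    obtain ⟨s, hs, rfl⟩ := Finset.mem_image.mp ha'
    have h1 := huniq _ ha s hs (hτ s hs)
    have h2 := hτ s hs
    rw [h1] at h2
    exact hns s h2
  have hunion : S ∪ S.image (fun s => k / (q * s)) = Finset.univ.erase 0 := by
    ext s
    rw [Finset.mem_union, Finset.mem_image, Finset.mem_erase]
    constructor
    · rintro (h | ⟨i, hi, rfl⟩)
      · exact ⟨hS s h, Finset.mem_univ _⟩
      · exact ⟨div_ne_zero hk (mul_ne_zero hq (hS i hi)), Finset.mem_univ _⟩
    · rintro ⟨hs, -⟩
      obtain ⟨i, hi, rfl | h⟩ := hcov s hs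
      · exact Or.inl hi
      · refine Or.inr ⟨i, hi, ?_⟩
        rw [div_eq_iff (mul_ne_zero hq (hS i hi)), ← h]
        ring
  have h := congrArg Finset.card hunion
  rw [Finset.card_union_of_disjoint hdisj, Finset.card_image_of_injOn hinj,
    Finset.card_erase_of_mem (Finset.mem_univ _), Finset.card_univ, ZMod.card] at h
  omega

/-- A solution would give `(q * s)² = -α`, so the power `2^(n-1)` of `q * s` would be `-1`; as `t`
is odd, this contradicts Fermat's little theorem. -/
lemma HeisenbergFrame.mul_self_ne {G : Type} [Group G] {p n t : ℕ} {α k q : ZMod p}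
    [Fact p.Prime] (F : HeisenbergFrame G p n α k q) (ht : Odd t) (hpt : p - 1 = 2 ^ (n - 1) * t)
    (s : ZMod p) : q * s * s ≠ k := by
  intro hs
  have hn := F.three_le
  have h0 : q * s ≠ 0 := by
    intro h
    rw [h, zero_mul] at hs
    exact F.k_ne_zero hs.symm
  have h1 : (q * s) ^ 2 = -α := by
    rw [← F.neg_alpha_eq, ← hs]; ring
  have h2 : (q * s) ^ 2 ^ (n - 1) = -1 := by
    rw [show 2 ^ (n - 1) = 2 * 2 ^ (n - 2) by rw [← pow_succ']; congr 1; omega, pow_mul, h1,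
      F.alpha_pow_half]
  have h3 := ZMod.pow_card_sub_one_eq_one h0
  rw [hpt, pow_mul, h2, ht.neg_one_pow] at h3
  apply F.two_ne_zero'
  linear_combination -h3

theorem mainTheorem6 (p n t : ℕ) (r k q : ℤ) [Fact p.Prime] (hp2 : Odd p) (hp4 : p % 4 = 1)
    (hn : 3 ≤ n) (ht : Odd t) (hpt : p - 1 = 2 ^ (n - 1) * t)
    (hr : orderOf (r : ZMod p) = p - 1) (hkq : r ^ t ≡ -(k * q) [ZMOD p])
    (J' : Finset ℕ) (hJ' : Gp.IsTransversal p n t r k q J') :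
    IsGeneralizedStronglyMonomialGroup (Gp p n t r k q) ∧
    (insert 0 J').card = (p + 1) / 2 ∧
    IsCompleteIrredundantShodaSet (Gp.pairs p n t r k q (insert 0 J')) ∧
    (Gp.pairs p n t r k q (insert 0 J')).ncard = (n + 1) + (p + 1) / 2 + 2 := by
  have hp : p ≠ 2 := by rintro rfl; exact absurd hp2 (by decide)
  have hα : orderOf ((r : ZMod p) ^ t) = 2 ^ (n - 1) := by
    rw [orderOf_pow' _ ht.pos.ne', hr, hpt, Nat.gcd_mul_left_left, Nat.mul_div_cancel _ ht.pos]
  have h : (r : ZMod p) ^ t = -(k * q) := by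
    have := (ZMod.intCast_eq_intCast_iff _ _ p).mpr hkq
    exact_mod_cast this
  let F := Gp.frame hp hn hα h
  obtain ⟨hsub, htrans⟩ := hJ'
  simp_rw [Gp.XZY_eq_line hp hn hα h, (Gp.frame hp hn hα h).map_conj_line_iff] at htrans
  set J := (insert 0 J').image (Nat.cast : ℕ → ZMod p) with hJ
  have hlt : ∀ i ∈ insert 0 J', i < p := by
    intro i hi
    rcases Finset.mem_insert.mp hi with rfl | hi
    · exact (Fact.out : p.Prime).pos
    · have := Finset.mem_Icc.mp (hsub hi)
      omega
  have hcast : ∀ i ∈ insert 0 J', ∀ j ∈ insert 0 J', (i : ZMod p) = j → i = j := by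
    intro i hi j hj hij
    rw [ZMod.natCast_eq_natCast_iff] at hij
    exact Nat.ModEq.eq_of_lt_of_lt hij (hlt i hi) (hlt j hj)
  have huniq' : ∀ i ∈ J', ∀ j ∈ J', (q : ZMod p) * i * j = k → i = j := by
    intro i hi j hj hij
    -- Both `i` and `j` represent the class of `i`.
    obtain ⟨_, -, hu⟩ := htrans i (hsub hi)
    exact (hu i ⟨hi, Or.inl rfl⟩).trans (hu j ⟨hj, Or.inr hij⟩).symm
  have huniq : ∀ i ∈ J, ∀ j ∈ J, (q : ZMod p) * i * j = k → i = j := by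
    intro i' hi' j' hj' hij
    obtain ⟨i, hi, rfl⟩ := Finset.mem_image.mp hi'
    obtain ⟨j, hj, rfl⟩ := Finset.mem_image.mp hj'
    rcases Finset.mem_insert.mp hi with rfl | hi
    -- Slope `0` is conjugate to no other slope, since `k ≠ 0`.
    · exact absurd hij.symm (by simpa using F.k_ne_zero)
    rcases Finset.mem_insert.mp hj with rfl | hj
    · exact absurd hij.symm (by simpa using F.k_ne_zero)
    rw [huniq' i hi j hj hij]
  have hcov' : ∀ s : ZMod p, s ≠ 0 → ∃ i ∈ J'.image (Nat.cast : ℕ → ZMod p),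
      s = i ∨ (q : ZMod p) * s * i = k := by
    intro s hs
    have h1 := ZMod.val_lt s
    have h2 : s.val ≠ 0 := (ZMod.val_ne_zero s).mpr hs
    obtain ⟨i, ⟨hi, his⟩, -⟩ := htrans s.val (Finset.mem_Icc.mpr (by omega))
    rw [ZMod.natCast_val, ZMod.cast_id] at his
    exact ⟨i, Finset.mem_image_of_mem _ hi, his⟩
  have hcov : ∀ s : ZMod p, ∃ i ∈ J, s = i ∨ (q : ZMod p) * s * i = k := by
    intro s
    by_cases hs : s = 0
    · exact ⟨0, Finset.mem_image.mpr ⟨0, Finset.mem_insert_self _ _, Nat.cast_zero⟩, Or.inl hs⟩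
    · obtain ⟨i, hi, his⟩ := hcov' s hs
      exact ⟨i, Finset.image_subset_image (Finset.subset_insert _ _) hi, his⟩
  have h0 : 0 ∉ J' := fun h0 => absurd (Finset.mem_Icc.mp (hsub h0)).1 (by norm_num)
  have h0' : (0 : ZMod p) ∉ J'.image (Nat.cast : ℕ → ZMod p) := by
    intro hmem
    obtain ⟨i, hi, hi0⟩ := Finset.mem_image.mp hmem
    have := hcast i (Finset.mem_insert_of_mem hi) 0 (Finset.mem_insert_self _ _)
      (by rw [hi0, Nat.cast_zero])
    exact h0 (this ▸ hi)
  have hcard := two_mul_card_of_transversal F.k_ne_zero F.q_ne_zero h0' hcov' (by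
    intro i hi j hj
    exact huniq i (Finset.image_subset_image (Finset.subset_insert _ _) hi) j
      (Finset.image_subset_image (Finset.subset_insert _ _) hj)) (F.mul_self_ne ht hpt)
  rw [Finset.card_image_of_injOn fun i hi j hj => hcast i (Finset.mem_insert_of_mem hi) j
    (Finset.mem_insert_of_mem hj)] at hcard
  have hcard' : (insert 0 J').card = (p + 1) / 2 := by
    rw [Finset.card_insert_of_notMem h0]
    have := (Fact.out : p.Prime).two_le
    omega
  have hpairs := Gp.pairs_eq_listed hp hn hα h (insert 0 J')
  rw [← hJ] at hpairs
  refine ⟨F.isGeneralizedStronglyMonomialGroup, hcard', ?_, ?_⟩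
  · rw [hpairs]
    exact ⟨fun s hs => F.isShodaPair_of_mem_listed hs,
      fun H K hHK => F.exists_shodaEquivalent_listed (J := (J : Set (ZMod p))) hcov hHK,
      F.pairwise_listed huniq⟩
  · rw [hpairs, F.ncard_listed huniq, hJ, Finset.card_image_of_injOn fun i hi j hj => hcast i hi j hj,
      hcard']
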